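/- Let $\mathsf{TV}(P,Q)=\sup_A|P(A)-Q(A)|$ (supremum over measurable sets; half the $L^1$ distance of the densities when these exist). **Setting.** Let $d\ge 1$, $K\ge 1$, $T\ge 2$ be integers and let $X_0\sim p_{\mathsf{data}}$ be a random vector in $\mathbb R^d$. The cumulative learning rates $\overline\alpha_t$ and the learning rates $\alpha_t$ are defined by $$\overline\alpha_T=T^{-c_0},\qquad \overline\alpha_{t-1}=\overline\alpha_t+c_1\frac{\log T}{T}\,\overline\alpha_t(1-\overline\alpha_t)\quad(t=T,\dots,2),\qquad \overline\alpha_t=\prod_{k=1}^t\alpha_k .$$ The forward process has marginals $X_t\overset{d}{=}\sqrt{\overline\alpha_t}\,X_0+\sqrt{1-\overline\alpha_t}\,W$ with $W\sim\mathcal N(0,I_d)$ independent of $X_0$, and $s_t^\star=\nabla\log p_{X_t}$ denotes its score, $p_{X_t}$ being the smooth Lebesgue density of $X_t$. Given measurable score estimates $s_t:\mathbb R^d\to\mathbb R^d$ ($1\le t\le T$), let $\widehat s_t(x)=s_t(x)$ if $\|s_t(x)\|_2\le C_{\mathsf{clip}}\sqrt{d\log(dT)/(1-\overline\alpha_t)}$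 and $\widehat s_t(x)=0$ otherwise. The DDPM sampler starts from $Y_T\sim\mathcal N(0,I_d)$, sets $$Y_{t-1}=\frac1{\sqrt{\alpha_t}}\bigl(Y_t+(1-\alpha_t)\widehat s_t(Y_t)\bigr)+\sqrt{1-\alpha_t}\,Z_t,\qquad t=T,\dots,2,$$ with $Z_t\sim\mathcal N(0,I_d)$ independent of each other and of $Y_T$, and outputs $Y_1$. **Assumptions.** (i) There are weights $\pi_k>0$ with $\sum_{k=1}^K\pi_k=1$ and means $\mu_k\in\mathbb R^d$ with $\max_k\|\mu_k\|_2\le T^{c_R}$ such that $\mathsf{TV}\bigl(p_{\mathsf{data}},\sum_{k=1}^K\pi_k\mathcal N(\mu_k,I_d)\bigr)\le\varepsilon_{\mathsf{apprx}}$. (ii) $\frac1T\sum_{t=1}^T\mathbb E\|s_t(X_t)-s_t^\star(X_t)\|_2^2\le\varepsilon_{\mathsf{score}}^2$, where $\varepsilon_{\mathsf{score}}\ge 0$. **Theorem 1.** For every $c_R>0$ there is $m>0$ such that for all $c_0,c_1,C_{\mathsf{clip}}\ge m$ with $c_1/c_0>4$ there is a constant $C>0$, depending only on $c_R,c_0,c_1,C_{\mathsf{clip}}$,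 for which the following hold. (a) For all $d$, $K$, $T$, all target distributions and all score estimates as above satisfying (i) and (ii), $$\mathsf{TV}(X_0,Y_1)\le C\Bigl(\frac{\log^2(KT)\log^2T}{T}+\varepsilon_{\mathsf{score}}\sqrt{\log T}+\sqrt{d\,\varepsilon_{\mathsf{apprx}}}\,\log^{3/2}(dT)\Bigr).$$ (b) In particular, DDPM needs only $\widetilde O(1/\varepsilon)$ iterations, with no dependence on $d$ and only a logarithmic one on $K$: if the target is exactly a mixture $\sum_{k=1}^K\pi_k\mathcal N(\mu_k,I_d)$ with $\pi_k>0$, $\sum_k\pi_k=1$, $\max_k\|\mu_k\|_2\le T^{c_R}$, if the score error in (ii) is $0$, and if $0<\varepsilon<1$, then $\mathsf{TV}(X_0,Y_1)\le\varepsilon$ as soon as $T\ge C\,\log^4(eK/\varepsilon)/\varepsilon$. -/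

import Mathlib

open MeasureTheory ProbabilityTheory

noncomputable section

namespace DDPM

/-- `ℝ^d` with the Euclidean norm. -/
abbrev E (d : ℕ) : Type := EuclideanSpace ℝ (Fin d)

/-- Total variation distance of two probability measures, `sup_A |μ(A) - ν(A)|`
over measurable sets (it equals half of the `L¹` distance of densities when these exist). -/
def tvDist {Ω : Type*} [MeasurableSpace Ω] (μ ν : Measure Ω) : ℝ :=
  ⨆ A : {A : Set Ω // MeasurableSet A}, |μ.real A - ν.real A|

/-- The isotropic Gaussian mixture `∑ k, w k • N(m k, I_d)`. -/
def gmm {d K : ℕ} (w : Fin K → ℝ) (m : Fin K → E d) : Measure (E d) :=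
  ∑ k, ENNReal.ofReal (w k) • (stdGaussian (E d)).map (fun z => m k + z)

/-- The cumulative learning rates, indexed backwards from time `T`:
`alphaBarRev c₀ c₁ T n` is the value at time `T - n`. -/
def alphaBarRev (c₀ c₁ : ℝ) (T : ℕ) : ℕ → ℝ
  | 0 => 1 / (T : ℝ) ^ c₀
  | n + 1 => alphaBarRev c₀ c₁ T n +
      c₁ * (Real.log T / T) * alphaBarRev c₀ c₁ T n * (1 - alphaBarRev c₀ c₁ T n)

/-- The cumulative product of the learning rates up to time `t ≤ T`
(the empty product `1` at `t = 0`). -/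
def alphaBar (c₀ c₁ : ℝ) (T t : ℕ) : ℝ :=
  if t = 0 then 1 else alphaBarRev c₀ c₁ T (T - t)

/-- The learning rate at time `t ≥ 1`, recovered from the cumulative products. -/
def alpha (c₀ c₁ : ℝ) (T t : ℕ) : ℝ :=
  alphaBar c₀ c₁ T t / alphaBar c₀ c₁ T (t - 1)

/-- The law of `√a X₀ + √(1 - a) W` with `X₀ ∼ ρ` and an independent `W ∼ N(0, I_d)`.
For `a = alphaBar c₀ c₁ T t` this is the law of `X_t` in the forward process. -/
def forwardLaw {d : ℕ} (ρ : Measure (E d)) (a : ℝ) : Measure (E d) :=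
  (ρ.prod (stdGaussian (E d))).map
    (fun p : E d × E d => Real.sqrt a • p.1 + Real.sqrt (1 - a) • p.2)

/-- The Lebesgue density of `N(m, v I_d)`. -/
def gaussDensity {d : ℕ} (m : E d) (v : ℝ) (x : E d) : ℝ :=
  (Real.sqrt (2 * Real.pi * v))⁻¹ ^ d * Real.exp (-‖x - m‖ ^ 2 / (2 * v))

/-- The smooth Lebesgue density of `forwardLaw ρ a`, see `forwardLaw_eq_withDensity`. -/
def forwardDensity {d : ℕ} (ρ : Measure (E d)) (a : ℝ) (x : E d) : ℝ :=
  ∫ x₀, gaussDensity (Real.sqrt a • x₀) (1 - a) x ∂ρ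

theorem measurable_gaussDensity {d : ℕ} (c v : ℝ) :
    Measurable (fun p : E d × E d => gaussDensity (c • p.1) v p.2) := by
  unfold gaussDensity
  fun_prop

theorem gaussDensity_nonneg {d : ℕ} (m : E d) (v : ℝ) (x : E d) : 0 ≤ gaussDensity m v x := by
  unfold gaussDensity
  positivity

theorem integrable_gaussDensity_zero {d : ℕ} {v : ℝ} (hv : 0 < v) :
    Integrable (fun x : E d => gaussDensity 0 v x) := by
  have h := (GaussianFourier.integrable_cexp_neg_mul_sq_norm_add (V := E d)
    (b := ((1 / (2 * v) : ℝ) : ℂ)) (by simpa using hv) 0 0).norm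
  refine (h.const_mul ((Real.sqrt (2 * Real.pi * v))⁻¹ ^ d)).congr (.of_forall fun x => ?_)
  simp only [gaussDensity, sub_zero, zero_mul, add_zero]
  rw [← Complex.ofReal_pow, ← Complex.ofReal_neg, ← Complex.ofReal_mul, Complex.norm_exp,
    Complex.ofReal_re]
  ring_nf

/-- `gaussDensity m v` is the density of `m + √v W` with `W ∼ N(0, I_d)`. -/
theorem map_stdGaussian_eq_withDensity {d : ℕ} (m : E d) {v : ℝ} (hv : 0 < v) :
    (stdGaussian (E d)).map (fun z => m + Real.sqrt v • z) =
      volume.withDensity (fun x => ENNReal.ofReal (gaussDensity m v x)) := by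
  have hint : Integrable (fun x : E d => gaussDensity m v x) := by
    refine ((integrable_gaussDensity_zero hv).comp_sub_right m).congr (.of_forall fun x => ?_)
    simp [gaussDensity]
  have hmeas : Measurable (fun x : E d => ENNReal.ofReal (gaussDensity m v x)) := by
    unfold gaussDensity; fun_prop
  have : IsProbabilityMeasure
      ((stdGaussian (E d)).map (fun z => m + Real.sqrt v • z)) :=
    Measure.isProbabilityMeasure_map (by fun_prop)
  have := isFiniteMeasure_withDensity_ofReal hint.2
  refine Measure.ext_of_charFun (funext fun t => ?_)
  have h1 : charFun ((stdGaussian (E d)).map (fun z => m + Real.sqrt v • z)) t =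
      Complex.exp (-(v * ‖t‖ ^ 2 : ℝ) / 2) * Complex.exp ((inner ℝ m t : ℝ) * Complex.I) := by
    have : (fun z : E d => m + Real.sqrt v • z) = (fun x => m + x) ∘ (fun z => Real.sqrt v • z) :=
      rfl
    rw [this, ← Measure.map_map (by fun_prop) (by fun_prop), charFun_map_const_add,
      charFun_map_smul, charFun_stdGaussian, norm_smul, Real.norm_of_nonneg (Real.sqrt_nonneg _)]
    congr 3
    push_cast
    rw [mul_pow, ← Complex.ofReal_pow, Real.sq_sqrt hv.le]
  rw [h1, charFun_apply, integral_withDensity_eq_integral_toReal_smul hmeas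
    (.of_forall fun x => ENNReal.ofReal_lt_top),
    ← integral_add_right_eq_self _ m]
  have hb : 0 < (((1 / (2 * v) : ℝ) : ℂ)).re := by simpa using hv
  have key := GaussianFourier.integral_cexp_neg_mul_sq_norm_add (V := E d) hb Complex.I t
  have hfun : ∀ x : E d, (ENNReal.ofReal (gaussDensity m v (x + m))).toReal •
      Complex.exp ((inner ℝ (x + m) t : ℝ) * Complex.I) =
      (((Real.sqrt (2 * Real.pi * v))⁻¹ ^ d : ℝ) *
        Complex.exp ((inner ℝ m t : ℝ) * Complex.I)) *
      Complex.exp (-((1 / (2 * v) : ℝ) : ℂ) * ‖x‖ ^ 2 + Complex.I * (inner ℝ t x : ℝ)) := by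
    intro x
    rw [ENNReal.toReal_ofReal (gaussDensity_nonneg _ _ _), gaussDensity, add_sub_cancel_right,
      Complex.real_smul, Complex.ofReal_mul, Complex.ofReal_exp, mul_assoc (Complex.ofReal _),
      mul_assoc (Complex.ofReal _), ← Complex.exp_add, ← Complex.exp_add, inner_add_left,
      real_inner_comm t x]
    congr 2
    push_cast
    field_simp
    ring
  simp_rw [hfun]
  rw [integral_const_mul, key]
  have hc : (((Real.sqrt (2 * Real.pi * v))⁻¹ ^ d : ℝ) : ℂ) *
      ((Real.pi : ℂ) / ((1 / (2 * v) : ℝ) : ℂ)) ^ ((Module.finrank ℝ (E d) : ℂ) / 2) = 1 := by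
    have e1 : (Real.pi : ℂ) / ((1 / (2 * v) : ℝ) : ℂ) = ((2 * Real.pi * v : ℝ) : ℂ) := by
      push_cast
      field_simp
    have e2 : ((Module.finrank ℝ (E d) : ℂ) / 2) = ((d / 2 : ℝ) : ℂ) := by
      rw [finrank_euclideanSpace_fin]; push_cast; rfl
    rw [e1, e2, ← Complex.ofReal_cpow (by positivity), ← Complex.ofReal_mul]
    have e3 : (2 * Real.pi * v) ^ ((d : ℝ) / 2) = Real.sqrt (2 * Real.pi * v) ^ d := by
      rw [Real.sqrt_eq_rpow, ← Real.rpow_natCast, ← Real.rpow_mul (by positivity)]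
      congr 1; ring
    rw [e3, inv_pow, inv_mul_cancel₀ (by positivity), Complex.ofReal_one]
  have he : Complex.I ^ 2 * (‖t‖ : ℂ) ^ 2 / (4 * ((1 / (2 * v) : ℝ) : ℂ)) =
      -(v * ‖t‖ ^ 2 : ℝ) / 2 := by
    have : (v : ℂ) ≠ 0 := by exact_mod_cast hv.ne'
    rw [Complex.I_sq]
    push_cast
    field_simp
    ring
  rw [he]
  linear_combination (-Complex.exp (-(v * ‖t‖ ^ 2 : ℝ) / 2) *
    Complex.exp ((inner ℝ m t : ℝ) * Complex.I)) * hc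

theorem forwardLaw_eq_withDensity {d : ℕ} (ρ : Measure (E d)) [IsProbabilityMeasure ρ] {a : ℝ}
    (ha : a < 1) :
    forwardLaw ρ a = volume.withDensity (fun x => ENNReal.ofReal (forwardDensity ρ a x)) := by
  have hv : 0 < 1 - a := by linarith
  have hm := measurable_gaussDensity (d := d) (Real.sqrt a) (1 - a)
  ext A hA
  rw [forwardLaw, Measure.map_apply (by fun_prop) hA, Measure.prod_apply (by measurability),
    withDensity_apply _ hA]
  have h1 : ∀ x₀ : E d, stdGaussian (E d) (Prod.mk x₀ ⁻¹'
      ((fun p : E d × E d => Real.sqrt a • p.1 + Real.sqrt (1 - a) • p.2) ⁻¹' A)) =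
      ∫⁻ x in A, ENNReal.ofReal (gaussDensity (Real.sqrt a • x₀) (1 - a) x) := by
    intro x₀
    rw [← withDensity_apply _ hA, ← map_stdGaussian_eq_withDensity _ hv,
      Measure.map_apply (by fun_prop) hA]
    rfl
  simp_rw [h1]
  rw [lintegral_lintegral_swap hm.ennreal_ofReal.aemeasurable]
  refine lintegral_congr fun x => ?_
  rw [forwardDensity, ofReal_integral_eq_lintegral_ofReal _
    (.of_forall fun _ => gaussDensity_nonneg _ _ _)]
  refine Integrable.of_bound (C := (Real.sqrt (2 * Real.pi * (1 - a)))⁻¹ ^ d)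
    (hm.comp (by fun_prop : Measurable fun x₀ : E d => (x₀, x))).aestronglyMeasurable
    (.of_forall fun x₀ => ?_)
  rw [Real.norm_of_nonneg (gaussDensity_nonneg _ _ _), gaussDensity]
  refine mul_le_of_le_one_right (by positivity) (Real.exp_le_one_iff.mpr ?_)
  rw [neg_div, neg_nonpos]
  positivity

/-- The score function `∇ log p` of the noised distribution. -/
def score {d : ℕ} (ρ : Measure (E d)) (a : ℝ) (x : E d) : E d :=
  gradient (fun y => Real.log (forwardDensity ρ a y)) x

/-- The time-averaged mean squared error
`(1/T) ∑_{t=1}^T 𝔼 ‖s_t(X_t) - ∇ log p_{X_t}(X_t)‖²` of the score estimates `s`. -/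
def scoreError {d : ℕ} (c₀ c₁ : ℝ) (T : ℕ) (ρ : Measure (E d)) (s : ℕ → E d → E d) :
    ENNReal :=
  (∑ t ∈ Finset.Icc 1 T,
    ∫⁻ x, ENNReal.ofReal (‖s t x - score ρ (alphaBar c₀ c₁ T t) x‖ ^ 2)
      ∂(forwardLaw ρ (alphaBar c₀ c₁ T t))) / (T : ENNReal)

open Classical in
/-- Hard clipping: keep the vector if its norm is at most `R`, otherwise return `0`. -/
def clip {d : ℕ} (R : ℝ) (v : E d) : E d := if ‖v‖ ≤ R then v else 0

/-- The clipped score estimates, with radius `C √(d log(dT) / (1 - ᾱ_t))`. -/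
def clippedScore {d : ℕ} (c₀ c₁ Cclip : ℝ) (T : ℕ) (s : ℕ → E d → E d) (t : ℕ) (x : E d) :
    E d :=
  clip (Cclip * Real.sqrt (d * Real.log (d * T) / (1 - alphaBar c₀ c₁ T t))) (s t x)

/-- One step of the sampler: the law of `(Y + (1 - a) g(Y)) / √a + √(1 - a) Z`
with `Y ∼ ν` and an independent `Z ∼ N(0, I_d)`. -/
def ddpmStep {d : ℕ} (a : ℝ) (g : E d → E d) (ν : Measure (E d)) : Measure (E d) :=
  (ν.prod (stdGaussian (E d))).map
    (fun p : E d × E d =>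
      (1 / Real.sqrt a) • (p.1 + (1 - a) • g p.1) + Real.sqrt (1 - a) • p.2)

/-- The law of `Y_{T-n}`, the state of the sampler after `n` steps started from
`Y_T ∼ N(0, I_d)`; the step from `Y_t` to `Y_{t-1}` uses `α_t` and the clipped score at `t`. -/
def ddpmLaw {d : ℕ} (c₀ c₁ Cclip : ℝ) (T : ℕ) (s : ℕ → E d → E d) : ℕ → Measure (E d)
  | 0 => stdGaussian (E d)
  | n + 1 => ddpmStep (alpha c₀ c₁ T (T - n)) (clippedScore c₀ c₁ Cclip T s (T - n))
      (ddpmLaw c₀ c₁ Cclip T s n)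

/-- The law of the output `Y_1` of the sampler. -/
def ddpmOutput {d : ℕ} (c₀ c₁ Cclip : ℝ) (T : ℕ) (s : ℕ → E d → E d) : Measure (E d) :=
  ddpmLaw c₀ c₁ Cclip T s (T - 1)

end DDPM

end

/-!
The data enter only through the mixture `∑ π_k N(μ_k, I)`. Because its components have identity
covariance, it keeps its shape along the forward process: `forwardLaw_gmm` gives the mixture of the
`N(√a μ_k, I)` for every cumulative rate `a`, and its score is `-x + √a M(x)`, with `M` the
posterior mean of the component (`score_gmm`). A step of the sampler with the exact score, started
from the exact law, is then the law `exactStep`, which is to be compared with the mixture it aims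
at.

*Local error.* The exact step has an explicit density against the time reversal of the noising
step, on the path made of the endpoint `y` and an independent Gaussian `W` that fixes the point
`r y + √(r (1 - r)) W` of a Brownian bridge (`lintegral_exactStep`). Since `1 - exp (-ℓ) ≤ ℓ`, the
error on an event is at most the mean of the log-likelihood ratio `ℓ` over it. That mean is the
remainder of the first-order Taylor expansion, in the time of the bridge, of the mean log-partition
function `E [g(y) log ∑ w_a exp θ_a]`. Gaussian integration by parts in `W` removes the singular
speed of the bridge and yields its first two derivatives (`hasDerivAt_integral_bridgeLog`,
`hasDerivAt_integral_bridgeDeriv`). So the local error is quadratic in the step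
(`abs_gmm_real_sub_exactStep_le`), provided that the second derivative has a bounded mean.

*No dependence on the dimension.* The second derivative only involves centred statistics of the
posterior over the components. The linear ones are centred log-posteriors (`sum_mul_inner_sq_le`),
whose second moment is an entropy, of order `log² K` (`sum_mul_log_sq_le`). The fourth central
moment of the means is of order `log² K`, since components at squared distance beyond a multiple of
`log K` have a tiny Bhattacharyya coefficient (`lintegral_wfourth_le`).

*Accumulation.* Local errors are measured in total variation, score errors in divergence. Both are
propagated together by comparing a sub-measure of the forward law with a sub-measure of the law of
the sampler: each local error removes mass from both, each score error adds its `L²` size to the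
divergence (`exists_submeasure_chain`). At the end, a one-sided Pinsker inequality gives
`tvDist_chain_le`.

*From the target to the mixture.* The estimates are trained for the score of the target. Two close
measures have noised densities and gradients that are close in `L¹`. The score is a posterior mean
of the noise, so it rarely exceeds half of the clipping radius. Hence the clipped estimates are
almost as good for the score of the mixture (`lintegral_clip_sub_score_le`), at a price of
`ε R²`, with `R` the clipping radius.

*Schedule.* The odds `a / (1 - a)` of the cumulative rate grow geometrically, so that the process
starts near `N(0, I)` and ends polynomially near the target (`one_sub_alphaBarRev_last_le`), while
each step has size at most `c₁ log T / T` (`alpha_facts`). Summing `T` local errors gives the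
leading term of the bound.
-/

open MeasureTheory ProbabilityTheory
noncomputable section
namespace DDPM

/-! ### Gaussian integrals -/

section GaussianIntegrals

variable {d : ℕ}

theorem measurable_gaussDensity_right (m : E d) (v : ℝ) : Measurable (gaussDensity m v) := by
  unfold gaussDensity
  fun_prop

theorem gaussDensity_pos (m : E d) {v : ℝ} (hv : 0 < v) (x : E d) : 0 < gaussDensity m v x := by
  unfold gaussDensity
  positivity

theorem lintegral_stdGaussian_affine (m : E d) {v : ℝ} (hv : 0 < v) {F : E d → ENNReal}
    (hF : Measurable F) :
    ∫⁻ z, F (m + Real.sqrt v • z) ∂(stdGaussian (E d)) =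
      ∫⁻ x, ENNReal.ofReal (gaussDensity m v x) * F x := by
  rw [← lintegral_map hF (by fun_prop : Measurable fun z : E d => m + Real.sqrt v • z),
    map_stdGaussian_eq_withDensity m hv,
    lintegral_withDensity_eq_lintegral_mul _ (measurable_gaussDensity_right m v).ennreal_ofReal hF]
  rfl

theorem lintegral_stdGaussian {F : E d → ENNReal} (hF : Measurable F) :
    ∫⁻ z, F z ∂(stdGaussian (E d)) = ∫⁻ x, ENNReal.ofReal (gaussDensity 0 1 x) * F x := by
  simpa using lintegral_stdGaussian_affine (0 : E d) one_pos hF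

theorem lintegral_gaussDensity (m : E d) {v : ℝ} (hv : 0 < v) :
    ∫⁻ x, ENNReal.ofReal (gaussDensity m v x) = 1 := by
  simpa using (lintegral_stdGaussian_affine m hv (F := fun _ => 1) measurable_const).symm

theorem stdGaussian_eq_withDensity :
    stdGaussian (E d) = volume.withDensity (fun x => ENNReal.ofReal (gaussDensity 0 1 x)) := by
  simpa using map_stdGaussian_eq_withDensity (0 : E d) one_pos

theorem gaussDensity_one_eq (m x : E d) :
    gaussDensity m 1 x = gaussDensity 0 1 x * Real.exp (inner ℝ m x - ‖m‖ ^ 2 / 2) := by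
  unfold gaussDensity
  rw [mul_assoc (_ ^ d), ← Real.exp_add, norm_sub_sq_real, real_inner_comm, sub_zero]
  congr 2
  ring

/-- The Cameron–Martin formula. -/
theorem lintegral_stdGaussian_shift (m : E d) {F : E d → ENNReal} (hF : Measurable F) :
    ∫⁻ z, F (m + z) ∂(stdGaussian (E d)) =
      ∫⁻ z, ENNReal.ofReal (Real.exp (inner ℝ m z - ‖m‖ ^ 2 / 2)) * F z ∂(stdGaussian (E d)) := by
  have h := lintegral_stdGaussian_affine m one_pos hF
  simp only [Real.sqrt_one, one_smul] at h
  rw [h, lintegral_stdGaussian (by fun_prop)]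
  refine lintegral_congr fun x => ?_
  rw [gaussDensity_one_eq, ENNReal.ofReal_mul (gaussDensity_nonneg _ _ _), mul_assoc]

theorem lintegral_exp_inner_stdGaussian (m : E d) :
    ∫⁻ z, ENNReal.ofReal (Real.exp (inner ℝ m z - ‖m‖ ^ 2 / 2)) ∂(stdGaussian (E d)) = 1 := by
  simpa using (lintegral_stdGaussian_shift m (F := fun _ => 1) measurable_const).symm

/-- A two-step change of measure. A pair `(x, √a x + b M(x) + √b z)` with `x, z` independent
standard Gaussians and `a + b = 1` is compared with the pair `(√a y + √b z, y)`: without the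
drift `M` the two have the same law, and the drift contributes the Girsanov weight. -/
theorem lintegral_gaussian_exchange {a b : ℝ} (ha : 0 < a) (hb : 0 < b) (hab : a + b = 1)
    {M : E d → E d} (hM : Measurable M) {F : E d → E d → ENNReal}
    (hF : Measurable (Function.uncurry F)) :
    ∫⁻ x, ∫⁻ z, F x (Real.sqrt a • x + b • M x + Real.sqrt b • z) ∂(stdGaussian (E d))
        ∂(stdGaussian (E d)) =
      ∫⁻ y, ∫⁻ z, (fun x => ENNReal.ofReal (Real.exp
          (inner ℝ (M x) (y - Real.sqrt a • x) - b * ‖M x‖ ^ 2 / 2)) * F x y)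
        (Real.sqrt a • y + Real.sqrt b • z) ∂(stdGaussian (E d)) ∂(stdGaussian (E d)) := by
  -- completing the square: the two joint densities differ by the Girsanov weight
  have hgd : ∀ x y : E d, gaussDensity 0 1 x * gaussDensity (Real.sqrt a • x + b • M x) b y =
      gaussDensity 0 1 y * gaussDensity (Real.sqrt a • y) b x *
        Real.exp (inner ℝ (M x) (y - Real.sqrt a • x) - b * ‖M x‖ ^ 2 / 2) := by
    intro x y
    unfold gaussDensity
    have e1 : y - (Real.sqrt a • x + b • M x) = (y - Real.sqrt a • x) - b • M x := by abel
    have e2 : -‖x - 0‖ ^ 2 / (2 * 1) +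
        -‖y - (Real.sqrt a • x + b • M x)‖ ^ 2 / (2 * b) =
        -‖y - 0‖ ^ 2 / (2 * 1) + -‖x - Real.sqrt a • y‖ ^ 2 / (2 * b) +
        (inner ℝ (M x) (y - Real.sqrt a • x) - b * ‖M x‖ ^ 2 / 2) := by
      rw [e1, norm_sub_sq_real (y - Real.sqrt a • x), norm_sub_sq_real y (Real.sqrt a • x),
        norm_sub_sq_real x (Real.sqrt a • y), sub_zero, sub_zero]
      simp only [norm_smul, inner_smul_right, mul_pow, Real.norm_eq_abs, sq_abs,
        Real.sq_sqrt ha.le]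
      rw [real_inner_comm x y, real_inner_comm (M x) (y - Real.sqrt a • x)]
      have : b = 1 - a := by linarith
      subst this
      field_simp
      ring
    have e3 := congrArg Real.exp e2
    simp only [Real.exp_add] at e3
    linear_combination ((Real.sqrt (2 * Real.pi * 1))⁻¹ ^ d *
      (Real.sqrt (2 * Real.pi * b))⁻¹ ^ d) * e3
  have hm0 : Measurable (gaussDensity (0 : E d) 1) := measurable_gaussDensity_right _ _
  have hm1 : Measurable (fun p : E d × E d =>
      gaussDensity (Real.sqrt a • p.1 + b • M p.1) b p.2) := by
    unfold gaussDensity; fun_prop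
  have hm2 : Measurable (fun p : E d × E d => gaussDensity (Real.sqrt a • p.2) b p.1) := by
    unfold gaussDensity; fun_prop
  have hF1 : Measurable fun p : E d × E d => F p.1 p.2 := hF
  have lhs : ∫⁻ x, ∫⁻ z, F x (Real.sqrt a • x + b • M x + Real.sqrt b • z) ∂(stdGaussian (E d))
        ∂(stdGaussian (E d)) = ∫⁻ x, ∫⁻ y, ENNReal.ofReal (gaussDensity 0 1 x) *
          (ENNReal.ofReal (gaussDensity (Real.sqrt a • x + b • M x) b y) * F x y) := by
    have : ∀ x, ∫⁻ z, F x (Real.sqrt a • x + b • M x + Real.sqrt b • z) ∂(stdGaussian (E d)) =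
        ∫⁻ y, ENNReal.ofReal (gaussDensity (Real.sqrt a • x + b • M x) b y) * F x y :=
      fun x => lintegral_stdGaussian_affine _ hb (by fun_prop)
    simp_rw [this]
    rw [lintegral_stdGaussian]
    · refine lintegral_congr fun x => (lintegral_const_mul _ ?_).symm
      exact (hm1.comp (by fun_prop : Measurable fun y => (x, y))).ennreal_ofReal.mul (by fun_prop)
    · exact (hm1.ennreal_ofReal.mul hF1).lintegral_prod_right'
  let G : E d → E d → ENNReal := fun x y => ENNReal.ofReal (Real.exp
          (inner ℝ (M x) (y - Real.sqrt a • x) - b * ‖M x‖ ^ 2 / 2)) * F x y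
  have hG : Measurable fun p : E d × E d => G p.1 p.2 := by
    refine Measurable.mul (by fun_prop) hF1
  have rhs : ∫⁻ y, ∫⁻ z, G (Real.sqrt a • y + Real.sqrt b • z) y ∂(stdGaussian (E d))
        ∂(stdGaussian (E d)) = ∫⁻ y, ∫⁻ x, ENNReal.ofReal (gaussDensity 0 1 y) *
          (ENNReal.ofReal (gaussDensity (Real.sqrt a • y) b x) * G x y) := by
    have : ∀ y, ∫⁻ z, G (Real.sqrt a • y + Real.sqrt b • z) y ∂(stdGaussian (E d)) =
        ∫⁻ x, ENNReal.ofReal (gaussDensity (Real.sqrt a • y) b x) * G x y :=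
      fun y => lintegral_stdGaussian_affine (F := fun x => G x y) _ hb (by fun_prop)
    simp_rw [this]
    rw [lintegral_stdGaussian]
    · refine lintegral_congr fun y => (lintegral_const_mul _ ?_).symm
      exact (hm2.comp (by fun_prop : Measurable fun x => (x, y))).ennreal_ofReal.mul (by fun_prop)
    · exact (hm2.ennreal_ofReal.mul hG).lintegral_prod_left'
  change _ = ∫⁻ y, ∫⁻ z, G (Real.sqrt a • y + Real.sqrt b • z) y ∂(stdGaussian (E d))
        ∂(stdGaussian (E d))
  rw [lhs, rhs, lintegral_lintegral_swap]
  · refine lintegral_congr fun y => lintegral_congr fun x => ?_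
    simp only [G]
    rw [← mul_assoc, ← mul_assoc, ← mul_assoc, ← ENNReal.ofReal_mul (gaussDensity_nonneg _ _ _),
      ← ENNReal.ofReal_mul (gaussDensity_nonneg _ _ _), hgd, ENNReal.ofReal_mul
        (mul_nonneg (gaussDensity_nonneg _ _ _) (gaussDensity_nonneg _ _ _))]
  · exact ((hm0.comp measurable_fst).ennreal_ofReal.mul
      (hm1.ennreal_ofReal.mul hF1)).aemeasurable

theorem memLp_id_stdGaussian (p : ENNReal) (hp : p ≠ ⊤) : MemLp id p (stdGaussian (E d)) :=
  IsGaussian.memLp_id _ p hp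

theorem integrable_norm_sq_stdGaussian :
    Integrable (fun x => ‖x‖ ^ 2) (stdGaussian (E d)) := by
  simpa using (memLp_id_stdGaussian (d := d) 2 (by simp)).integrable_norm_pow (p := 2) (by simp)

theorem integrable_norm_stdGaussian :
    Integrable (fun x => ‖x‖) (stdGaussian (E d)) :=
  ((memLp_id_stdGaussian (d := d) 1 (by simp)).integrable le_rfl).norm

theorem integrable_inner_sq_stdGaussian (v : E d) :
    Integrable (fun x => (inner ℝ x v) ^ 2) (stdGaussian (E d)) := by
  refine ((integrable_norm_sq_stdGaussian (d := d)).mul_const (‖v‖ ^ 2)).mono' (by fun_prop)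
    (.of_forall fun x => ?_)
  rw [Real.norm_of_nonneg (sq_nonneg _), ← mul_pow, ← sq_abs]
  exact pow_le_pow_left₀ (abs_nonneg _) (abs_real_inner_le_norm x v) 2

theorem integral_inner_sq_stdGaussian (v : E d) :
    ∫ x, (inner ℝ x v) ^ 2 ∂(stdGaussian (E d)) = ‖v‖ ^ 2 := by
  have h := variance_dual_stdGaussian (E := E d) (innerSL ℝ v)
  rw [variance_eq_integral (by fun_prop), integral_strongDual_stdGaussian] at h
  simpa [real_inner_comm] using h

theorem integral_norm_sq_stdGaussian :
    ∫ x, ‖x‖ ^ 2 ∂(stdGaussian (E d)) = d := by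
  have h : ∀ x : E d, ‖x‖ ^ 2 = ∑ i, (inner ℝ x (EuclideanSpace.single i (1 : ℝ))) ^ 2 := by
    intro x
    simp [EuclideanSpace.norm_sq_eq, EuclideanSpace.inner_single_right]
  simp_rw [h]
  rw [integral_finsetSum _ fun i _ => integrable_inner_sq_stdGaussian _]
  simp_rw [integral_inner_sq_stdGaussian]
  simp

/-- The exponential moment `E exp (‖x‖² / 4) = 2 ^ (d / 2)`, the source of all tail bounds. -/
theorem lintegral_exp_norm_sq_stdGaussian :
    ∫⁻ x, ENNReal.ofReal (Real.exp (‖x‖ ^ 2 / 4)) ∂(stdGaussian (E d)) =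
      ENNReal.ofReal (Real.sqrt 2 ^ d) := by
  rw [lintegral_stdGaussian (by fun_prop)]
  have h : ∀ x : E d, ENNReal.ofReal (gaussDensity 0 1 x) * ENNReal.ofReal (Real.exp (‖x‖ ^ 2 / 4))
      = ENNReal.ofReal (Real.sqrt 2 ^ d) * ENNReal.ofReal (gaussDensity 0 2 x) := by
    intro x
    rw [← ENNReal.ofReal_mul (gaussDensity_nonneg _ _ _), ← ENNReal.ofReal_mul (by positivity)]
    congr 1
    unfold gaussDensity
    rw [mul_assoc, ← Real.exp_add, ← mul_assoc, ← mul_pow]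
    congr 2
    · rw [mul_one, Real.sqrt_mul (by positivity) 2, mul_inv, mul_comm _ (Real.sqrt 2)⁻¹,
        ← mul_assoc, mul_inv_cancel₀ (by positivity), one_mul]
    · simp; ring
  simp_rw [h]
  rw [lintegral_const_mul _ (measurable_gaussDensity_right _ _).ennreal_ofReal,
    lintegral_gaussDensity _ (by norm_num), mul_one]

/-- Gaussian integration by parts (Stein's identity) in the direction `v`. -/
theorem integral_mul_inner_stdGaussian {f f' : E d → ℝ} (v : E d)
    (hf : ∀ x, HasLineDerivAt ℝ f (f' x) x v)
    (h1 : Integrable f (stdGaussian (E d))) (h2 : Integrable f' (stdGaussian (E d)))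
    (h3 : Integrable (fun x => f x * inner ℝ x v) (stdGaussian (E d))) :
    ∫ x, f x * inner ℝ x v ∂(stdGaussian (E d)) = ∫ x, f' x ∂(stdGaussian (E d)) := by
  have hmeas : Measurable (fun x : E d => ENNReal.ofReal (gaussDensity 0 1 x)) :=
    (measurable_gaussDensity_right _ _).ennreal_ofReal
  have key : ∀ φ : E d → ℝ, Integrable φ (stdGaussian (E d)) →
      Integrable (fun x => φ x * gaussDensity 0 1 x) := by
    intro φ hφ
    rw [stdGaussian_eq_withDensity, integrable_withDensity_iff hmeas
      (.of_forall fun x => ENNReal.ofReal_lt_top)] at hφ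
    simpa [ENNReal.toReal_ofReal (gaussDensity_nonneg _ _ _)] using hφ
  have key2 : ∀ φ : E d → ℝ, ∫ x, φ x ∂(stdGaussian (E d)) = ∫ x, φ x * gaussDensity 0 1 x := by
    intro φ
    rw [stdGaussian_eq_withDensity, integral_withDensity_eq_integral_toReal_smul hmeas
      (.of_forall fun x => ENNReal.ofReal_lt_top)]
    simp [ENNReal.toReal_ofReal (gaussDensity_nonneg _ _ _), mul_comm]
  have hg : ∀ x : E d, HasLineDerivAt ℝ (gaussDensity (0 : E d) 1)
      (-(inner ℝ x v * gaussDensity 0 1 x)) x v := by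
    intro x
    have h : HasDerivAt (fun t : ℝ => ‖x + t • v‖ ^ 2) (2 * inner ℝ x v) 0 := by
      have e : (fun t : ℝ => ‖x + t • v‖ ^ 2) =
          fun t => ‖x‖ ^ 2 + 2 * (t * inner ℝ x v) + t ^ 2 * ‖v‖ ^ 2 := by
        funext t
        rw [norm_add_sq_real, inner_smul_right, norm_smul, mul_pow, Real.norm_eq_abs, sq_abs]
      rw [e]
      have h1 : HasDerivAt (fun t : ℝ => 2 * (t * inner ℝ x v)) (2 * (1 * inner ℝ x v)) 0 :=
        ((hasDerivAt_id (0 : ℝ)).mul_const _).const_mul _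
      have h2 : HasDerivAt (fun t : ℝ => t ^ 2 * ‖v‖ ^ 2) ((2 * (0 : ℝ)) * ‖v‖ ^ 2) 0 := by
        simpa using (hasDerivAt_pow 2 (0 : ℝ)).mul_const (‖v‖ ^ 2)
      exact ((h1.const_add _).add h2).congr_deriv (by ring)
    unfold HasLineDerivAt gaussDensity
    have h3 := (((h.neg).div_const (2 * 1)).exp).const_mul ((Real.sqrt (2 * Real.pi * 1))⁻¹ ^ d)
    simp only [sub_zero]
    refine h3.congr_deriv ?_
    simp
    ring
  have ibp := integral_bilinear_hasLineDerivAt_right_eq_neg_left_of_integrable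
    (μ := (volume : Measure (E d))) (f := f) (f' := f') (g := gaussDensity 0 1)
    (g' := fun x => -(inner ℝ x v * gaussDensity 0 1 x)) (v := v)
    (B := ContinuousLinearMap.mul ℝ ℝ) (by simpa using key _ h2)
    (by simpa [mul_assoc] using (key _ h3).neg) (by simpa using key _ h1)
    (fun x _ => hf x) (fun x _ => hg x)
  simp only [ContinuousLinearMap.mul_apply', mul_neg, integral_neg, neg_inj] at ibp
  rw [key2, key2, ← ibp]
  simp_rw [mul_assoc]

end GaussianIntegrals

/-! ### Posterior weights and their derivatives -/

section Softmax

variable {ι : Type*} [Fintype ι]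

/-- The partition function `∑ w_a exp θ_a`. -/
def partition (w θ : ι → ℝ) : ℝ := ∑ a, w a * Real.exp (θ a)

/-- The softmax weights `w_a exp θ_a / ∑ w_b exp θ_b`. -/
def softmax (w θ : ι → ℝ) (a : ι) : ℝ := w a * Real.exp (θ a) / partition w θ

/-- The mean of the points `m` under the weights `p`. -/
def wmean {d : ℕ} (p : ι → ℝ) (m : ι → E d) : E d := ∑ a, p a • m a

/-- The trace of the covariance of the points `m` under the weights `p`. -/
def wvar {d : ℕ} (p : ι → ℝ) (m : ι → E d) : ℝ := ∑ a, p a * ‖m a - wmean p m‖ ^ 2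

/-- The centred function `a ↦ ⟨y - M, v_a⟩ - r (‖v_a‖² - tr C)`, where `v_a = m_a - M`, and `M`
and `C` are the mean and the covariance of `m` under `p`. It drives the second derivative of the
mean log-partition function along the Brownian bridge to `y`. -/
def drive {d : ℕ} (r : ℝ) (y : E d) (m : ι → E d) (p : ι → ℝ) (a : ι) : ℝ :=
  inner ℝ (y - wmean p m) (m a - wmean p m) - r * (‖m a - wmean p m‖ ^ 2 - wvar p m)

/-- The integrand of the first derivative of the mean log-partition function along the bridge. -/
def bridgeDeriv {d : ℕ} (r : ℝ) (y : E d) (m : ι → E d) (p : ι → ℝ) : ℝ :=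
  inner ℝ y (wmean p m) - ‖wmean p m‖ ^ 2 / 2 - r * wvar p m

/-- The squared Frobenius norm of the covariance of `m` under `p`. -/
def wcovSq {d : ℕ} (p : ι → ℝ) (m : ι → E d) : ℝ :=
  ∑ a, ∑ b, p a * p b * (inner ℝ (m a - wmean p m) (m b - wmean p m)) ^ 2

/-- The integrand of the second derivative of the mean log-partition function along the bridge. -/
def bridgeDeriv2 {d : ℕ} (r : ℝ) (y : E d) (m : ι → E d) (p : ι → ℝ) : ℝ :=
  ∑ a, p a * drive r y m p a ^ 2 - wvar p m - (1 - 2 * r) ^ 2 / 2 * wcovSq p m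

variable {w : ι → ℝ}

theorem partition_pos [Nonempty ι] (hw : ∀ a, 0 < w a) (θ : ι → ℝ) : 0 < partition w θ :=
  Finset.sum_pos (fun a _ => mul_pos (hw a) (Real.exp_pos _)) Finset.univ_nonempty

theorem softmax_pos [Nonempty ι] (hw : ∀ a, 0 < w a) (θ : ι → ℝ) (a : ι) : 0 < softmax w θ a :=
  div_pos (mul_pos (hw a) (Real.exp_pos _)) (partition_pos hw θ)

theorem sum_softmax [Nonempty ι] (hw : ∀ a, 0 < w a) (θ : ι → ℝ) : ∑ a, softmax w θ a = 1 := by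
  unfold softmax
  rw [← Finset.sum_div]
  exact div_self (partition_pos hw θ).ne'

theorem softmax_le_one [Nonempty ι] (hw : ∀ a, 0 < w a) (θ : ι → ℝ) (a : ι) :
    softmax w θ a ≤ 1 := by
  rw [← sum_softmax hw θ]
  exact Finset.single_le_sum (fun b _ => (softmax_pos hw θ b).le) (Finset.mem_univ a)

theorem hasDerivAt_partition {θ : ℝ → ι → ℝ} {θ' : ι → ℝ} {t : ℝ}
    (h : ∀ a, HasDerivAt (fun t => θ t a) (θ' a) t) :
    HasDerivAt (fun t => partition w (θ t)) (∑ a, w a * Real.exp (θ t a) * θ' a) t := by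
  unfold partition
  refine HasDerivAt.fun_sum fun a _ => ?_
  exact ((h a).exp.const_mul (w a)).congr_deriv (by ring)

theorem hasDerivAt_log_partition [Nonempty ι] (hw : ∀ a, 0 < w a) {θ : ℝ → ι → ℝ} {θ' : ι → ℝ}
    {t : ℝ} (h : ∀ a, HasDerivAt (fun t => θ t a) (θ' a) t) :
    HasDerivAt (fun t => Real.log (partition w (θ t))) (∑ a, softmax w (θ t) a * θ' a) t := by
  refine ((hasDerivAt_partition h).log (partition_pos hw _).ne').congr_deriv ?_
  rw [Finset.sum_div]
  exact Finset.sum_congr rfl fun a _ => by unfold softmax; ring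

theorem hasDerivAt_softmax [Nonempty ι] (hw : ∀ a, 0 < w a) {θ : ℝ → ι → ℝ} {θ' : ι → ℝ}
    {t : ℝ} (h : ∀ a, HasDerivAt (fun t => θ t a) (θ' a) t) (a : ι) :
    HasDerivAt (fun t => softmax w (θ t) a)
      (softmax w (θ t) a * (θ' a - ∑ b, softmax w (θ t) b * θ' b)) t := by
  have hZ := (partition_pos hw (θ t)).ne'
  refine (((h a).exp.const_mul (w a)).div (hasDerivAt_partition h) hZ).congr_deriv ?_
  have : ∑ b, softmax w (θ t) b * θ' b =
      (∑ b, w b * Real.exp (θ t b) * θ' b) / partition w (θ t) := by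
    rw [Finset.sum_div]
    exact Finset.sum_congr rfl fun a _ => by unfold softmax; ring
  rw [this]
  unfold softmax
  field_simp

variable {d : ℕ} {m : ι → E d}

theorem sum_smul_sub_wmean {p : ι → ℝ} (hp : ∑ a, p a = 1) (m : ι → E d) :
    ∑ a, p a • (m a - wmean p m) = 0 := by
  simp_rw [smul_sub]
  rw [Finset.sum_sub_distrib, ← Finset.sum_smul, hp, one_smul]
  exact sub_self _

theorem sum_mul_inner_sub_wmean {p : ι → ℝ} (hp : ∑ a, p a = 1) (m : ι → E d) (z : E d) :
    ∑ a, p a * inner ℝ z (m a - wmean p m) = 0 := by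
  simp_rw [← inner_smul_right]
  rw [← inner_sum, sum_smul_sub_wmean hp, inner_zero_right]

theorem sum_mul_drive {p : ι → ℝ} (hp : ∑ a, p a = 1) (r : ℝ) (y : E d) (m : ι → E d) :
    ∑ a, p a * drive r y m p a = 0 := by
  unfold drive
  simp_rw [mul_sub, Finset.sum_sub_distrib]
  rw [sum_mul_inner_sub_wmean hp]
  have h1 : ∑ a, p a * (r * ‖m a - wmean p m‖ ^ 2) = r * wvar p m := by
    unfold wvar; rw [Finset.mul_sum]; exact Finset.sum_congr rfl fun a _ => by ring
  rw [h1, ← Finset.sum_mul, hp]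
  ring

theorem wvar_eq {p : ι → ℝ} (hp : ∑ a, p a = 1) (m : ι → E d) :
    wvar p m = ∑ a, p a * ‖m a‖ ^ 2 - ‖wmean p m‖ ^ 2 := by
  have h : ∀ a, p a * ‖m a - wmean p m‖ ^ 2 =
      p a * ‖m a‖ ^ 2 - 2 * (p a * inner ℝ (wmean p m) (m a - wmean p m))
        - p a * ‖wmean p m‖ ^ 2 := by
    intro a
    rw [norm_sub_sq_real, inner_sub_right, real_inner_self_eq_norm_sq, real_inner_comm]
    ring
  unfold wvar
  simp_rw [h]
  rw [Finset.sum_sub_distrib, Finset.sum_sub_distrib, ← Finset.mul_sum,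
    sum_mul_inner_sub_wmean hp, ← Finset.sum_mul, hp]
  ring

variable {p : ℝ → ι → ℝ} {τ : ι → ℝ} {t : ℝ}

/-- Along weights whose logarithmic derivatives are `τ_a - τ̄`, the mean has derivative
`∑ p_a τ_a v_a`. -/
theorem hasDerivAt_wmean (m : ι → E d)
    (h : ∀ a, HasDerivAt (fun t => p t a) (p t a * (τ a - ∑ b, p t b * τ b)) t) :
    HasDerivAt (fun t => wmean (p t) m) (∑ a, (p t a * τ a) • (m a - wmean (p t) m)) t := by
  have h1 : HasDerivAt (fun t => wmean (p t) m)
      (∑ a, (p t a * (τ a - ∑ b, p t b * τ b)) • m a) t := by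
    unfold wmean
    exact HasDerivAt.fun_sum fun a _ => (h a).smul_const (m a)
  refine h1.congr_deriv ?_
  simp_rw [mul_sub, sub_smul, smul_sub]
  rw [Finset.sum_sub_distrib, Finset.sum_sub_distrib, ← Finset.sum_smul]
  congr 1
  rw [wmean, Finset.smul_sum]
  refine Finset.sum_congr rfl fun a _ => ?_
  rw [smul_smul, mul_comm]

theorem hasDerivAt_wvar (m : ι → E d) (hp : ∀ t, ∑ a, p t a = 1)
    (h : ∀ a, HasDerivAt (fun t => p t a) (p t a * (τ a - ∑ b, p t b * τ b)) t) :
    HasDerivAt (fun t => wvar (p t) m)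
      (∑ a, p t a * τ a * (‖m a - wmean (p t) m‖ ^ 2 - wvar (p t) m)) t := by
  have hM := hasDerivAt_wmean m h
  have h1 : HasDerivAt (fun t => ∑ a, p t a * ‖m a‖ ^ 2)
      (∑ a, (p t a * (τ a - ∑ b, p t b * τ b)) * ‖m a‖ ^ 2) t :=
    HasDerivAt.fun_sum fun a _ => (h a).mul_const _
  have h2 := h1.sub hM.norm_sq
  have e : (fun t => wvar (p t) m) =
      (fun t => ∑ a, p t a * ‖m a‖ ^ 2) - (fun t => ‖wmean (p t) m‖ ^ 2) :=
    funext fun t => wvar_eq (hp t) m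
  rw [e]
  refine h2.congr_deriv ?_
  have e2 : ∑ a, (p t a * (τ a - ∑ b, p t b * τ b)) * ‖m a‖ ^ 2 =
      ∑ a, p t a * τ a * (‖m a‖ ^ 2 - ∑ b, p t b * ‖m b‖ ^ 2) := by
    simp_rw [mul_sub, sub_mul, Finset.sum_sub_distrib, ← Finset.sum_mul]
    congr 1
    rw [Finset.mul_sum]
    exact Finset.sum_congr rfl fun a _ => by ring
  rw [e2, inner_sum, Finset.mul_sum, ← Finset.sum_sub_distrib]
  refine Finset.sum_congr rfl fun a _ => ?_
  rw [wvar_eq (hp t), inner_smul_right, norm_sub_sq_real, inner_sub_right,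
    real_inner_self_eq_norm_sq, real_inner_comm]
  ring

/-- The derivative of `bridgeDeriv` along the flow: `drive` is its gradient with respect to the
weights, and the explicit dependence on the time contributes `-tr C`. -/
theorem hasDerivAt_bridgeDeriv (m : ι → E d) (y : E d) (hp : ∀ t, ∑ a, p t a = 1)
    (h : ∀ a, HasDerivAt (fun t => p t a) (p t a * (τ a - ∑ b, p t b * τ b)) t) :
    HasDerivAt (fun t => bridgeDeriv t y m (p t))
      (∑ a, p t a * τ a * drive t y m (p t) a - wvar (p t) m) t := by
  have hM := hasDerivAt_wmean m h
  have hV := hasDerivAt_wvar m hp h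
  have h1 : HasDerivAt (fun t => inner ℝ y (wmean (p t) m))
      (inner ℝ y (∑ a, (p t a * τ a) • (m a - wmean (p t) m))) t := by
    simpa using (hasDerivAt_const t y).inner ℝ hM
  refine ((h1.sub (hM.norm_sq.div_const 2)).sub ((hasDerivAt_id t).mul hV)).congr_deriv ?_
  simp only [inner_sum, inner_smul_right, id_eq, one_mul, drive, inner_sub_left, mul_sub,
    Finset.mul_sum, Finset.sum_sub_distrib, Finset.sum_div]
  have e1 : ∀ x : ι, 2 * (p t x * τ x * inner ℝ (wmean (p t) m) (m x - wmean (p t) m)) / 2 =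
      p t x * τ x * inner ℝ (wmean (p t) m) (m x - wmean (p t) m) := fun x => by ring
  have e2 : ∀ x : ι, t * (p t x * τ x * ‖m x - wmean (p t) m‖ ^ 2) =
      p t x * τ x * (t * ‖m x - wmean (p t) m‖ ^ 2) := fun x => by ring
  have e3 : ∀ x : ι, t * (p t x * τ x * wvar (p t) m) =
      p t x * τ x * (t * wvar (p t) m) := fun x => by ring
  simp_rw [e1, e2, e3]
  ring

theorem hasDerivAt_drive (m : ι → E d) (r : ℝ) (y : E d) (hp : ∀ t, ∑ a, p t a = 1)
    (h : ∀ a, HasDerivAt (fun t => p t a) (p t a * (τ a - ∑ b, p t b * τ b)) t) (a : ι) :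
    HasDerivAt (fun t => drive r y m (p t) a)
      (-∑ b, p t b * τ b * ((1 - 2 * r) *
        inner ℝ (m a - wmean (p t) m) (m b - wmean (p t) m) + drive r y m (p t) b)) t := by
  have hM := hasDerivAt_wmean m h
  have hV := hasDerivAt_wvar m hp h
  have hy := hM.const_sub y
  have ha := hM.const_sub (m a)
  refine ((hy.inner ℝ ha).sub ((ha.norm_sq.sub hV).const_mul r)).congr_deriv ?_
  simp only [inner_neg_left, inner_neg_right, sum_inner, inner_sum, inner_smul_left,
    inner_smul_right, conj_trivial]
  have e : ∀ b, p t b * τ b * ((1 - 2 * r) *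
        inner ℝ (m a - wmean (p t) m) (m b - wmean (p t) m) + drive r y m (p t) b) =
      p t b * τ b * inner ℝ (m b - wmean (p t) m) (m a - wmean (p t) m)
      - (2 * r) * (p t b * τ b * inner ℝ (m a - wmean (p t) m) (m b - wmean (p t) m))
      + p t b * τ b * inner ℝ (y - wmean (p t) m) (m b - wmean (p t) m)
      - r * (p t b * τ b * (‖m b - wmean (p t) m‖ ^ 2 - wvar (p t) m)) := by
    intro b
    rw [real_inner_comm (m a - wmean (p t) m) (m b - wmean (p t) m), drive]
    ring
  simp_rw [e, Finset.sum_sub_distrib, Finset.sum_add_distrib, Finset.sum_sub_distrib,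
    ← Finset.mul_sum]
  ring

/-- The algebra behind the second derivative of the mean log-partition function: the terms that
depend on the position of the mean cancel. -/
theorem sum_laplacian_drive {p : ι → ℝ} (hp : ∑ a, p a = 1) (r : ℝ) (y : E d) (m : ι → E d) :
    ∑ a, (p a * (inner ℝ (m a) (m a) - ∑ b, p b * inner ℝ (m a) (m b)) * drive r y m p a -
      p a * ∑ b, p b * inner ℝ (m a) (m b) * ((1 - 2 * r) *
        inner ℝ (m a - wmean p m) (m b - wmean p m) + drive r y m p b)) =
      ∑ a, p a * ‖m a - wmean p m‖ ^ 2 * drive r y m p a - (1 - 2 * r) * wcovSq p m := by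
  set M := wmean p m with hMdef
  set k := drive r y m p with hk
  have hsk : ∑ a, p a * k a = 0 := sum_mul_drive hp r y m
  have hv : ∀ z : E d, ∑ a, p a * inner ℝ z (m a - M) = 0 := sum_mul_inner_sub_wmean hp m
  have hM : ∀ a, ∑ b, p b * inner ℝ (m a) (m b) = inner ℝ (m a) M := by
    intro a
    simp_rw [← inner_smul_right]
    rw [← inner_sum]; rfl
  have hG : ∀ a b, inner ℝ (m a) (m b) = inner ℝ (m a - M) (m b - M) + inner ℝ M (m a - M)
      + inner ℝ M (m b - M) + ‖M‖ ^ 2 := by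
    intro a b
    simp only [inner_sub_left, inner_sub_right, real_inner_self_eq_norm_sq,
      real_inner_comm M (m a)]
    ring
  have h1 : ∀ a, inner ℝ (m a) (m a) - inner ℝ (m a) M =
      ‖m a - M‖ ^ 2 + inner ℝ M (m a - M) := by
    intro a
    rw [norm_sub_sq_real, inner_sub_right, real_inner_self_eq_norm_sq,
      real_inner_self_eq_norm_sq, real_inner_comm M (m a)]
    ring
  -- the inner sums, after the centred terms drop out
  have h2 : ∀ a, ∑ b, p b * inner ℝ (m a) (m b) * ((1 - 2 * r) *
        inner ℝ (m a - M) (m b - M) + k b) =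
      (1 - 2 * r) * (∑ b, p b * inner ℝ (m a - M) (m b - M) ^ 2) +
      (1 - 2 * r) * (∑ b, p b * inner ℝ M (m b - M) * inner ℝ (m a - M) (m b - M)) +
      (∑ b, p b * k b * inner ℝ (m a - M) (m b - M)) + ∑ b, p b * k b * inner ℝ M (m b - M) := by
    intro a
    have e : ∀ b, p b * inner ℝ (m a) (m b) * ((1 - 2 * r) *
        inner ℝ (m a - M) (m b - M) + k b) =
        (1 - 2 * r) * (p b * inner ℝ (m a - M) (m b - M) ^ 2) +
        (1 - 2 * r) * (p b * inner ℝ M (m b - M) * inner ℝ (m a - M) (m b - M)) +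
        p b * k b * inner ℝ (m a - M) (m b - M) + p b * k b * inner ℝ M (m b - M) +
        (1 - 2 * r) * (inner ℝ M (m a - M) + ‖M‖ ^ 2) * (p b * inner ℝ (m a - M) (m b - M)) +
        (inner ℝ M (m a - M) + ‖M‖ ^ 2) * (p b * k b) := by
      intro b; rw [hG]; ring
    simp_rw [e, Finset.sum_add_distrib, ← Finset.mul_sum]
    rw [hv, hsk]
    ring
  have hv' : ∀ z : E d, ∑ a, p a * inner ℝ (m a - M) z = 0 := by
    intro z; simp_rw [real_inner_comm z]; exact hv z
  have h3 : ∀ f : ι → ℝ, ∑ a, p a * ∑ b, f b * inner ℝ (m a - M) (m b - M) = 0 := by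
    intro f
    simp_rw [Finset.mul_sum]
    rw [Finset.sum_comm]
    refine Finset.sum_eq_zero fun b _ => ?_
    have := hv' (m b - M)
    calc _ = f b * ∑ a, p a * inner ℝ (m a - M) (m b - M) := by
          rw [Finset.mul_sum]; exact Finset.sum_congr rfl fun a _ => by ring
      _ = 0 := by rw [this, mul_zero]
  simp_rw [hM, h1, h2]
  rw [Finset.sum_sub_distrib]
  have e1 : ∑ a, p a * (‖m a - M‖ ^ 2 + inner ℝ M (m a - M)) * k a =
      ∑ a, p a * ‖m a - M‖ ^ 2 * k a + ∑ b, p b * k b * inner ℝ M (m b - M) := by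
    rw [← Finset.sum_add_distrib]; exact Finset.sum_congr rfl fun a _ => by ring
  have e2 : wcovSq p m = ∑ a, p a * ∑ b, p b * inner ℝ (m a - M) (m b - M) ^ 2 := by
    unfold wcovSq
    simp_rw [Finset.mul_sum]
    exact Finset.sum_congr rfl fun a _ => Finset.sum_congr rfl fun b _ => by rw [← hMdef]; ring
  rw [e1, e2]
  simp_rw [mul_add, Finset.sum_add_distrib]
  rw [h3, ← Finset.sum_mul, hp]
  have e3 : ∑ a, p a * ((1 - 2 * r) * ∑ b, p b * inner ℝ M (m b - M) *
      inner ℝ (m a - M) (m b - M)) = 0 := by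
    have := h3 (fun b => p b * inner ℝ M (m b - M))
    rw [← mul_zero (1 - 2 * r), ← this, Finset.mul_sum]
    exact Finset.sum_congr rfl fun a _ => by ring
  have e4 : ∑ a, p a * ((1 - 2 * r) * ∑ b, p b * inner ℝ (m a - M) (m b - M) ^ 2) =
      (1 - 2 * r) * ∑ a, p a * ∑ b, p b * inner ℝ (m a - M) (m b - M) ^ 2 := by
    rw [Finset.mul_sum]
    exact Finset.sum_congr rfl fun a _ => by ring
  rw [e3, e4]
  ring

end Softmax

/-! ### The mean log-partition function along the Brownian bridge -/

section Bridge

variable {ι : Type*} [Fintype ι] {d : ℕ}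

theorem abs_sum_mul_le {p : ι → ℝ} (h0 : ∀ a, 0 ≤ p a) (hp : ∑ a, p a = 1) {f : ι → ℝ} {c : ℝ}
    (hf : ∀ a, |f a| ≤ c) : |∑ a, p a * f a| ≤ c := by
  refine (Finset.abs_sum_le_sum_abs _ _).trans ?_
  calc ∑ a, |p a * f a| ≤ ∑ a, p a * c := by
        refine Finset.sum_le_sum fun a _ => ?_
        rw [abs_mul, abs_of_nonneg (h0 a)]
        exact mul_le_mul_of_nonneg_left (hf a) (h0 a)
    _ = c := by rw [← Finset.sum_mul, hp, one_mul]

section Bounds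

variable {p : ι → ℝ} {m : ι → E d} {B : ℝ}

theorem norm_wmean_le (h0 : ∀ a, 0 ≤ p a) (hp : ∑ a, p a = 1) (hB : ∀ a, ‖m a‖ ≤ B) :
    ‖wmean p m‖ ≤ B := by
  refine (norm_sum_le _ _).trans ?_
  calc ∑ a, ‖p a • m a‖ ≤ ∑ a, p a * B := by
        refine Finset.sum_le_sum fun a _ => ?_
        rw [norm_smul, Real.norm_of_nonneg (h0 a)]
        exact mul_le_mul_of_nonneg_left (hB a) (h0 a)
    _ = B := by rw [← Finset.sum_mul, hp, one_mul]

theorem norm_sub_wmean_le (h0 : ∀ a, 0 ≤ p a) (hp : ∑ a, p a = 1) (hB : ∀ a, ‖m a‖ ≤ B) (a : ι) :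
    ‖m a - wmean p m‖ ≤ 2 * B := by
  have := norm_sub_le (m a) (wmean p m)
  have := norm_wmean_le h0 hp hB
  have := hB a
  linarith

theorem wvar_nonneg (h0 : ∀ a, 0 ≤ p a) : 0 ≤ wvar p m :=
  Finset.sum_nonneg fun a _ => mul_nonneg (h0 a) (sq_nonneg _)

theorem norm_sq_sub_wmean_le (h0 : ∀ a, 0 ≤ p a) (hp : ∑ a, p a = 1) (hB : ∀ a, ‖m a‖ ≤ B)
    (a : ι) : ‖m a - wmean p m‖ ^ 2 ≤ 4 * B ^ 2 := by
  have := pow_le_pow_left₀ (norm_nonneg _) (norm_sub_wmean_le h0 hp hB a) 2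
  linarith

theorem wvar_le (h0 : ∀ a, 0 ≤ p a) (hp : ∑ a, p a = 1) (hB : ∀ a, ‖m a‖ ≤ B) :
    wvar p m ≤ 4 * B ^ 2 := by
  refine (le_abs_self _).trans (abs_sum_mul_le h0 hp fun a => ?_)
  rw [abs_of_nonneg (sq_nonneg _)]
  exact norm_sq_sub_wmean_le h0 hp hB a

theorem abs_drive_le (h0 : ∀ a, 0 ≤ p a) (hp : ∑ a, p a = 1) (hB : ∀ a, ‖m a‖ ≤ B)
    (hB1 : 1 ≤ B) {r : ℝ} (hr0 : 0 ≤ r) (hr1 : r ≤ 1) (y : E d) (a : ι) :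
    |drive r y m p a| ≤ 8 * B ^ 2 * (1 + ‖y‖) := by
  have h1 := abs_real_inner_le_norm (y - wmean p m) (m a - wmean p m)
  have h2 : ‖y - wmean p m‖ * ‖m a - wmean p m‖ ≤ (‖y‖ + B) * (2 * B) :=
    mul_le_mul ((norm_sub_le _ _).trans (by linarith [norm_wmean_le h0 hp hB]))
      (norm_sub_wmean_le h0 hp hB a) (norm_nonneg _) (by positivity)
  have h3 : |‖m a - wmean p m‖ ^ 2 - wvar p m| ≤ 4 * B ^ 2 := by
    rw [abs_le]
    have := norm_sq_sub_wmean_le h0 hp hB a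
    have := wvar_le h0 hp hB
    have := wvar_nonneg (m := m) h0
    constructor <;> nlinarith [sq_nonneg ‖m a - wmean p m‖]
  have h4 : |r * (‖m a - wmean p m‖ ^ 2 - wvar p m)| ≤ 4 * B ^ 2 := by
    rw [abs_mul, abs_of_nonneg hr0]
    nlinarith [abs_nonneg (‖m a - wmean p m‖ ^ 2 - wvar p m)]
  have h5 := abs_sub (inner ℝ (y - wmean p m) (m a - wmean p m))
    (r * (‖m a - wmean p m‖ ^ 2 - wvar p m))
  have hB2 : B ≤ B ^ 2 := by nlinarith
  unfold drive
  nlinarith [norm_nonneg y]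

theorem abs_bridgeDeriv_le (h0 : ∀ a, 0 ≤ p a) (hp : ∑ a, p a = 1) (hB : ∀ a, ‖m a‖ ≤ B)
    (hB1 : 1 ≤ B) {r : ℝ} (hr0 : 0 ≤ r) (hr1 : r ≤ 1) (y : E d) :
    |bridgeDeriv r y m p| ≤ 8 * B ^ 2 * (1 + ‖y‖) := by
  have hM := norm_wmean_le h0 hp hB
  have h1 := (abs_real_inner_le_norm y (wmean p m)).trans
    (mul_le_mul_of_nonneg_left hM (norm_nonneg y))
  have h2 : ‖wmean p m‖ ^ 2 ≤ B ^ 2 := pow_le_pow_left₀ (norm_nonneg _) hM 2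
  have h3 := wvar_le h0 hp hB
  have h4 := wvar_nonneg (m := m) h0
  have h5 : r * wvar p m ≤ 4 * B ^ 2 := by nlinarith
  have h6 : 0 ≤ r * wvar p m := by positivity
  have hB2 : B ≤ B ^ 2 := by nlinarith
  obtain ⟨h7, h8⟩ := abs_le.1 h1
  have h9 : ‖y‖ * B ≤ B ^ 2 * ‖y‖ := by nlinarith [norm_nonneg y]
  have h10 := mul_nonneg (sq_nonneg B) (norm_nonneg y)
  unfold bridgeDeriv
  rw [abs_le]
  constructor <;> nlinarith [sq_nonneg ‖wmean p m‖]

end Bounds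

section Continuity

variable {X : Type*} [TopologicalSpace X] {p : X → ι → ℝ} {m : ι → E d}

@[fun_prop]
theorem continuous_wmean (hp : ∀ a, Continuous fun x => p x a) :
    Continuous fun x => wmean (p x) m := by
  unfold wmean
  exact continuous_finsetSum _ fun a _ => (hp a).smul continuous_const

theorem continuous_wvar (hp : ∀ a, Continuous fun x => p x a) :
    Continuous fun x => wvar (p x) m := by
  have := continuous_wmean (m := m) hp
  unfold wvar
  exact continuous_finsetSum _ fun a _ => (hp a).mul (by fun_prop)

theorem continuous_wcovSq (hp : ∀ a, Continuous fun x => p x a) :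
    Continuous fun x => wcovSq (p x) m := by
  have := continuous_wmean (m := m) hp
  unfold wcovSq
  exact continuous_finsetSum _ fun a _ => continuous_finsetSum _ fun b _ =>
    ((hp a).mul (hp b)).mul (by fun_prop)

theorem continuous_drive (hp : ∀ a, Continuous fun x => p x a) (r : ℝ) {y : X → E d}
    (hy : Continuous y) (a : ι) : Continuous fun x => drive r (y x) m (p x) a := by
  have := continuous_wmean (m := m) hp
  have := continuous_wvar (m := m) hp
  unfold drive
  fun_prop

theorem continuous_bridgeDeriv (hp : ∀ a, Continuous fun x => p x a) (r : ℝ) {y : X → E d}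
    (hy : Continuous y) : Continuous fun x => bridgeDeriv r (y x) m (p x) := by
  have := continuous_wmean (m := m) hp
  have := continuous_wvar (m := m) hp
  unfold bridgeDeriv
  fun_prop

variable {w : ι → ℝ}

theorem continuous_partition {θ : X → ι → ℝ} (hθ : ∀ a, Continuous fun x => θ x a) :
    Continuous fun x => partition w (θ x) := by
  unfold partition
  exact continuous_finsetSum _ fun a _ => continuous_const.mul (hθ a).rexp

theorem continuous_softmax [Nonempty ι] (hw : ∀ a, 0 < w a) {θ : X → ι → ℝ}
    (hθ : ∀ a, Continuous fun x => θ x a) (a : ι) : Continuous fun x => softmax w (θ x) a := by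
  unfold softmax
  exact (continuous_const.mul (hθ a).rexp).div (continuous_partition hθ)
    fun x => (partition_pos hw _).ne'

end Continuity

/-- The exponent `⟨u, m_a⟩ - r ‖m_a‖² / 2`: up to the factor of the standard Gaussian density,
`w_a exp` of it is the density at `u = √r x` of the component `N(√r m_a, I)` of the mixture. -/
def expo (m : ι → E d) (r : ℝ) (u : E d) (a : ι) : ℝ := inner ℝ u (m a) - r * ‖m a‖ ^ 2 / 2

/-- A point of the Brownian bridge from `0` at time `0` to `y` at time `1`, driven by the standard
Gaussian `W`. -/
def bridgePoint (r : ℝ) (y W : E d) : E d := r • y + Real.sqrt (r * (1 - r)) • W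

/-- The posterior weights of the labels at a point of the bridge. -/
def bridgePost (w : ι → ℝ) (m : ι → E d) (r : ℝ) (y W : E d) : ι → ℝ :=
  softmax w (expo m r (bridgePoint r y W))

/-- The log-partition function at a point of the bridge. -/
def bridgeLog (w : ι → ℝ) (m : ι → E d) (r : ℝ) (y W : E d) : ℝ :=
  Real.log (partition w (expo m r (bridgePoint r y W)))

omit [Fintype ι] in
theorem continuous_bridgeExpo (m : ι → E d) (r : ℝ) (a : ι) :
    Continuous fun q : E d × E d => expo m r (bridgePoint r q.1 q.2) a := by
  unfold expo bridgePoint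
  fun_prop

theorem continuous_bridgePost {w : ι → ℝ} [Nonempty ι] (hw : ∀ a, 0 < w a) (m : ι → E d) (r : ℝ)
    (a : ι) : Continuous fun q : E d × E d => bridgePost w m r q.1 q.2 a :=
  continuous_softmax hw (continuous_bridgeExpo m r) a

theorem continuous_bridgeLog {w : ι → ℝ} [Nonempty ι] (hw : ∀ a, 0 < w a) (m : ι → E d) (r : ℝ) :
    Continuous fun q : E d × E d => bridgeLog w m r q.1 q.2 :=
  (continuous_partition (continuous_bridgeExpo m r)).log fun _ => (partition_pos hw _).ne'

theorem hasDerivAt_sqrt_mul_one_sub {r : ℝ} (h0 : 0 < r) (h1 : r < 1) :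
    HasDerivAt (fun r => Real.sqrt (r * (1 - r))) ((1 - 2 * r) / (2 * Real.sqrt (r * (1 - r)))) r := by
  have h : HasDerivAt (fun r : ℝ => r * (1 - r)) (1 - 2 * r) r :=
    ((hasDerivAt_id r).mul ((hasDerivAt_id r).const_sub 1)).congr_deriv (by simp; ring)
  exact h.sqrt (mul_pos h0 (by linarith)).ne'

/-- The derivative of the exponents in the time of the bridge, for fixed `y` and `W`. -/
def expoSpeed (m : ι → E d) (r : ℝ) (y W : E d) (a : ι) : ℝ :=
  inner ℝ y (m a) - ‖m a‖ ^ 2 / 2 +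
    (1 - 2 * r) / (2 * Real.sqrt (r * (1 - r))) * inner ℝ W (m a)

omit [Fintype ι] in
theorem hasDerivAt_expo (m : ι → E d) {r : ℝ} (h0 : 0 < r) (h1 : r < 1) (y W : E d) (a : ι) :
    HasDerivAt (fun r => expo m r (bridgePoint r y W) a) (expoSpeed m r y W a) r := by
  have e : (fun r => expo m r (bridgePoint r y W) a) = fun r =>
      r * (inner ℝ y (m a) - ‖m a‖ ^ 2 / 2) + Real.sqrt (r * (1 - r)) * inner ℝ W (m a) := by
    funext r
    simp only [expo, bridgePoint, inner_add_left, inner_smul_left, conj_trivial]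
    ring
  rw [e]
  exact (((hasDerivAt_id r).mul_const _).add
    ((hasDerivAt_sqrt_mul_one_sub h0 h1).mul_const _)).congr_deriv (by simp [expoSpeed])

omit [Fintype ι] in
theorem hasDerivAt_expo_line (m : ι → E d) (r : ℝ) (y W v : E d) (t : ℝ) (a : ι) :
    HasDerivAt (fun t : ℝ => expo m r (bridgePoint r y (W + t • v)) a)
      (Real.sqrt (r * (1 - r)) * inner ℝ v (m a)) t := by
  have e : (fun t : ℝ => expo m r (bridgePoint r y (W + t • v)) a) = fun t =>
      t * (Real.sqrt (r * (1 - r)) * inner ℝ v (m a)) + expo m r (bridgePoint r y W) a := by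
    funext t
    simp only [expo, bridgePoint, inner_add_left, inner_smul_left, conj_trivial, smul_add]
    ring
  rw [e]
  exact (((hasDerivAt_id t).mul_const _).add_const _).congr_deriv (by simp)

variable {Q : Measure (E d)} [IsProbabilityMeasure Q]

/-- The common dominating function of the integrands below. -/
def envelope (q : E d × E d) : ℝ := (1 + ‖q.1‖) ^ 2 * (1 + ‖q.2‖) ^ 2

theorem integrable_one_add_norm_sq {μ : Measure (E d)} [IsProbabilityMeasure μ]
    (h : Integrable (fun y => ‖y‖ ^ 2) μ) : Integrable (fun y => (1 + ‖y‖) ^ 2) μ := by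
  refine (((integrable_const (2 : ℝ)).add (h.const_mul 2))).mono' (by fun_prop)
    (.of_forall fun y => ?_)
  rw [Real.norm_of_nonneg (sq_nonneg _)]
  simp only [Pi.add_apply]
  nlinarith [sq_nonneg (1 - ‖y‖)]

theorem integrable_envelope (hQ : Integrable (fun y => ‖y‖ ^ 2) Q) :
    Integrable (envelope (d := d)) (Q.prod (stdGaussian (E d))) :=
  (integrable_one_add_norm_sq hQ).mul_prod
    (integrable_one_add_norm_sq integrable_norm_sq_stdGaussian)

theorem one_le_envelope (q : E d × E d) : 1 ≤ envelope q := by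
  unfold envelope
  have h1 : 1 ≤ (1 + ‖q.1‖) ^ 2 := one_le_pow₀ (by linarith [norm_nonneg q.1])
  have h2 : 1 ≤ (1 + ‖q.2‖) ^ 2 := one_le_pow₀ (by linarith [norm_nonneg q.2])
  exact one_le_mul_of_one_le_of_one_le h1 h2

theorem mul_le_envelope {i j : ℕ} (hi : i ≤ 2) (hj : j ≤ 2) (q : E d × E d) :
    (1 + ‖q.1‖) ^ i * (1 + ‖q.2‖) ^ j ≤ envelope q := by
  unfold envelope
  have h1 : 1 ≤ 1 + ‖q.1‖ := by linarith [norm_nonneg q.1]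
  have h2 : 1 ≤ 1 + ‖q.2‖ := by linarith [norm_nonneg q.2]
  exact mul_le_mul (pow_le_pow_right₀ h1 hi) (pow_le_pow_right₀ h2 hj) (by positivity)
    (by positivity)

/-- The domination criterion behind all integrability claims on path space. -/
theorem integrable_of_le_envelope (hQ : Integrable (fun y => ‖y‖ ^ 2) Q) {f : E d × E d → ℝ}
    (hf : AEStronglyMeasurable f (Q.prod (stdGaussian (E d)))) {c : ℝ}
    (h : ∀ q, |f q| ≤ c * envelope q) : Integrable f (Q.prod (stdGaussian (E d))) :=
  ((integrable_envelope hQ).const_mul c).mono' hf (.of_forall h)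

/-- Gaussian integration by parts in the second variable of `Q ⊗ N(0, I)`. -/
theorem integral_sum_mul_inner_prod (hQ : Integrable (fun y => ‖y‖ ^ 2) Q) {g : E d → ℝ}
    (hg : Measurable g) (hg1 : ∀ y, |g y| ≤ 1) (m : ι → E d) {f f' : ι → E d → E d → ℝ}
    (hf : ∀ a, Continuous fun q : E d × E d => f a q.1 q.2)
    (hf' : ∀ a, Continuous fun q : E d × E d => f' a q.1 q.2) {c : ℝ}
    (bf : ∀ a y W, |f a y W| ≤ c * (1 + ‖y‖)) (bf' : ∀ a y W, |f' a y W| ≤ c * (1 + ‖y‖))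
    (hd : ∀ a y W, HasLineDerivAt ℝ (f a y) (f' a y W) W (m a)) :
    ∫ q, g q.1 * ∑ a, f a q.1 q.2 * inner ℝ q.2 (m a) ∂(Q.prod (stdGaussian (E d))) =
      ∫ q, g q.1 * ∑ a, f' a q.1 q.2 ∂(Q.prod (stdGaussian (E d))) := by
  have hc : ∀ y : E d, ∀ _ : ι, 0 ≤ c * (1 + ‖y‖) := fun y a => (abs_nonneg _).trans (bf a y 0)
  have h1 : ∀ a, Integrable (fun q : E d × E d => g q.1 * (f a q.1 q.2 * inner ℝ q.2 (m a)))
      (Q.prod (stdGaussian (E d))) := by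
    intro a
    have hc0 : 0 ≤ c := by
      by_contra hneg
      have := hc 0 a
      simp at this; linarith
    refine integrable_of_le_envelope hQ (c := c * ‖m a‖) ?_ fun q => ?_
    · refine Measurable.aestronglyMeasurable ((hg.comp measurable_fst).mul ?_)
      exact ((hf a).mul (by fun_prop)).measurable
    · rw [abs_mul, abs_mul]
      have e1 := abs_real_inner_le_norm q.2 (m a)
      have e2 := mul_le_envelope (i := 1) (j := 1) (by norm_num) (by norm_num) q
      calc |g q.1| * (|f a q.1 q.2| * |inner ℝ q.2 (m a)|) ≤
          1 * (c * (1 + ‖q.1‖) * ((1 + ‖q.2‖) * ‖m a‖)) := by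
            refine mul_le_mul (hg1 _) (mul_le_mul (bf a _ _) (e1.trans ?_) (abs_nonneg _)
              (hc _ a)) (by positivity) zero_le_one
            nlinarith [norm_nonneg (m a)]
        _ = c * ‖m a‖ * ((1 + ‖q.1‖) ^ 1 * (1 + ‖q.2‖) ^ 1) := by ring
        _ ≤ _ := mul_le_mul_of_nonneg_left e2 (by positivity)
  have h2 : ∀ a, Integrable (fun q : E d × E d => g q.1 * f' a q.1 q.2)
      (Q.prod (stdGaussian (E d))) := by
    intro a
    have hc0 : 0 ≤ c := by
      by_contra hneg
      have := hc 0 a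
      simp at this; linarith
    refine integrable_of_le_envelope hQ (c := c) ?_ fun q => ?_
    · exact Measurable.aestronglyMeasurable ((hg.comp measurable_fst).mul (hf' a).measurable)
    · rw [abs_mul]
      have e2 := mul_le_envelope (i := 1) (j := 0) (by norm_num) (by norm_num) q
      calc |g q.1| * |f' a q.1 q.2| ≤ 1 * (c * (1 + ‖q.1‖)) :=
            mul_le_mul (hg1 _) (bf' a _ _) (abs_nonneg _) zero_le_one
        _ = c * ((1 + ‖q.1‖) ^ 1 * (1 + ‖q.2‖) ^ 0) := by ring
        _ ≤ _ := mul_le_mul_of_nonneg_left e2 hc0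
  simp_rw [Finset.mul_sum]
  rw [integral_finsetSum _ fun a _ => h1 a, integral_finsetSum _ fun a _ => h2 a]
  refine Finset.sum_congr rfl fun a _ => ?_
  rw [integral_prod _ (h1 a), integral_prod _ (h2 a)]
  refine integral_congr_ae (.of_forall fun y => ?_)
  simp only []
  rw [integral_const_mul, integral_const_mul]
  congr 1
  have hfy : Continuous (f a y) := (hf a).comp (by fun_prop : Continuous fun W => (y, W))
  have hfy' : Continuous (f' a y) := (hf' a).comp (by fun_prop : Continuous fun W => (y, W))
  refine integral_mul_inner_stdGaussian (m a) (hd a y) ?_ ?_ ?_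
  · exact Integrable.of_bound hfy.aestronglyMeasurable _ (.of_forall (bf a y))
  · exact Integrable.of_bound hfy'.aestronglyMeasurable _ (.of_forall (bf' a y))
  · refine ((integrable_norm_stdGaussian (d := d)).const_mul
      (c * (1 + ‖y‖) * ‖m a‖)).mono' (by fun_prop) (.of_forall fun W => ?_)
    rw [Real.norm_eq_abs, abs_mul]
    calc _ ≤ (c * (1 + ‖y‖)) * (‖W‖ * ‖m a‖) :=
          mul_le_mul (bf a y W) (abs_real_inner_le_norm _ _) (abs_nonneg _) (hc y a)
      _ = _ := by ring

end Bridge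

/-! ### Gaussian integration by parts along the bridge -/

section Bridge

variable {ι : Type*} [Fintype ι] {d : ℕ}

/-- A crude common bound on the points. It depends on the means, and only enters integrability and
differentiation under the integral, never the final constants. -/
theorem norm_le_one_add_sum (m : ι → E d) (a : ι) : ‖m a‖ ≤ 1 + ∑ b, ‖m b‖ := by
  have := Finset.single_le_sum (f := fun b => ‖m b‖) (fun b _ => norm_nonneg _) (Finset.mem_univ a)
  linarith

theorem one_le_one_add_sum (m : ι → E d) : 1 ≤ 1 + ∑ b, ‖m b‖ := by
  have := Finset.sum_nonneg (s := Finset.univ) fun b _ => norm_nonneg (m b)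
  linarith

theorem sum_mul_inner_self_sub {p : ι → ℝ} (hp : ∑ a, p a = 1) (m : ι → E d) :
    ∑ a, p a * (inner ℝ (m a) (m a) - ∑ b, p b * inner ℝ (m a) (m b)) = wvar p m := by
  have h1 : ∀ a, ∑ b, p b * inner ℝ (m a) (m b) = inner ℝ (m a) (wmean p m) := by
    intro a
    simp_rw [← inner_smul_right]
    rw [← inner_sum]; rfl
  have h2 : ∑ a, p a * inner ℝ (m a) (wmean p m) = ‖wmean p m‖ ^ 2 := by
    rw [← real_inner_self_eq_norm_sq, wmean, sum_inner]
    simp only [inner_smul_left, conj_trivial]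
  simp_rw [h1, mul_sub, Finset.sum_sub_distrib]
  rw [h2, wvar_eq hp]
  simp_rw [real_inner_self_eq_norm_sq]

variable [Nonempty ι] {w : ι → ℝ} {m : ι → E d} {Q : Measure (E d)} [IsProbabilityMeasure Q]
  {g : E d → ℝ}

theorem bridgePost_nonneg (hw : ∀ a, 0 < w a) (m : ι → E d) (r : ℝ) (y W : E d) (a : ι) :
    0 ≤ bridgePost w m r y W a := (softmax_pos hw _ a).le

theorem sum_bridgePost (hw : ∀ a, 0 < w a) (m : ι → E d) (r : ℝ) (y W : E d) :
    ∑ a, bridgePost w m r y W a = 1 := sum_softmax hw _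

theorem integrable_mul_of_abs_le (hQ : Integrable (fun y => ‖y‖ ^ 2) Q)
    (hg : Measurable g) (hg1 : ∀ y, |g y| ≤ 1) {f : E d × E d → ℝ} (hf : Continuous f) {c : ℝ}
    (h : ∀ q, |f q| ≤ c * envelope q) :
    Integrable (fun q => g q.1 * f q) (Q.prod (stdGaussian (E d))) := by
  refine integrable_of_le_envelope hQ
    (((hg.comp measurable_fst).mul hf.measurable).aestronglyMeasurable) (c := c) fun q => ?_
  rw [abs_mul]
  calc |g q.1| * |f q| ≤ 1 * |f q| := mul_le_mul_of_nonneg_right (hg1 _) (abs_nonneg _)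
    _ ≤ _ := by rw [one_mul]; exact h q

theorem one_add_norm_le_envelope (q : E d × E d) : 1 + ‖q.1‖ ≤ envelope q := by
  simpa using mul_le_envelope (i := 1) (j := 0) (by norm_num) (by norm_num) q

theorem hasLineDerivAt_bridgePost (hw : ∀ a, 0 < w a) (m : ι → E d) (r : ℝ) (y W v : E d)
    (a : ι) :
    HasLineDerivAt ℝ (fun W => bridgePost w m r y W a)
      (bridgePost w m r y W a * (Real.sqrt (r * (1 - r)) * inner ℝ v (m a) -
        ∑ b, bridgePost w m r y W b * (Real.sqrt (r * (1 - r)) * inner ℝ v (m b)))) W v := by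
  have h := hasDerivAt_softmax hw (fun b => hasDerivAt_expo_line m r y W v 0 b) a
  simpa [HasLineDerivAt, bridgePost] using h

theorem hasLineDerivAt_bridgePost_mul_drive (hw : ∀ a, 0 < w a) (m : ι → E d) (r : ℝ)
    (y W v : E d) (a : ι) :
    HasLineDerivAt ℝ (fun W => bridgePost w m r y W a * drive r y m (bridgePost w m r y W) a)
      (Real.sqrt (r * (1 - r)) * (bridgePost w m r y W a * (inner ℝ v (m a) -
        ∑ b, bridgePost w m r y W b * inner ℝ v (m b)) * drive r y m (bridgePost w m r y W) a -
        bridgePost w m r y W a * ∑ b, bridgePost w m r y W b * inner ℝ v (m b) *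
          ((1 - 2 * r) * inner ℝ (m a - wmean (bridgePost w m r y W) m)
            (m b - wmean (bridgePost w m r y W) m) + drive r y m (bridgePost w m r y W) b)))
      W v := by
  have h := fun a => hasDerivAt_softmax hw (fun b => hasDerivAt_expo_line m r y W v 0 b) a
  have hk := hasDerivAt_drive m r y (fun t => sum_softmax hw _) h a
  have h2 := (h a).mul hk
  simp only [zero_smul, add_zero] at h2
  unfold HasLineDerivAt
  refine h2.congr_deriv ?_
  change _ = Real.sqrt (r * (1 - r)) * (softmax w (expo m r (bridgePoint r y W)) a * _ * _ - _)
  simp only [bridgePost]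
  have e1 : ∑ b, softmax w (expo m r (bridgePoint r y W)) b *
      (Real.sqrt (r * (1 - r)) * inner ℝ v (m b)) = Real.sqrt (r * (1 - r)) *
      ∑ b, softmax w (expo m r (bridgePoint r y W)) b * inner ℝ v (m b) := by
    rw [Finset.mul_sum]; exact Finset.sum_congr rfl fun b _ => by ring
  have e2 : ∀ X : ι → ℝ, ∑ b, softmax w (expo m r (bridgePoint r y W)) b *
      (Real.sqrt (r * (1 - r)) * inner ℝ v (m b)) * X b = Real.sqrt (r * (1 - r)) *
      ∑ b, softmax w (expo m r (bridgePoint r y W)) b * inner ℝ v (m b) * X b := by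
    intro X
    rw [Finset.mul_sum]; exact Finset.sum_congr rfl fun b _ => by ring
  rw [e1, e2]
  ring

/-- Integration by parts turns the term linear in the driving Gaussian into the posterior
variance. -/
theorem integral_mul_sum_bridgePost (hw : ∀ a, 0 < w a) (m : ι → E d)
    (hQ : Integrable (fun y => ‖y‖ ^ 2) Q) (hg : Measurable g) (hg1 : ∀ y, |g y| ≤ 1) (r : ℝ) :
    ∫ q, g q.1 * ∑ a, bridgePost w m r q.1 q.2 a * inner ℝ q.2 (m a)
        ∂(Q.prod (stdGaussian (E d))) =
      ∫ q, g q.1 * (Real.sqrt (r * (1 - r)) * wvar (bridgePost w m r q.1 q.2) m)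
        ∂(Q.prod (stdGaussian (E d))) := by
  set B := 1 + ∑ b, ‖m b‖ with hB
  set s := Real.sqrt (r * (1 - r))
  have hs : 0 ≤ s := Real.sqrt_nonneg _
  have hmB := norm_le_one_add_sum m
  have hB1 := one_le_one_add_sum m
  rw [← hB] at hB1
  have hin : ∀ a b, |s * inner ℝ (m a) (m b)| ≤ s * B ^ 2 := by
    intro a b
    rw [abs_mul, abs_of_nonneg hs]
    refine mul_le_mul_of_nonneg_left ((abs_real_inner_le_norm _ _).trans ?_) hs
    rw [sq]
    exact mul_le_mul (hmB a) (hmB b) (norm_nonneg _) (by linarith)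
  have hp := continuous_bridgePost hw m r
  have hpr : ∀ q : E d × E d, ∀ a, Continuous (fun x : E d × E d => bridgePost w m r x.1 x.2 a) :=
    fun _ a => hp a
  rw [integral_sum_mul_inner_prod (c := 1 + 2 * s * B ^ 2) hQ hg hg1 m (f := fun a y W => bridgePost w m r y W a)
    (f' := fun a y W => bridgePost w m r y W a * (s * inner ℝ (m a) (m a) -
        ∑ b, bridgePost w m r y W b * (s * inner ℝ (m a) (m b)))) hp
    (fun a => (hp a).mul (continuous_const.sub (continuous_finsetSum _ fun b _ =>
      (hp b).mul continuous_const))) ?_ ?_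
    (fun a y W => hasLineDerivAt_bridgePost hw m r y W (m a) a)]
  · refine integral_congr_ae (.of_forall fun q => ?_)
    simp only []
    congr 1
    rw [← sum_mul_inner_self_sub (sum_bridgePost hw m r q.1 q.2), Finset.mul_sum]
    refine Finset.sum_congr rfl fun a _ => ?_
    have : ∑ b, bridgePost w m r q.1 q.2 b * (s * inner ℝ (m a) (m b)) =
        s * ∑ b, bridgePost w m r q.1 q.2 b * inner ℝ (m a) (m b) := by
      rw [Finset.mul_sum]; exact Finset.sum_congr rfl fun b _ => by ring
    rw [this]
    ring
  · intro a y W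
    rw [abs_of_nonneg (bridgePost_nonneg hw m r y W a)]
    have := softmax_le_one hw (expo m r (bridgePoint r y W)) a
    have h0 : 0 ≤ s * B ^ 2 := by positivity
    change softmax w (expo m r (bridgePoint r y W)) a ≤ _
    nlinarith [norm_nonneg y]
  · intro a y W
    have h1 := abs_sum_mul_le (bridgePost_nonneg hw m r y W) (sum_bridgePost hw m r y W)
      (f := fun b => s * inner ℝ (m a) (m b)) (hin a)
    have h2 := hin a a
    have h3 := abs_sub (s * inner ℝ (m a) (m a))
      (∑ b, bridgePost w m r y W b * (s * inner ℝ (m a) (m b)))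
    have h4 := softmax_le_one hw (expo m r (bridgePoint r y W)) a
    rw [abs_mul, abs_of_nonneg (bridgePost_nonneg hw m r y W a)]
    have h0 : 0 ≤ s * B ^ 2 := by positivity
    calc _ ≤ 1 * (2 * s * B ^ 2) :=
          mul_le_mul h4 (by linarith) (abs_nonneg _) zero_le_one
      _ ≤ _ := by nlinarith [norm_nonneg y]

/-- Integration by parts for the linear term of the second derivative. -/
theorem integral_mul_sum_bridgePost_drive (hw : ∀ a, 0 < w a) (m : ι → E d)
    (hQ : Integrable (fun y => ‖y‖ ^ 2) Q) (hg : Measurable g) (hg1 : ∀ y, |g y| ≤ 1) {r : ℝ}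
    (hr0 : 0 ≤ r) (hr1 : r ≤ 1) :
    ∫ q, g q.1 * ∑ a, bridgePost w m r q.1 q.2 a * drive r q.1 m (bridgePost w m r q.1 q.2) a *
        inner ℝ q.2 (m a) ∂(Q.prod (stdGaussian (E d))) =
      ∫ q, g q.1 * (Real.sqrt (r * (1 - r)) *
        (∑ a, bridgePost w m r q.1 q.2 a * ‖m a - wmean (bridgePost w m r q.1 q.2) m‖ ^ 2 *
            drive r q.1 m (bridgePost w m r q.1 q.2) a -
          (1 - 2 * r) * wcovSq (bridgePost w m r q.1 q.2) m)) ∂(Q.prod (stdGaussian (E d))) := by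
  set B := 1 + ∑ b, ‖m b‖ with hB
  set s := Real.sqrt (r * (1 - r))
  have hs : 0 ≤ s := Real.sqrt_nonneg _
  have hmB := norm_le_one_add_sum m
  have hB1 := one_le_one_add_sum m
  rw [← hB] at hB1
  have hin : ∀ a b, |inner ℝ (m a) (m b)| ≤ B ^ 2 := by
    intro a b
    refine (abs_real_inner_le_norm _ _).trans ?_
    rw [sq]
    exact mul_le_mul (hmB a) (hmB b) (norm_nonneg _) (by linarith)
  have hp := continuous_bridgePost hw m r
  have hk := fun a => continuous_drive (m := m) hp r (continuous_fst) a
  have hM := continuous_wmean (m := m) hp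
  have hkB : ∀ y W a, |drive r y m (bridgePost w m r y W) a| ≤ 8 * B ^ 2 * (1 + ‖y‖) :=
    fun y W a => abs_drive_le (bridgePost_nonneg hw m r y W) (sum_bridgePost hw m r y W) hmB hB1
      hr0 hr1 y a
  have hpk : ∀ y W a, |bridgePost w m r y W a| ≤ 1 := by
    intro y W a
    rw [abs_of_nonneg (bridgePost_nonneg hw m r y W a)]
    exact softmax_le_one hw (expo m r (bridgePoint r y W)) a
  rw [integral_sum_mul_inner_prod (c := 8 * B ^ 2 + s * (28 * B ^ 4)) hQ hg hg1 m
    (f := fun a y W => bridgePost w m r y W a * drive r y m (bridgePost w m r y W) a)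
    (f' := fun a y W => s * (bridgePost w m r y W a * (inner ℝ (m a) (m a) -
        ∑ b, bridgePost w m r y W b * inner ℝ (m a) (m b)) * drive r y m (bridgePost w m r y W) a -
        bridgePost w m r y W a * ∑ b, bridgePost w m r y W b * inner ℝ (m a) (m b) *
          ((1 - 2 * r) * inner ℝ (m a - wmean (bridgePost w m r y W) m)
            (m b - wmean (bridgePost w m r y W) m) + drive r y m (bridgePost w m r y W) b)))
    (fun a => (hp a).mul (hk a)) ?_ ?_ ?_
    (fun a y W => hasLineDerivAt_bridgePost_mul_drive hw m r y W (m a) a)]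
  · refine integral_congr_ae (.of_forall fun q => ?_)
    simp only []
    rw [← sum_laplacian_drive (sum_bridgePost hw m r q.1 q.2), Finset.mul_sum _ _ s]
  · intro a
    refine continuous_const.mul ((((hp a).mul (continuous_const.sub (continuous_finsetSum _
      fun b _ => (hp b).mul continuous_const))).mul (hk a)).sub ((hp a).mul
      (continuous_finsetSum _ fun b _ => ((hp b).mul continuous_const).mul ((continuous_const.mul
        ?_).add (hk b)))))
    fun_prop
  · intro a y W
    rw [abs_mul]
    calc _ ≤ 1 * (8 * B ^ 2 * (1 + ‖y‖)) :=
          mul_le_mul (hpk y W a) (hkB y W a) (abs_nonneg _) zero_le_one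
      _ ≤ _ := by
          have : 0 ≤ s * (28 * B ^ 4) * (1 + ‖y‖) := by positivity
          nlinarith
  · intro a y W
    set p := bridgePost w m r y W with hpdef
    have hp0 : ∀ a, 0 ≤ p a := bridgePost_nonneg hw m r y W
    have hp1 : ∑ a, p a = 1 := sum_bridgePost hw m r y W
    have h1 := abs_sum_mul_le hp0 hp1 (f := fun b => inner ℝ (m a) (m b)) (hin a)
    have h3 : |inner ℝ (m a) (m a) - ∑ b, p b * inner ℝ (m a) (m b)| ≤ 2 * B ^ 2 :=
      (abs_sub _ _).trans (by linarith [hin a a])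
    have hv : ∀ b, |(1 - 2 * r) * inner ℝ (m a - wmean p m) (m b - wmean p m) +
        drive r y m p b| ≤ 12 * B ^ 2 * (1 + ‖y‖) := by
      intro b
      have e1 : |inner ℝ (m a - wmean p m) (m b - wmean p m)| ≤ 4 * B ^ 2 := by
        refine (abs_real_inner_le_norm _ _).trans ?_
        calc _ ≤ (2 * B) * (2 * B) := mul_le_mul (norm_sub_wmean_le hp0 hp1 hmB a)
              (norm_sub_wmean_le hp0 hp1 hmB b) (norm_nonneg _) (by linarith)
          _ = _ := by ring
      have e2 : |1 - 2 * r| ≤ 1 := by rw [abs_le]; constructor <;> linarith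
      refine (abs_add_le _ _).trans ?_
      rw [abs_mul]
      have e3 := mul_le_mul e2 e1 (abs_nonneg _) zero_le_one
      have e4 := hkB y W b
      have e5 : 0 ≤ B ^ 2 * ‖y‖ := by positivity
      nlinarith
    have h4 := abs_sum_mul_le hp0 hp1 (f := fun b => inner ℝ (m a) (m b) * ((1 - 2 * r) *
      inner ℝ (m a - wmean p m) (m b - wmean p m) + drive r y m p b))
      (c := B ^ 2 * (12 * B ^ 2 * (1 + ‖y‖))) (fun b => by
        rw [abs_mul]
        exact mul_le_mul (hin a b) (hv b) (abs_nonneg _) (by positivity))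
    simp_rw [← mul_assoc (p _)] at h4
    rw [abs_mul, abs_of_nonneg hs]
    have h5 : |p a * (inner ℝ (m a) (m a) - ∑ b, p b * inner ℝ (m a) (m b)) * drive r y m p a| ≤
        16 * B ^ 4 * (1 + ‖y‖) := by
      rw [abs_mul, abs_mul]
      calc _ ≤ 1 * (2 * B ^ 2) * (8 * B ^ 2 * (1 + ‖y‖)) := by
            refine mul_le_mul (mul_le_mul (hpk y W a) h3 (abs_nonneg _) zero_le_one) (hkB y W a)
              (abs_nonneg _) (by positivity)
        _ = _ := by ring
    have h6 : |p a * ∑ b, p b * inner ℝ (m a) (m b) * ((1 - 2 * r) *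
        inner ℝ (m a - wmean p m) (m b - wmean p m) + drive r y m p b)| ≤
        12 * B ^ 4 * (1 + ‖y‖) := by
      rw [abs_mul]
      calc _ ≤ 1 * (B ^ 2 * (12 * B ^ 2 * (1 + ‖y‖))) :=
            mul_le_mul (hpk y W a) h4 (abs_nonneg _) zero_le_one
        _ = _ := by ring
    have h7 := (abs_sub (p a * (inner ℝ (m a) (m a) - ∑ b, p b * inner ℝ (m a) (m b)) *
      drive r y m p a) (p a * ∑ b, p b * inner ℝ (m a) (m b) * ((1 - 2 * r) *
        inner ℝ (m a - wmean p m) (m b - wmean p m) + drive r y m p b))).trans (add_le_add h5 h6)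
    have h8 := mul_le_mul_of_nonneg_left h7 hs
    have h9 : 0 ≤ B ^ 2 * (1 + ‖y‖) := by positivity
    refine h8.trans ?_
    nlinarith

end Bridge

/-! ### Taylor expansion of the mean log-partition function -/

section Bridge

variable {ι : Type*} [Fintype ι] {d : ℕ}

variable [Nonempty ι] {w : ι → ℝ} {m : ι → E d} {Q : Measure (E d)} [IsProbabilityMeasure Q]
  {g : E d → ℝ}

omit [Nonempty ι] in
theorem sum_mul_expoSpeed {p : ι → ℝ} (hp : ∑ a, p a = 1) (m : ι → E d) {r : ℝ} (y W : E d) :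
    ∑ a, p a * expoSpeed m r y W a = inner ℝ y (wmean p m) - (wvar p m + ‖wmean p m‖ ^ 2) / 2 +
      (1 - 2 * r) / (2 * Real.sqrt (r * (1 - r))) * ∑ a, p a * inner ℝ W (m a) := by
  have h1 : inner ℝ y (wmean p m) = ∑ a, p a * inner ℝ y (m a) := by
    simp_rw [← inner_smul_right]
    rw [← inner_sum]; rfl
  have h2 := wvar_eq hp m
  rw [h1, h2, sub_add_cancel, Finset.mul_sum, Finset.sum_div, ← Finset.sum_sub_distrib,
    ← Finset.sum_add_distrib]
  exact Finset.sum_congr rfl fun a _ => by unfold expoSpeed; ring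

omit [Nonempty ι] in
theorem sum_mul_expoSpeed_mul_drive {p : ι → ℝ} (hp : ∑ a, p a = 1) (m : ι → E d) {r : ℝ}
    (y W : E d) :
    ∑ a, p a * expoSpeed m r y W a * drive r y m p a =
      ∑ a, p a * drive r y m p a * (inner ℝ (y - wmean p m) (m a - wmean p m) -
        ‖m a - wmean p m‖ ^ 2 / 2) +
      (1 - 2 * r) / (2 * Real.sqrt (r * (1 - r))) *
        ∑ a, p a * drive r y m p a * inner ℝ W (m a) := by
  have h0 := sum_mul_drive hp r y m
  have h1 : ∀ a, p a * expoSpeed m r y W a * drive r y m p a =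
      p a * drive r y m p a * (inner ℝ (y - wmean p m) (m a - wmean p m) -
        ‖m a - wmean p m‖ ^ 2 / 2) +
      (1 - 2 * r) / (2 * Real.sqrt (r * (1 - r))) * (p a * drive r y m p a * inner ℝ W (m a)) +
      (inner ℝ y (wmean p m) - ‖wmean p m‖ ^ 2 / 2) * (p a * drive r y m p a) := by
    intro a
    unfold expoSpeed
    rw [norm_sub_sq_real, inner_sub_left, inner_sub_right, inner_sub_right,
      real_inner_self_eq_norm_sq, real_inner_comm (wmean p m) (m a)]
    ring
  simp_rw [h1, Finset.sum_add_distrib, ← Finset.mul_sum]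
  rw [h0]
  ring

omit [Nonempty ι] in
/-- The terms that remain after integration by parts assemble to a square: this identifies the
second derivative. -/
theorem sum_mul_drive_sq {p : ι → ℝ} (hp : ∑ a, p a = 1) (m : ι → E d) (r : ℝ) (y : E d) :
    ∑ a, p a * drive r y m p a * (inner ℝ (y - wmean p m) (m a - wmean p m) -
        ‖m a - wmean p m‖ ^ 2 / 2) + (1 - 2 * r) / 2 *
      (∑ a, p a * ‖m a - wmean p m‖ ^ 2 * drive r y m p a - (1 - 2 * r) * wcovSq p m)
      - wvar p m = bridgeDeriv2 r y m p := by
  have h0 := sum_mul_drive hp r y m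
  have h1 : ∀ a, p a * drive r y m p a ^ 2 =
      p a * drive r y m p a * (inner ℝ (y - wmean p m) (m a - wmean p m) -
        ‖m a - wmean p m‖ ^ 2 / 2) + (1 - 2 * r) / 2 *
      (p a * ‖m a - wmean p m‖ ^ 2 * drive r y m p a) +
      r * wvar p m * (p a * drive r y m p a) := by
    intro a
    rw [sq, drive]
    ring
  unfold bridgeDeriv2
  simp_rw [h1, Finset.sum_add_distrib, ← Finset.mul_sum]
  rw [h0]
  ring

omit [Nonempty ι] in
/-- A neighbourhood of an interior time on which the speed of the exponents is bounded. -/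
theorem exists_expoSpeed_bound (m : ι → E d) {r : ℝ} (h0 : 0 < r) (h1 : r < 1) :
    ∃ s ∈ nhds r, s ⊆ Set.Ioo 0 1 ∧ ∃ c, 0 ≤ c ∧ ∀ x ∈ s, ∀ y W a,
      |expoSpeed m x y W a| ≤ c * ((1 + ‖y‖) * (1 + ‖W‖)) := by
  set B := 1 + ∑ b, ‖m b‖ with hB
  have hB1 := one_le_one_add_sum m
  rw [← hB] at hB1
  set L := Real.sqrt (r / 2 * ((1 - r) / 2)) with hL
  have hLpos : 0 < L := Real.sqrt_pos.2 (mul_pos (by linarith) (by linarith))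
  refine ⟨Set.Ioo (r / 2) ((1 + r) / 2), Ioo_mem_nhds (by linarith) (by linarith),
    fun x hx => ⟨by linarith [hx.1], by linarith [hx.2]⟩, B ^ 2 * (1 + 1 / (2 * L)),
    by positivity, fun x hx y W a => ?_⟩
  have hmB := norm_le_one_add_sum m a
  rw [← hB] at hmB
  have hx0 : 0 < x := by linarith [hx.1]
  have hx1 : x < 1 := by linarith [hx.2]
  have e1 : L ≤ Real.sqrt (x * (1 - x)) :=
    Real.sqrt_le_sqrt (mul_le_mul hx.1.le (by linarith [hx.2]) (by linarith) hx0.le)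
  have e2 : |(1 - 2 * x) / (2 * Real.sqrt (x * (1 - x)))| ≤ 1 / (2 * L) := by
    rw [abs_div, abs_of_pos (by linarith : 0 < 2 * Real.sqrt (x * (1 - x)))]
    exact div_le_div₀ zero_le_one (by rw [abs_le]; constructor <;> linarith) (by linarith)
      (by linarith)
  have e3 : |inner ℝ y (m a)| ≤ ‖y‖ * B :=
    (abs_real_inner_le_norm _ _).trans (mul_le_mul_of_nonneg_left hmB (norm_nonneg _))
  have e4 : |inner ℝ W (m a)| ≤ ‖W‖ * B :=
    (abs_real_inner_le_norm _ _).trans (mul_le_mul_of_nonneg_left hmB (norm_nonneg _))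
  have e5 : |‖m a‖ ^ 2 / 2| ≤ B ^ 2 := by
    rw [abs_of_nonneg (by positivity)]
    have := pow_le_pow_left₀ (norm_nonneg _) hmB 2
    nlinarith [sq_nonneg ‖m a‖]
  have e6 : |(1 - 2 * x) / (2 * Real.sqrt (x * (1 - x))) * inner ℝ W (m a)| ≤
      1 / (2 * L) * (‖W‖ * B) := by
    rw [abs_mul]
    exact mul_le_mul e2 e4 (abs_nonneg _) (by positivity)
  unfold expoSpeed
  refine (abs_add_le _ _).trans ?_
  refine (add_le_add (abs_sub _ _) le_rfl).trans ?_
  refine (add_le_add (add_le_add e3 e5) e6).trans ?_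
  have hB2 : B ≤ B ^ 2 := by nlinarith
  have i1 : ‖y‖ * B ≤ B ^ 2 * ‖y‖ := by nlinarith [norm_nonneg y]
  have i2 : 1 / (2 * L) * (‖W‖ * B) ≤ B ^ 2 * (1 / (2 * L)) * ‖W‖ := by
    have : 0 ≤ 1 / (2 * L) * ‖W‖ := by positivity
    nlinarith
  have i3 : B ^ 2 * (1 + 1 / (2 * L)) * ((1 + ‖y‖) * (1 + ‖W‖)) =
      B ^ 2 * ‖y‖ + B ^ 2 + B ^ 2 * (1 / (2 * L)) * ‖W‖ + (B ^ 2 * ‖W‖ + B ^ 2 * ‖y‖ * ‖W‖ +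
      B ^ 2 * (1 / (2 * L)) * (1 + ‖y‖ + ‖y‖ * ‖W‖)) := by ring
  have i4 : 0 ≤ B ^ 2 * ‖W‖ + B ^ 2 * ‖y‖ * ‖W‖ +
      B ^ 2 * (1 / (2 * L)) * (1 + ‖y‖ + ‖y‖ * ‖W‖) := by positivity
  linarith

omit [Fintype ι] [Nonempty ι] in
theorem continuous_expoSpeed (m : ι → E d) (r : ℝ) (a : ι) :
    Continuous fun q : E d × E d => expoSpeed m r q.1 q.2 a := by
  unfold expoSpeed
  fun_prop

theorem abs_log_partition_le (hw : ∀ a, 0 < w a) (hw1 : ∑ a, w a = 1) {θ : ι → ℝ} {R : ℝ}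
    (h : ∀ a, |θ a| ≤ R) : |Real.log (partition w θ)| ≤ R := by
  have hpos := partition_pos hw θ
  rw [abs_le]
  constructor
  · rw [Real.le_log_iff_exp_le hpos]
    calc Real.exp (-R) = ∑ a, w a * Real.exp (-R) := by rw [← Finset.sum_mul, hw1, one_mul]
      _ ≤ _ := Finset.sum_le_sum fun a _ => mul_le_mul_of_nonneg_left
        (Real.exp_le_exp.2 (abs_le.1 (h a)).1) (hw a).le
  · rw [Real.log_le_iff_le_exp hpos]
    calc partition w θ ≤ ∑ a, w a * Real.exp R :=
          Finset.sum_le_sum fun a _ => mul_le_mul_of_nonneg_left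
            (Real.exp_le_exp.2 (abs_le.1 (h a)).2) (hw a).le
      _ = _ := by rw [← Finset.sum_mul, hw1, one_mul]

theorem exists_abs_bridgeLog_le (hw : ∀ a, 0 < w a) (hw1 : ∑ a, w a = 1) (m : ι → E d) :
    ∃ c, ∀ r ∈ Set.Icc (0 : ℝ) 1, ∀ q : E d × E d, |bridgeLog w m r q.1 q.2| ≤ c * envelope q := by
  set B := 1 + ∑ b, ‖m b‖ with hB
  have hB1 := one_le_one_add_sum m
  rw [← hB] at hB1
  refine ⟨B ^ 2, fun r hr q => ?_⟩
  have hb : ∀ a, |expo m r (bridgePoint r q.1 q.2) a| ≤ B ^ 2 * ((1 + ‖q.1‖) * (1 + ‖q.2‖)) := by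
    intro a
    have hmB := norm_le_one_add_sum m a
    rw [← hB] at hmB
    have hs : Real.sqrt (r * (1 - r)) ≤ 1 := by
      rw [Real.sqrt_le_iff]; exact ⟨zero_le_one, by nlinarith [hr.1, hr.2]⟩
    have h1 : ‖bridgePoint r q.1 q.2‖ ≤ ‖q.1‖ + ‖q.2‖ := by
      unfold bridgePoint
      refine (norm_add_le _ _).trans ?_
      rw [norm_smul, norm_smul, Real.norm_of_nonneg hr.1, Real.norm_of_nonneg (Real.sqrt_nonneg _)]
      have := mul_le_mul_of_nonneg_right hs (norm_nonneg q.2)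
      have := mul_le_mul_of_nonneg_right hr.2 (norm_nonneg q.1)
      linarith
    have h2 : |inner ℝ (bridgePoint r q.1 q.2) (m a)| ≤ (‖q.1‖ + ‖q.2‖) * B :=
      (abs_real_inner_le_norm _ _).trans (mul_le_mul h1 hmB (norm_nonneg _) (by positivity))
    have h3 : |r * ‖m a‖ ^ 2 / 2| ≤ B ^ 2 := by
      rw [abs_of_nonneg (by have := hr.1; positivity)]
      have := pow_le_pow_left₀ (norm_nonneg _) hmB 2
      nlinarith [sq_nonneg ‖m a‖, hr.1, hr.2]
    unfold expo
    refine (abs_sub _ _).trans ((add_le_add h2 h3).trans ?_)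
    have hB2 : B ≤ B ^ 2 := by nlinarith
    have : (‖q.1‖ + ‖q.2‖) * B ≤ (‖q.1‖ + ‖q.2‖) * B ^ 2 :=
      mul_le_mul_of_nonneg_left hB2 (by positivity)
    have : 0 ≤ B ^ 2 * (‖q.1‖ * ‖q.2‖) := by positivity
    nlinarith
  refine (abs_log_partition_le hw hw1 hb).trans ?_
  refine mul_le_mul_of_nonneg_left ?_ (by positivity)
  simpa using mul_le_envelope (i := 1) (j := 1) (by norm_num) (by norm_num) q

/-- The factor `√(r (1 - r))` gained by integration by parts cancels the singularity of the speed
of the bridge at its endpoints. -/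
theorem one_sub_two_mul_div_sqrt {r : ℝ} (h0 : 0 < r) (h1 : r < 1) (X : ℝ) :
    (1 - 2 * r) / (2 * Real.sqrt (r * (1 - r))) * (Real.sqrt (r * (1 - r)) * X) =
      (1 - 2 * r) / 2 * X := by
  have : Real.sqrt (r * (1 - r)) ≠ 0 := (Real.sqrt_pos.2 (mul_pos h0 (by linarith))).ne'
  field_simp

omit [Nonempty ι] in
theorem integrable_mul_sum_mul_inner (hQ : Integrable (fun y => ‖y‖ ^ 2) Q)
    (hg : Measurable g) (hg1 : ∀ y, |g y| ≤ 1) (m : ι → E d) {f : ι → E d × E d → ℝ}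
    (hf : ∀ a, Continuous (f a)) {c : ℝ} (h : ∀ a q, |f a q| ≤ c * (1 + ‖q.1‖)) :
    Integrable (fun q : E d × E d => g q.1 * ∑ a, f a q * inner ℝ q.2 (m a))
      (Q.prod (stdGaussian (E d))) := by
  refine integrable_mul_of_abs_le hQ hg hg1
    (continuous_finsetSum _ fun a _ => (hf a).mul (by fun_prop)) (c := ∑ a, c * ‖m a‖) fun q => ?_
  rw [Finset.sum_mul]
  refine (Finset.abs_sum_le_sum_abs _ _).trans (Finset.sum_le_sum fun a _ => ?_)
  rw [abs_mul]
  have hc : 0 ≤ c := by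
    by_contra hneg
    have := (abs_nonneg _).trans (h a 0)
    simp at this; linarith
  have e2 := mul_le_envelope (i := 1) (j := 1) (by norm_num) (by norm_num) q
  calc _ ≤ (c * (1 + ‖q.1‖)) * (‖q.2‖ * ‖m a‖) :=
        mul_le_mul (h a q) (abs_real_inner_le_norm _ _) (abs_nonneg _) (by positivity)
    _ ≤ c * ‖m a‖ * ((1 + ‖q.1‖) ^ 1 * (1 + ‖q.2‖) ^ 1) := by
        have : 0 ≤ c * ‖m a‖ * (1 + ‖q.1‖) := by positivity
        nlinarith
    _ ≤ _ := mul_le_mul_of_nonneg_left e2 (by positivity)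

/-- First derivative of the mean log-partition function along the bridge, on any event or bounded
weight `g` of the endpoint. -/
theorem hasDerivAt_integral_bridgeLog (hw : ∀ a, 0 < w a) (hw1 : ∑ a, w a = 1) (m : ι → E d)
    (hQ : Integrable (fun y => ‖y‖ ^ 2) Q) (hg : Measurable g) (hg1 : ∀ y, |g y| ≤ 1) {r : ℝ}
    (h0 : 0 < r) (h1 : r < 1) :
    HasDerivAt (fun r => ∫ q, g q.1 * bridgeLog w m r q.1 q.2 ∂(Q.prod (stdGaussian (E d))))
      (∫ q, g q.1 * bridgeDeriv r q.1 m (bridgePost w m r q.1 q.2) ∂(Q.prod (stdGaussian (E d))))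
      r := by
  obtain ⟨s, hs, hsub, c, hc, hsp⟩ := exists_expoSpeed_bound m h0 h1
  obtain ⟨c', hc'⟩ := exists_abs_bridgeLog_le hw hw1 m
  have hmB := norm_le_one_add_sum m
  have hB1 := one_le_one_add_sum m
  have hp := continuous_bridgePost hw m r
  have hM := continuous_wmean (m := m) hp
  have hV := continuous_wvar (m := m) hp
  have hgm : Measurable fun q : E d × E d => g q.1 := hg.comp measurable_fst
  have key := hasDerivAt_integral_of_dominated_loc_of_deriv_le (μ := Q.prod (stdGaussian (E d)))
    (F := fun r q => g q.1 * bridgeLog w m r q.1 q.2)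
    (F' := fun r q => g q.1 * ∑ a, bridgePost w m r q.1 q.2 a * expoSpeed m r q.1 q.2 a)
    (bound := fun q => c * envelope q) hs
    (.of_forall fun x => (hgm.mul (continuous_bridgeLog hw m x).measurable).aestronglyMeasurable)
    (integrable_mul_of_abs_le hQ hg hg1 (continuous_bridgeLog hw m r) (hc' r ⟨h0.le, h1.le⟩))
    (hgm.mul (Continuous.measurable (continuous_finsetSum _ fun a _ =>
      (hp a).mul (continuous_expoSpeed m r a)))).aestronglyMeasurable
    (.of_forall fun q x hx => ?_) ((integrable_envelope hQ).const_mul c)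
    (.of_forall fun q x hx => ?_)
  · refine key.2.congr_deriv ?_
    simp_rw [sum_mul_expoSpeed (sum_bridgePost hw m r _ _) m, mul_add]
    have hi1 : Integrable (fun q : E d × E d => g q.1 * (inner ℝ q.1
        (wmean (bridgePost w m r q.1 q.2) m) - (wvar (bridgePost w m r q.1 q.2) m +
        ‖wmean (bridgePost w m r q.1 q.2) m‖ ^ 2) / 2)) (Q.prod (stdGaussian (E d))) := by
      refine integrable_mul_of_abs_le hQ hg hg1 (by fun_prop)
        (c := 16 * (1 + ∑ b, ‖m b‖) ^ 2) fun q => ?_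
      set p := bridgePost w m r q.1 q.2
      have hp0 : ∀ a, 0 ≤ p a := bridgePost_nonneg hw m r _ _
      have hp1 : ∑ a, p a = 1 := sum_bridgePost hw m r _ _
      have b1 := abs_bridgeDeriv_le hp0 hp1 hmB hB1 h0.le h1.le q.1
      have b2 := wvar_le hp0 hp1 hmB
      have b3 := wvar_nonneg (m := m) hp0
      have e : inner ℝ q.1 (wmean p m) - (wvar p m + ‖wmean p m‖ ^ 2) / 2 =
          bridgeDeriv r q.1 m p + (r - 1 / 2) * wvar p m := by unfold bridgeDeriv; ring
      rw [e]
      have b4 : |(r - 1 / 2) * wvar p m| ≤ 4 * (1 + ∑ b, ‖m b‖) ^ 2 := by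
        rw [abs_mul, abs_of_nonneg b3]
        have : |r - 1 / 2| ≤ 1 := by rw [abs_le]; constructor <;> linarith
        nlinarith
      have b5 := one_add_norm_le_envelope q
      have b6 := one_le_envelope q
      refine (abs_add_le _ _).trans ?_
      nlinarith [sq_nonneg (1 + ∑ b, ‖m b‖)]
    have hi2 := integrable_mul_sum_mul_inner hQ hg hg1 m (c := 1) hp (fun a q => by
      rw [abs_of_nonneg (bridgePost_nonneg hw m r q.1 q.2 a)]
      have := softmax_le_one hw (expo m r (bridgePoint r q.1 q.2)) a
      change softmax w (expo m r (bridgePoint r q.1 q.2)) a ≤ _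
      linarith [norm_nonneg q.1])
    have comm : ∀ X Y : ℝ, ∀ q : E d × E d, g q.1 * (X * Y) = X * (g q.1 * Y) :=
      fun X Y q => by ring
    rw [integral_add hi1 (by simp_rw [comm]; exact hi2.const_mul _)]
    have e2 : ∫ q, g q.1 * ((1 - 2 * r) / (2 * Real.sqrt (r * (1 - r))) *
        ∑ a, bridgePost w m r q.1 q.2 a * inner ℝ q.2 (m a)) ∂(Q.prod (stdGaussian (E d))) =
        ∫ q, g q.1 * ((1 - 2 * r) / 2 * wvar (bridgePost w m r q.1 q.2) m)
          ∂(Q.prod (stdGaussian (E d))) := by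
      simp_rw [comm ((1 - 2 * r) / (2 * Real.sqrt (r * (1 - r))))]
      rw [integral_const_mul, integral_mul_sum_bridgePost hw m hQ hg hg1, ← integral_const_mul]
      simp_rw [← comm ((1 - 2 * r) / (2 * Real.sqrt (r * (1 - r)))),
        one_sub_two_mul_div_sqrt h0 h1]
    rw [e2, ← integral_add hi1]
    · refine integral_congr_ae (.of_forall fun q => ?_)
      simp only [bridgeDeriv]
      ring
    · refine integrable_mul_of_abs_le hQ hg hg1 (by fun_prop)
        (c := 4 * (1 + ∑ b, ‖m b‖) ^ 2) fun q => ?_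
      set p := bridgePost w m r q.1 q.2
      have hp0 : ∀ a, 0 ≤ p a := bridgePost_nonneg hw m r _ _
      have b2 := wvar_le hp0 (sum_bridgePost hw m r _ _) hmB
      have b3 := wvar_nonneg (m := m) hp0
      rw [abs_mul, abs_of_nonneg b3]
      have : |(1 - 2 * r) / 2| ≤ 1 := by rw [abs_le]; constructor <;> linarith
      have b6 := one_le_envelope q
      nlinarith [sq_nonneg (1 + ∑ b, ‖m b‖)]
  · rw [Real.norm_eq_abs, abs_mul]
    have b1 := abs_sum_mul_le (bridgePost_nonneg hw m x q.1 q.2) (sum_bridgePost hw m x q.1 q.2)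
      (hsp x hx q.1 q.2)
    have e2 := mul_le_envelope (i := 1) (j := 1) (by norm_num) (by norm_num) q
    simp only [pow_one] at e2
    calc _ ≤ 1 * (c * ((1 + ‖q.1‖) * (1 + ‖q.2‖))) :=
          mul_le_mul (hg1 _) b1 (abs_nonneg _) zero_le_one
      _ ≤ _ := by rw [one_mul]; exact mul_le_mul_of_nonneg_left e2 hc
  · exact (hasDerivAt_log_partition hw fun a =>
      hasDerivAt_expo m (hsub hx).1 (hsub hx).2 q.1 q.2 a).const_mul _

/-- Second derivative of the mean log-partition function along the bridge. -/
theorem hasDerivAt_integral_bridgeDeriv (hw : ∀ a, 0 < w a) (m : ι → E d)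
    (hQ : Integrable (fun y => ‖y‖ ^ 2) Q) (hg : Measurable g) (hg1 : ∀ y, |g y| ≤ 1) {r : ℝ}
    (h0 : 0 < r) (h1 : r < 1) :
    HasDerivAt (fun r => ∫ q, g q.1 * bridgeDeriv r q.1 m (bridgePost w m r q.1 q.2)
        ∂(Q.prod (stdGaussian (E d))))
      (∫ q, g q.1 * bridgeDeriv2 r q.1 m (bridgePost w m r q.1 q.2) ∂(Q.prod (stdGaussian (E d))))
      r := by
  obtain ⟨s, hs, hsub, c, hc, hsp⟩ := exists_expoSpeed_bound m h0 h1
  set B := 1 + ∑ b, ‖m b‖ with hB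
  have hmB := norm_le_one_add_sum m
  have hB1 := one_le_one_add_sum m
  rw [← hB] at hB1
  have hp := continuous_bridgePost hw m r
  have hM := continuous_wmean (m := m) hp
  have hV := continuous_wvar (m := m) hp
  have hcov := continuous_wcovSq (m := m) hp
  have hk := fun a => continuous_drive (m := m) hp r (continuous_fst) a
  have hgm : Measurable fun q : E d × E d => g q.1 := hg.comp measurable_fst
  have hpost : ∀ x : ℝ, ∀ q : E d × E d, ∀ a, |bridgePost w m x q.1 q.2 a| ≤ 1 := by
    intro x q a
    rw [abs_of_nonneg (bridgePost_nonneg hw m x _ _ a)]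
    exact softmax_le_one hw (expo m x (bridgePoint x _ _)) a
  have hkB : ∀ x ∈ Set.Icc (0 : ℝ) 1, ∀ (q : E d × E d) a,
      |drive x q.1 m (bridgePost w m x q.1 q.2) a| ≤ 8 * B ^ 2 * (1 + ‖q.1‖) :=
    fun x hx q a => abs_drive_le (bridgePost_nonneg hw m x _ _) (sum_bridgePost hw m x _ _) hmB hB1
      hx.1 hx.2 _ a
  have hr : r ∈ Set.Icc (0 : ℝ) 1 := ⟨h0.le, h1.le⟩
  have key := hasDerivAt_integral_of_dominated_loc_of_deriv_le (μ := Q.prod (stdGaussian (E d)))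
    (F := fun r q => g q.1 * bridgeDeriv r q.1 m (bridgePost w m r q.1 q.2))
    (F' := fun r q => g q.1 * (∑ a, bridgePost w m r q.1 q.2 a * expoSpeed m r q.1 q.2 a *
      drive r q.1 m (bridgePost w m r q.1 q.2) a - wvar (bridgePost w m r q.1 q.2) m))
    (bound := fun q => (c * (8 * B ^ 2) + 4 * B ^ 2) * envelope q) hs
    (.of_forall fun x => (hgm.mul (continuous_bridgeDeriv (continuous_bridgePost hw m x) x
      continuous_fst).measurable).aestronglyMeasurable)
    (integrable_mul_of_abs_le (c := 8 * B ^ 2) hQ hg hg1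
      (continuous_bridgeDeriv hp r continuous_fst) fun q =>
        (abs_bridgeDeriv_le (bridgePost_nonneg hw m r _ _) (sum_bridgePost hw m r _ _) hmB hB1
          h0.le h1.le q.1).trans (mul_le_mul_of_nonneg_left (one_add_norm_le_envelope q)
            (by positivity)))
    (hgm.mul (Continuous.measurable ((continuous_finsetSum _ fun a _ =>
      ((hp a).mul (continuous_expoSpeed m r a)).mul (hk a)).sub hV))).aestronglyMeasurable
    (.of_forall fun q x hx => ?_) ((integrable_envelope hQ).const_mul _)
    (.of_forall fun q x hx => ?_)
  · refine key.2.congr_deriv ?_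
    -- the integrands that do not contain the Gaussian variable linearly
    have hAc : Continuous fun q : E d × E d => ∑ a, bridgePost w m r q.1 q.2 a *
        drive r q.1 m (bridgePost w m r q.1 q.2) a *
        (inner ℝ (q.1 - wmean (bridgePost w m r q.1 q.2) m)
          (m a - wmean (bridgePost w m r q.1 q.2) m) -
          ‖m a - wmean (bridgePost w m r q.1 q.2) m‖ ^ 2 / 2) :=
      continuous_finsetSum _ fun a _ => ((hp a).mul (hk a)).mul (by fun_prop)
    have hi1 : Integrable (fun q : E d × E d => g q.1 * (∑ a, bridgePost w m r q.1 q.2 a *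
        drive r q.1 m (bridgePost w m r q.1 q.2) a *
        (inner ℝ (q.1 - wmean (bridgePost w m r q.1 q.2) m)
          (m a - wmean (bridgePost w m r q.1 q.2) m) -
          ‖m a - wmean (bridgePost w m r q.1 q.2) m‖ ^ 2 / 2) -
          wvar (bridgePost w m r q.1 q.2) m)) (Q.prod (stdGaussian (E d))) := by
      refine integrable_mul_of_abs_le hQ hg hg1 (hAc.sub hV)
        (c := 8 * B ^ 2 * (4 * B ^ 2) + 4 * B ^ 2) fun q => ?_
      set p := bridgePost w m r q.1 q.2 with hpdef
      have hp0 : ∀ a, 0 ≤ p a := bridgePost_nonneg hw m r _ _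
      have hp1 : ∑ a, p a = 1 := sum_bridgePost hw m r _ _
      have b2 := wvar_le hp0 hp1 hmB
      have b3 := wvar_nonneg (m := m) hp0
      have b4 : ∀ a, |inner ℝ (q.1 - wmean p m) (m a - wmean p m) -
          ‖m a - wmean p m‖ ^ 2 / 2| ≤ 4 * B ^ 2 * (1 + ‖q.1‖) := by
        intro a
        have c1 : |inner ℝ (q.1 - wmean p m) (m a - wmean p m)| ≤ (‖q.1‖ + B) * (2 * B) :=
          (abs_real_inner_le_norm _ _).trans (mul_le_mul ((norm_sub_le _ _).trans
            (by linarith [norm_wmean_le hp0 hp1 hmB])) (norm_sub_wmean_le hp0 hp1 hmB a)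
            (norm_nonneg _) (by positivity))
        have c2 := norm_sq_sub_wmean_le hp0 hp1 hmB a
        refine (abs_sub _ _).trans ?_
        rw [abs_of_nonneg (by positivity : 0 ≤ ‖m a - wmean p m‖ ^ 2 / 2)]
        have hB2 : B * ‖q.1‖ ≤ B ^ 2 * ‖q.1‖ :=
          mul_le_mul_of_nonneg_right (by nlinarith) (norm_nonneg _)
        have : 0 ≤ B ^ 2 * ‖q.1‖ := by positivity
        nlinarith
      have b5 := abs_sum_mul_le hp0 hp1 (f := fun a => drive r q.1 m p a *
        (inner ℝ (q.1 - wmean p m) (m a - wmean p m) - ‖m a - wmean p m‖ ^ 2 / 2))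
        (c := 8 * B ^ 2 * (1 + ‖q.1‖) * (4 * B ^ 2 * (1 + ‖q.1‖))) (fun a => by
          rw [abs_mul]
          exact mul_le_mul (hkB r hr q a) (b4 a) (abs_nonneg _) (by positivity))
      simp_rw [← mul_assoc (p _)] at b5
      refine (abs_sub _ _).trans ?_
      rw [abs_of_nonneg b3]
      have e2 := mul_le_envelope (i := 2) (j := 0) (by norm_num) (by norm_num) q
      have e3 := one_le_envelope q
      have e4 := mul_le_mul_of_nonneg_left e2 (by positivity : 0 ≤ 8 * B ^ 2 * (4 * B ^ 2))
      have e5 := mul_le_mul_of_nonneg_left e3 (by positivity : 0 ≤ 4 * B ^ 2)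
      linarith
    have hi2 := integrable_mul_sum_mul_inner hQ hg hg1 m (c := 8 * B ^ 2)
      (f := fun a q => bridgePost w m r q.1 q.2 a *
        drive r q.1 m (bridgePost w m r q.1 q.2) a) (fun a => (hp a).mul (hk a)) (fun a q => by
        rw [abs_mul]
        calc _ ≤ 1 * (8 * B ^ 2 * (1 + ‖q.1‖)) :=
              mul_le_mul (hpost r q a) (hkB r hr q a) (abs_nonneg _) zero_le_one
          _ = _ := one_mul _)
    have comm : ∀ X Y : ℝ, ∀ q : E d × E d, g q.1 * (X * Y) = X * (g q.1 * Y) :=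
      fun X Y q => by ring
    have e0 : ∀ q : E d × E d, g q.1 * (∑ a, bridgePost w m r q.1 q.2 a *
        expoSpeed m r q.1 q.2 a * drive r q.1 m (bridgePost w m r q.1 q.2) a -
        wvar (bridgePost w m r q.1 q.2) m) =
        g q.1 * (∑ a, bridgePost w m r q.1 q.2 a *
        drive r q.1 m (bridgePost w m r q.1 q.2) a *
        (inner ℝ (q.1 - wmean (bridgePost w m r q.1 q.2) m)
          (m a - wmean (bridgePost w m r q.1 q.2) m) -
          ‖m a - wmean (bridgePost w m r q.1 q.2) m‖ ^ 2 / 2) -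
          wvar (bridgePost w m r q.1 q.2) m) +
        (1 - 2 * r) / (2 * Real.sqrt (r * (1 - r))) * (g q.1 *
          ∑ a, bridgePost w m r q.1 q.2 a * drive r q.1 m (bridgePost w m r q.1 q.2) a *
            inner ℝ q.2 (m a)) := by
      intro q
      rw [sum_mul_expoSpeed_mul_drive (sum_bridgePost hw m r _ _) m]
      ring
    simp_rw [e0]
    rw [integral_add hi1 (hi2.const_mul _), integral_const_mul,
      integral_mul_sum_bridgePost_drive hw m hQ hg hg1 h0.le h1.le, ← integral_const_mul]
    simp_rw [← comm ((1 - 2 * r) / (2 * Real.sqrt (r * (1 - r)))),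
        one_sub_two_mul_div_sqrt h0 h1]
    rw [← integral_add hi1]
    · refine integral_congr_ae (.of_forall fun q => ?_)
      simp only []
      rw [← sum_mul_drive_sq (sum_bridgePost hw m r q.1 q.2)]
      ring
    · refine integrable_mul_of_abs_le hQ hg hg1 (continuous_const.mul
        ((continuous_finsetSum _ fun a _ => ((hp a).mul (by fun_prop)).mul (hk a)).sub
          (by fun_prop))) (c := 4 * B ^ 2 * (8 * B ^ 2) + 16 * B ^ 4) fun q => ?_
      set p := bridgePost w m r q.1 q.2 with hpdef
      have hp0 : ∀ a, 0 ≤ p a := bridgePost_nonneg hw m r _ _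
      have hp1 : ∑ a, p a = 1 := sum_bridgePost hw m r _ _
      have b5 := abs_sum_mul_le hp0 hp1 (f := fun a => ‖m a - wmean p m‖ ^ 2 * drive r q.1 m p a)
        (c := 4 * B ^ 2 * (8 * B ^ 2 * (1 + ‖q.1‖))) (fun a => by
          rw [abs_mul, abs_of_nonneg (sq_nonneg ‖m a - wmean p m‖)]
          exact mul_le_mul (norm_sq_sub_wmean_le hp0 hp1 hmB a) (hkB r hr q a) (abs_nonneg _)
            (by positivity))
      simp_rw [← mul_assoc (p _)] at b5
      have b6 : |wcovSq p m| ≤ 16 * B ^ 4 := by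
        have e : wcovSq p m = ∑ a, p a * ∑ b, p b *
            inner ℝ (m a - wmean p m) (m b - wmean p m) ^ 2 := by
          unfold wcovSq
          simp_rw [Finset.mul_sum]
          exact Finset.sum_congr rfl fun a _ => Finset.sum_congr rfl fun b _ => by ring
        rw [e]
        refine abs_sum_mul_le hp0 hp1 fun a => abs_sum_mul_le hp0 hp1 fun b => ?_
        rw [abs_pow]
        have c1 : |inner ℝ (m a - wmean p m) (m b - wmean p m)| ≤ 4 * B ^ 2 := by
          refine (abs_real_inner_le_norm _ _).trans ?_
          calc _ ≤ (2 * B) * (2 * B) := mul_le_mul (norm_sub_wmean_le hp0 hp1 hmB a)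
                (norm_sub_wmean_le hp0 hp1 hmB b) (norm_nonneg _) (by linarith)
            _ = _ := by ring
        calc _ ≤ (4 * B ^ 2) ^ 2 := pow_le_pow_left₀ (abs_nonneg _) c1 2
          _ = _ := by ring
      have b7 : |1 - 2 * r| ≤ 1 := by rw [abs_le]; constructor <;> linarith
      have b8 : |(1 - 2 * r) / 2| ≤ 1 := by rw [abs_le]; constructor <;> linarith
      rw [abs_mul]
      have b9 : |(1 - 2 * r) * wcovSq p m| ≤ 16 * B ^ 4 := by
        rw [abs_mul]
        calc _ ≤ 1 * (16 * B ^ 4) := mul_le_mul b7 b6 (abs_nonneg _) zero_le_one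
          _ = _ := one_mul _
      have b10 := (abs_sub (∑ a, p a * ‖m a - wmean p m‖ ^ 2 * drive r q.1 m p a)
        ((1 - 2 * r) * wcovSq p m)).trans (add_le_add b5 b9)
      have e3 := one_le_envelope q
      have e4 := one_add_norm_le_envelope q
      calc _ ≤ 1 * (4 * B ^ 2 * (8 * B ^ 2 * (1 + ‖q.1‖)) + 16 * B ^ 4) :=
            mul_le_mul b8 b10 (abs_nonneg _) zero_le_one
        _ = 4 * B ^ 2 * (8 * B ^ 2) * (1 + ‖q.1‖) + 16 * B ^ 4 * 1 := by ring
        _ ≤ 4 * B ^ 2 * (8 * B ^ 2) * envelope q + 16 * B ^ 4 * envelope q := by gcongr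
        _ = _ := by ring
  · have hx' := hsub hx
    set p := bridgePost w m x q.1 q.2 with hpdef
    have hp0 : ∀ a, 0 ≤ p a := bridgePost_nonneg hw m x _ _
    have hp1 : ∑ a, p a = 1 := sum_bridgePost hw m x _ _
    have b5 := abs_sum_mul_le hp0 hp1 (f := fun a => expoSpeed m x q.1 q.2 a * drive x q.1 m p a)
      (c := c * ((1 + ‖q.1‖) * (1 + ‖q.2‖)) * (8 * B ^ 2 * (1 + ‖q.1‖))) (fun a => by
        rw [abs_mul]
        exact mul_le_mul (hsp x hx q.1 q.2 a) (hkB x ⟨hx'.1.le, hx'.2.le⟩ q a) (abs_nonneg _)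
          (by positivity))
    simp_rw [← mul_assoc (p _)] at b5
    have b2 := wvar_le hp0 hp1 hmB
    have b3 := wvar_nonneg (m := m) hp0
    have e2 := mul_le_envelope (i := 2) (j := 1) (by norm_num) (by norm_num) q
    have e3 := one_le_envelope q
    rw [Real.norm_eq_abs, abs_mul]
    have b6 := (abs_sub (∑ a, p a * expoSpeed m x q.1 q.2 a * drive x q.1 m p a)
      (wvar p m))
    rw [abs_of_nonneg b3] at b6
    calc _ ≤ 1 * (c * ((1 + ‖q.1‖) * (1 + ‖q.2‖)) * (8 * B ^ 2 * (1 + ‖q.1‖)) + 4 * B ^ 2) :=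
          mul_le_mul (hg1 _) (b6.trans (add_le_add b5 b2)) (abs_nonneg _) zero_le_one
      _ = c * (8 * B ^ 2) * ((1 + ‖q.1‖) ^ 2 * (1 + ‖q.2‖) ^ 1) + 4 * B ^ 2 * 1 := by ring
      _ ≤ c * (8 * B ^ 2) * envelope q + 4 * B ^ 2 * envelope q := by gcongr
      _ = _ := by ring
  · refine (hasDerivAt_bridgeDeriv m q.1 (fun t => sum_bridgePost hw m t q.1 q.2) (fun a =>
      hasDerivAt_softmax hw (fun b => hasDerivAt_expo m (hsub hx).1 (hsub hx).2 q.1 q.2 b)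
        a)).const_mul _

theorem continuousOn_integral_bridgeLog (hw : ∀ a, 0 < w a) (hw1 : ∑ a, w a = 1) (m : ι → E d)
    (hQ : Integrable (fun y => ‖y‖ ^ 2) Q) (hg : Measurable g) (hg1 : ∀ y, |g y| ≤ 1) :
    ContinuousOn (fun r => ∫ q, g q.1 * bridgeLog w m r q.1 q.2 ∂(Q.prod (stdGaussian (E d))))
      (Set.Icc 0 1) := by
  obtain ⟨c', hc'⟩ := exists_abs_bridgeLog_le hw hw1 m
  have hgm : Measurable fun q : E d × E d => g q.1 := hg.comp measurable_fst
  refine continuousOn_of_dominated (bound := fun q => c' * envelope q)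
    (fun x _ => (hgm.mul (continuous_bridgeLog hw m x).measurable).aestronglyMeasurable)
    (fun x hx => .of_forall fun q => ?_) ((integrable_envelope hQ).const_mul _)
    (.of_forall fun q => Continuous.continuousOn ?_)
  · rw [Real.norm_eq_abs, abs_mul]
    calc _ ≤ 1 * |bridgeLog w m x q.1 q.2| := mul_le_mul_of_nonneg_right (hg1 _) (abs_nonneg _)
      _ ≤ _ := by rw [one_mul]; exact hc' x hx q
  · refine continuous_const.mul ?_
    refine (continuous_partition fun a => ?_).log fun q => (partition_pos hw _).ne'
    unfold expo bridgePoint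
    fun_prop

/-- Second-order Taylor expansion along the bridge of the mean log-partition function. -/
theorem abs_taylor_bridgeLog_le (hw : ∀ a, 0 < w a) (hw1 : ∑ a, w a = 1) (m : ι → E d)
    (hQ : Integrable (fun y => ‖y‖ ^ 2) Q) (hg : Measurable g) (hg1 : ∀ y, |g y| ≤ 1) {α : ℝ}
    (h0 : 0 < α) (h1 : α < 1) {D : ℝ} (hD : ∀ r ∈ Set.Ico α 1,
      |∫ q, g q.1 * bridgeDeriv2 r q.1 m (bridgePost w m r q.1 q.2)
        ∂(Q.prod (stdGaussian (E d)))| ≤ D) :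
    |∫ q, g q.1 * bridgeLog w m 1 q.1 q.2 ∂(Q.prod (stdGaussian (E d))) -
      ∫ q, g q.1 * bridgeLog w m α q.1 q.2 ∂(Q.prod (stdGaussian (E d))) -
      (1 - α) * ∫ q, g q.1 * bridgeDeriv α q.1 m (bridgePost w m α q.1 q.2)
        ∂(Q.prod (stdGaussian (E d)))| ≤ D * (1 - α) ^ 2 := by
  set F := fun r => ∫ q, g q.1 * bridgeLog w m r q.1 q.2 ∂(Q.prod (stdGaussian (E d))) with hF
  set G := fun r => ∫ q, g q.1 * bridgeDeriv r q.1 m (bridgePost w m r q.1 q.2)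
        ∂(Q.prod (stdGaussian (E d))) with hG
  have hD0 : 0 ≤ D := (abs_nonneg _).trans (hD α ⟨le_rfl, h1⟩)
  -- the derivative of `G` is bounded by `D`, and then so is the increment of `F - r G(α)` by `D (1 - α)²`
  have hG1 : ∀ r ∈ Set.Ico α 1, |G r - G α| ≤ D * (1 - α) := by
    intro r hr
    have hsub : ∀ x ∈ Set.Icc α r, x ∈ Set.Ico α 1 := fun x hx => ⟨hx.1, hx.2.trans_lt hr.2⟩
    have hd : ∀ x ∈ Set.Icc α r, HasDerivAt G _ x := fun x hx =>
      hasDerivAt_integral_bridgeDeriv hw m hQ hg hg1 (h0.trans_le hx.1) (hsub x hx).2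
    have := norm_image_sub_le_of_norm_deriv_right_le_segment (C := D)
      (fun x hx => (hd x hx).continuousAt.continuousWithinAt)
      (fun x hx => (hd x ⟨hx.1, hx.2.le⟩).hasDerivWithinAt)
      (fun x hx => hD x (hsub x ⟨hx.1, hx.2.le⟩)) r ⟨hr.1, le_rfl⟩
    refine this.trans (mul_le_mul_of_nonneg_left (by linarith [hr.2]) hD0)
  have hd : ∀ x ∈ Set.Ico α 1, HasDerivAt (fun r => F r - r * G α) (G x - 1 * G α) x :=
    fun x hx => (hasDerivAt_integral_bridgeLog hw hw1 m hQ hg hg1 (h0.trans_le hx.1) hx.2).sub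
      ((hasDerivAt_id x).mul_const _)
  have := norm_image_sub_le_of_norm_deriv_right_le_segment (C := D * (1 - α))
      (f := fun r => F r - r * G α)
      (((continuousOn_integral_bridgeLog hw hw1 m hQ hg hg1).mono
        (Set.Icc_subset_Icc h0.le le_rfl)).sub (by fun_prop))
      (fun x hx => (hd x hx).hasDerivWithinAt)
      (fun x hx => by rw [one_mul]; exact hG1 x hx) 1 ⟨h1.le, le_rfl⟩
  rw [Real.norm_eq_abs] at this
  refine le_of_eq_of_le ?_ (this.trans (by rw [sq, mul_assoc]))
  congr 1
  ring

end Bridge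

/-! ### Dimension-free moment bounds -/

section Moments

variable {ι : Type*} [Fintype ι] {d : ℕ}

/-- The fourth central moment of the points `m` under the weights `p`. -/
def wfourth (p : ι → ℝ) (m : ι → E d) : ℝ := ∑ a, p a * ‖m a - wmean p m‖ ^ 4

theorem sq_sum_mul_le {p : ι → ℝ} (h0 : ∀ a, 0 ≤ p a) (hp : ∑ a, p a = 1) (f : ι → ℝ) :
    (∑ a, p a * f a) ^ 2 ≤ ∑ a, p a * f a ^ 2 := by
  have h := Finset.sum_nonneg (s := Finset.univ) fun a _ =>
    mul_nonneg (h0 a) (sq_nonneg (f a - ∑ b, p b * f b))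
  have e : ∀ a, p a * (f a - ∑ b, p b * f b) ^ 2 = p a * f a ^ 2 -
      2 * (∑ b, p b * f b) * (p a * f a) + p a * (∑ b, p b * f b) ^ 2 := fun a => by ring
  simp_rw [e, Finset.sum_add_distrib, Finset.sum_sub_distrib, ← Finset.mul_sum,
    ← Finset.sum_mul] at h
  rw [hp] at h
  nlinarith

theorem sum_mul_sub_sq_le {p : ι → ℝ} (hp : ∑ a, p a = 1) (f : ι → ℝ) :
    ∑ a, p a * (f a - ∑ b, p b * f b) ^ 2 ≤ ∑ a, p a * f a ^ 2 := by
  have e : ∀ a, p a * (f a - ∑ b, p b * f b) ^ 2 = p a * f a ^ 2 -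
      2 * (∑ b, p b * f b) * (p a * f a) + p a * (∑ b, p b * f b) ^ 2 := fun a => by ring
  simp_rw [e, Finset.sum_add_distrib, Finset.sum_sub_distrib, ← Finset.mul_sum,
    ← Finset.sum_mul]
  rw [hp]
  nlinarith [sq_nonneg (∑ b, p b * f b)]

variable {p : ι → ℝ} {m : ι → E d}

theorem wvar_sq_le (h0 : ∀ a, 0 ≤ p a) (hp : ∑ a, p a = 1) : wvar p m ^ 2 ≤ wfourth p m := by
  refine (sq_sum_mul_le h0 hp _).trans (le_of_eq ?_)
  exact Finset.sum_congr rfl fun a _ => by ring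

theorem wfourth_nonneg (h0 : ∀ a, 0 ≤ p a) : 0 ≤ wfourth p m :=
  Finset.sum_nonneg fun a _ => mul_nonneg (h0 a) (by positivity)

theorem wvar_le_one_add (h0 : ∀ a, 0 ≤ p a) (hp : ∑ a, p a = 1) :
    wvar p m ≤ 1 + wfourth p m := by
  have := wvar_sq_le (m := m) h0 hp
  nlinarith [sq_nonneg (wvar p m - 1), wvar_nonneg (m := m) h0]

theorem wcovSq_nonneg (h0 : ∀ a, 0 ≤ p a) : 0 ≤ wcovSq p m :=
  Finset.sum_nonneg fun a _ => Finset.sum_nonneg fun b _ =>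
    mul_nonneg (mul_nonneg (h0 a) (h0 b)) (sq_nonneg _)

theorem wcovSq_le (h0 : ∀ a, 0 ≤ p a) (hp : ∑ a, p a = 1) : wcovSq p m ≤ wfourth p m := by
  refine le_trans ?_ (wvar_sq_le h0 hp)
  unfold wcovSq wvar
  rw [sq, Finset.sum_mul_sum]
  refine Finset.sum_le_sum fun a _ => Finset.sum_le_sum fun b _ => ?_
  have h := abs_real_inner_le_norm (m a - wmean p m) (m b - wmean p m)
  have h2 := pow_le_pow_left₀ (abs_nonneg _) h 2
  rw [sq_abs, mul_pow] at h2
  calc _ ≤ p a * p b * (‖m a - wmean p m‖ ^ 2 * ‖m b - wmean p m‖ ^ 2) :=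
        mul_le_mul_of_nonneg_left h2 (mul_nonneg (h0 a) (h0 b))
    _ = _ := by ring

/-- The second derivative is controlled by two statistics of the posterior, whose means are
dimension free. -/
theorem abs_bridgeDeriv2_le (h0 : ∀ a, 0 ≤ p a) (hp : ∑ a, p a = 1) {r : ℝ} (hr0 : 0 ≤ r)
    (hr1 : r ≤ 1) (y : E d) :
    |bridgeDeriv2 r y m p| ≤ 1 +
      2 * ∑ a, p a * inner ℝ (y - wmean p m) (m a - wmean p m) ^ 2 + 10 * wfourth p m := by
  have hV := wvar_le_one_add (m := m) h0 hp
  have hV0 := wvar_nonneg (m := m) h0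
  have hC := wcovSq_le (m := m) h0 hp
  have hC0 := wcovSq_nonneg (m := m) h0
  have h4 := wfourth_nonneg (m := m) h0
  have hk : ∑ a, p a * drive r y m p a ^ 2 ≤
      2 * ∑ a, p a * inner ℝ (y - wmean p m) (m a - wmean p m) ^ 2 + 2 * wfourth p m := by
    have hvar := sum_mul_sub_sq_le hp fun a => ‖m a - wmean p m‖ ^ 2
    have e1 : ∑ a, p a * (‖m a - wmean p m‖ ^ 2) ^ 2 = wfourth p m :=
      Finset.sum_congr rfl fun a _ => by ring
    rw [e1] at hvar
    change ∑ a, p a * (‖m a - wmean p m‖ ^ 2 - wvar p m) ^ 2 ≤ _ at hvar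
    calc _ ≤ ∑ a, (2 * (p a * inner ℝ (y - wmean p m) (m a - wmean p m) ^ 2) +
          2 * (p a * (‖m a - wmean p m‖ ^ 2 - wvar p m) ^ 2)) := by
          refine Finset.sum_le_sum fun a _ => ?_
          have : drive r y m p a ^ 2 ≤ 2 * inner ℝ (y - wmean p m) (m a - wmean p m) ^ 2 +
              2 * (‖m a - wmean p m‖ ^ 2 - wvar p m) ^ 2 := by
            unfold drive
            have hr2 : r ^ 2 ≤ 1 := pow_le_one₀ hr0 hr1
            nlinarith [sq_nonneg (inner ℝ (y - wmean p m) (m a - wmean p m) +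
              r * (‖m a - wmean p m‖ ^ 2 - wvar p m)),
              sq_nonneg (‖m a - wmean p m‖ ^ 2 - wvar p m)]
          nlinarith [h0 a]
      _ ≤ _ := by
          rw [Finset.sum_add_distrib, ← Finset.mul_sum, ← Finset.mul_sum]
          linarith
  have hk0 : 0 ≤ ∑ a, p a * drive r y m p a ^ 2 :=
    Finset.sum_nonneg fun a _ => mul_nonneg (h0 a) (sq_nonneg _)
  have hA0 : 0 ≤ ∑ a, p a * inner ℝ (y - wmean p m) (m a - wmean p m) ^ 2 :=
    Finset.sum_nonneg fun a _ => mul_nonneg (h0 a) (sq_nonneg _)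
  have hrc : (1 - 2 * r) ^ 2 / 2 ≤ 1 := by nlinarith
  have hrc0 : 0 ≤ (1 - 2 * r) ^ 2 / 2 := by positivity
  have hx : (1 - 2 * r) ^ 2 / 2 * wcovSq p m ≤ wfourth p m := by nlinarith
  have hx0 : 0 ≤ (1 - 2 * r) ^ 2 / 2 * wcovSq p m := by positivity
  unfold bridgeDeriv2
  rw [abs_le]
  constructor <;> linarith

/-- The entropy-type bound `∑ p log² p ≤ 2 log² N + 8` for `N` weights. -/
theorem sum_mul_log_sq_le [Nonempty ι] (h0 : ∀ a, 0 < p a) (hp : ∑ a, p a = 1) :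
    ∑ a, p a * Real.log (p a) ^ 2 ≤ 2 * Real.log (Fintype.card ι) ^ 2 + 8 := by
  set N : ℝ := (Fintype.card ι : ℝ) with hN
  have hNpos : 0 < N := by
    rw [hN]; exact_mod_cast Fintype.card_pos
  have hlogN : 0 ≤ Real.log N := Real.log_nonneg (by
    rw [hN]; exact_mod_cast Nat.one_le_iff_ne_zero.2 Fintype.card_ne_zero)
  have key : ∀ a, p a * Real.log (p a) ^ 2 ≤ 2 * Real.log N ^ 2 * p a + 8 / N := by
    intro a
    have hpa1 : p a ≤ 1 := by
      rw [← hp]; exact Finset.single_le_sum (fun b _ => (h0 b).le) (Finset.mem_univ a)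
    have hlp : Real.log (p a) ≤ 0 := Real.log_nonpos (h0 a).le hpa1
    have h8 : 0 ≤ 8 / N := by positivity
    set t := p a * N with ht
    have htpos : 0 < t := mul_pos (h0 a) hNpos
    have hl : Real.log t = Real.log (p a) + Real.log N :=
      Real.log_mul (h0 a).ne' hNpos.ne'
    -- weights above `1 / N` have `log² p ≤ log² N`; the others have a bounded contribution
    rcases le_total 1 t with h1 | h1
    · have := Real.log_nonneg h1
      have h2 : Real.log (p a) ^ 2 ≤ Real.log N ^ 2 := by nlinarith
      have := mul_le_mul_of_nonneg_left h2 (h0 a).le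
      nlinarith [mul_nonneg (h0 a).le (sq_nonneg (Real.log N))]
    · have hl0 : Real.log t ≤ 0 := Real.log_nonpos htpos.le h1
      -- `t log² t ≤ 4` follows from `log (1 / √t) ≤ 1 / √t`
      have h3 : -Real.log t ≤ 2 * (Real.sqrt t)⁻¹ := by
        have h5 := Real.log_le_sub_one_of_pos (inv_pos.2 (Real.sqrt_pos.2 htpos))
        rw [Real.log_inv, Real.log_sqrt htpos.le] at h5
        linarith
      have h4 : t * Real.log t ^ 2 ≤ 4 := by
        have h6 := pow_le_pow_left₀ (by linarith) h3 2
        have h7 : (2 * (Real.sqrt t)⁻¹) ^ 2 = 4 / t := by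
          rw [mul_pow, inv_pow, Real.sq_sqrt htpos.le]; field_simp; norm_num
        rw [h7, le_div_iff₀ htpos] at h6
        nlinarith
      have h5 : p a * Real.log t ^ 2 ≤ 4 / N := by
        rw [le_div_iff₀ hNpos]
        calc _ = t * Real.log t ^ 2 := by rw [ht]; ring
          _ ≤ 4 := h4
      have h6 : Real.log (p a) ^ 2 ≤ 2 * Real.log t ^ 2 + 2 * Real.log N ^ 2 := by
        have : Real.log (p a) = Real.log t - Real.log N := by linarith
        rw [this]
        nlinarith [sq_nonneg (Real.log t + Real.log N)]
      have h7 := mul_le_mul_of_nonneg_left h6 (h0 a).le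
      have h8 : 8 / N = 2 * (4 / N) := by ring
      rw [h8]
      linarith
  calc _ ≤ ∑ a, (2 * Real.log N ^ 2 * p a + 8 / N) := Finset.sum_le_sum fun a _ => key a
    _ = _ := by
      rw [Finset.sum_add_distrib, ← Finset.mul_sum, hp, Finset.sum_const, Finset.card_univ,
        nsmul_eq_mul, ← hN]
      field_simp

theorem wfourth_le_pairs (h0 : ∀ a, 0 ≤ p a) (hp : ∑ a, p a = 1) :
    wfourth p m ≤ ∑ a, ∑ b, p a * p b * ‖m a - m b‖ ^ 4 := by
  unfold wfourth
  refine Finset.sum_le_sum fun a _ => ?_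
  have e : m a - wmean p m = ∑ b, p b • (m a - m b) := by
    simp_rw [smul_sub]
    rw [Finset.sum_sub_distrib, ← Finset.sum_smul, hp, one_smul]; rfl
  have h1 : ‖m a - wmean p m‖ ≤ ∑ b, p b * ‖m a - m b‖ := by
    rw [e]
    refine (norm_sum_le _ _).trans (le_of_eq ?_)
    exact Finset.sum_congr rfl fun b _ => by rw [norm_smul, Real.norm_of_nonneg (h0 b)]
  have h2 := (pow_le_pow_left₀ (norm_nonneg _) h1 2).trans (sq_sum_mul_le h0 hp _)
  have h3 := (pow_le_pow_left₀ (sq_nonneg _) h2 2).trans (sq_sum_mul_le h0 hp _)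
  simp_rw [← pow_mul] at h3
  have h4 := mul_le_mul_of_nonneg_left h3 (h0 a)
  rw [Finset.mul_sum] at h4
  refine h4.trans (le_of_eq (Finset.sum_congr rfl fun b _ => by ring))

end Moments

section Mixture

variable {ι : Type*} [Fintype ι] [Nonempty ι] {d : ℕ} {w : ι → ℝ} {m : ι → E d}

theorem partition_mul_softmax (hw : ∀ a, 0 < w a) (θ : ι → ℝ) (a : ι) :
    partition w θ * softmax w θ a = w a * Real.exp (θ a) := by
  unfold softmax
  rw [mul_div_cancel₀ _ (partition_pos hw θ).ne']

/-- The centred linear statistic `⟨u - r M, v_a⟩` is a centred log-posterior. This is what makes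
its second moment dimension free. -/
theorem sum_mul_inner_sq_le (hw : ∀ a, 0 < w a) (m : ι → E d) {r : ℝ} (hr0 : 0 ≤ r) (hr1 : r ≤ 1)
    (u : E d) :
    ∑ a, softmax w (expo m r u) a * inner ℝ (u - r • wmean (softmax w (expo m r u)) m)
        (m a - wmean (softmax w (expo m r u)) m) ^ 2 ≤
      4 * ∑ a, softmax w (expo m r u) a * Real.log (softmax w (expo m r u) a) ^ 2 +
      4 * ∑ a, softmax w (expo m r u) a * Real.log (w a) ^ 2 +
      wfourth (softmax w (expo m r u)) m := by
  set p := softmax w (expo m r u) with hpdef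
  have hp0 : ∀ a, 0 < p a := softmax_pos hw _
  have hp1 : ∑ a, p a = 1 := sum_softmax hw _
  set M := wmean p m
  -- solving the formula for the posterior for its linear part
  set f : ι → ℝ := fun a => Real.log (p a) - Real.log (w a) + r / 2 * ‖m a - M‖ ^ 2 with hf
  have hlog : ∀ a, Real.log (p a) = Real.log (w a) + expo m r u a -
      Real.log (partition w (expo m r u)) := by
    intro a
    rw [hpdef, softmax, Real.log_div (mul_pos (hw a) (Real.exp_pos _)).ne'
      (partition_pos hw _).ne', Real.log_mul (hw a).ne' (Real.exp_pos _).ne', Real.log_exp]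
  have h1 : ∀ a, inner ℝ (u - r • M) (m a - M) = f a +
      (r / 2 * ‖M‖ ^ 2 - inner ℝ u M + Real.log (partition w (expo m r u))) := by
    intro a
    simp only [hf, hlog, expo]
    rw [norm_sub_sq_real, inner_sub_left, inner_sub_right, inner_sub_right, inner_smul_left,
      inner_smul_left, real_inner_self_eq_norm_sq, real_inner_comm M (m a)]
    simp only [conj_trivial]
    ring
  have h2 : ∀ a, inner ℝ (u - r • M) (m a - M) = f a - ∑ b, p b * f b := by
    intro a
    have h3 : ∑ b, p b * inner ℝ (u - r • M) (m b - M) = 0 := sum_mul_inner_sub_wmean hp1 m _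
    simp_rw [h1, mul_add, Finset.sum_add_distrib, ← Finset.sum_mul] at h3
    rw [hp1] at h3
    rw [h1]
    linarith
  simp_rw [h2]
  refine (sum_mul_sub_sq_le hp1 f).trans ?_
  unfold wfourth
  rw [Finset.mul_sum, Finset.mul_sum, ← Finset.sum_add_distrib, ← Finset.sum_add_distrib]
  refine Finset.sum_le_sum fun a _ => ?_
  have h5 : f a ^ 2 ≤ 4 * Real.log (p a) ^ 2 + 4 * Real.log (w a) ^ 2 + ‖m a - M‖ ^ 4 := by
    have e4 : ‖m a - M‖ ^ 4 = (‖m a - M‖ ^ 2) ^ 2 := by ring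
    rw [e4]
    simp only [hf]
    set n := ‖m a - M‖ ^ 2
    have hrn : (r / 2 * n) ^ 2 ≤ n ^ 2 / 4 := by
      have : r ^ 2 ≤ 1 := pow_le_one₀ hr0 hr1
      nlinarith [sq_nonneg n]
    nlinarith [sq_nonneg (Real.log (p a) - Real.log (w a) - r / 2 * n),
      sq_nonneg (Real.log (p a) + Real.log (w a)), sq_nonneg n]
  have := mul_le_mul_of_nonneg_left h5 (hp0 a).le
  linarith

/-- Averages over the mixture of `N(√r m_k, I)`, joint with the label, are posterior averages
weighted by the partition function. -/
theorem sum_lintegral_mixture (hw : ∀ a, 0 < w a) (m : ι → E d) {r : ℝ} (hr0 : 0 ≤ r)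
    {f : ι → E d → ℝ} (hf : ∀ k, Measurable (f k)) (hf0 : ∀ k u, 0 ≤ f k u) :
    ∑ k, ENNReal.ofReal (w k) * ∫⁻ x, ENNReal.ofReal (f k (r • m k + Real.sqrt r • x))
        ∂(stdGaussian (E d)) =
      ∫⁻ x, ENNReal.ofReal (partition w (expo m r (Real.sqrt r • x)) *
        ∑ k, softmax w (expo m r (Real.sqrt r • x)) k * f k (Real.sqrt r • x))
        ∂(stdGaussian (E d)) := by
  have h1 : ∀ k, ∫⁻ x, ENNReal.ofReal (f k (r • m k + Real.sqrt r • x)) ∂(stdGaussian (E d)) =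
      ∫⁻ x, ENNReal.ofReal (Real.exp (expo m r (Real.sqrt r • x) k) * f k (Real.sqrt r • x))
        ∂(stdGaussian (E d)) := by
    intro k
    have h2 := lintegral_stdGaussian_shift (Real.sqrt r • m k)
      (F := fun x => ENNReal.ofReal (f k (Real.sqrt r • x))) (by have := hf k; fun_prop)
    simp only [smul_add, smul_smul, Real.mul_self_sqrt hr0] at h2
    rw [h2]
    refine lintegral_congr fun x => ?_
    rw [ENNReal.ofReal_mul (Real.exp_pos _).le]
    congr 3
    unfold expo
    rw [inner_smul_left, inner_smul_left, norm_smul, mul_pow, Real.norm_of_nonneg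
      (Real.sqrt_nonneg _), Real.sq_sqrt hr0, real_inner_comm]
  simp_rw [h1]
  have hmeas : ∀ k, Measurable fun x : E d =>
      ENNReal.ofReal (Real.exp (expo m r (Real.sqrt r • x) k) * f k (Real.sqrt r • x)) := by
    intro k
    have := hf k
    unfold expo
    fun_prop
  simp_rw [← lintegral_const_mul _ (hmeas _)]
  rw [← lintegral_finsetSum _ fun k _ => (hmeas k).const_mul _]
  refine lintegral_congr fun x => ?_
  rw [Finset.mul_sum, ENNReal.ofReal_sum_of_nonneg]
  · refine Finset.sum_congr rfl fun k _ => ?_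
    rw [← ENNReal.ofReal_mul (hw k).le, ← mul_assoc, ← mul_assoc, partition_mul_softmax hw]
  · intro k _
    exact mul_nonneg (partition_pos hw _).le (mul_nonneg (softmax_pos hw _ _).le (hf0 _ _))

theorem lintegral_partition (hw : ∀ a, 0 < w a) (hw1 : ∑ a, w a = 1) (m : ι → E d) {r : ℝ}
    (hr0 : 0 ≤ r) :
    ∫⁻ x, ENNReal.ofReal (partition w (expo m r (Real.sqrt r • x))) ∂(stdGaussian (E d)) = 1 := by
  have h := sum_lintegral_mixture hw m hr0 (f := fun _ _ => 1) (fun _ => measurable_const)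
    (fun _ _ => zero_le_one)
  simp only [mul_one, sum_softmax hw, ENNReal.ofReal_one, lintegral_const, measure_univ] at h
  rw [← h, ← ENNReal.ofReal_sum_of_nonneg fun a _ => (hw a).le, hw1, ENNReal.ofReal_one]

omit [Fintype ι] [Nonempty ι] in
theorem continuous_expo_sqrt (m : ι → E d) (r : ℝ) (a : ι) :
    Continuous fun x : E d => expo m r (Real.sqrt r • x) a := by
  unfold expo
  fun_prop

omit [Fintype ι] [Nonempty ι] in
/-- The Bhattacharyya coefficient of two components of the mixture. -/
theorem lintegral_exp_half_expo (m : ι → E d) {r : ℝ} (hr0 : 0 ≤ r) (a b : ι) :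
    ∫⁻ x, ENNReal.ofReal (Real.exp ((expo m r (Real.sqrt r • x) a +
        expo m r (Real.sqrt r • x) b) / 2)) ∂(stdGaussian (E d)) =
      ENNReal.ofReal (Real.exp (-(r * ‖m a - m b‖ ^ 2) / 8)) := by
  set v : E d := (Real.sqrt r / 2) • (m a + m b) with hv
  have hvn : ‖v‖ ^ 2 = r / 4 * ‖m a + m b‖ ^ 2 := by
    rw [hv, norm_smul, mul_pow, Real.norm_of_nonneg (by positivity), div_pow, Real.sq_sqrt hr0]
    ring
  have h : ∀ x : E d, Real.exp ((expo m r (Real.sqrt r • x) a +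
        expo m r (Real.sqrt r • x) b) / 2) = Real.exp (-(r * ‖m a - m b‖ ^ 2) / 8) *
        Real.exp (inner ℝ v x - ‖v‖ ^ 2 / 2) := by
    intro x
    rw [← Real.exp_add, hvn, hv]
    congr 1
    unfold expo
    rw [norm_sub_sq_real, norm_add_sq_real, inner_smul_left, inner_smul_left, inner_smul_left,
      inner_add_left, real_inner_comm x (m a), real_inner_comm x (m b)]
    simp only [conj_trivial]
    ring
  simp_rw [h, ENNReal.ofReal_mul (Real.exp_pos _).le]
  rw [lintegral_const_mul _ (by fun_prop), lintegral_exp_inner_stdGaussian, mul_one]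

/-- The product of two posterior weights, times the density, is at most the geometric mean of the two
components: `q p_a p_b = (q_a q_b) / q ≤ √(q_a q_b)`. -/
theorem partition_mul_softmax_mul_softmax_le (hw : ∀ a, 0 < w a) (θ : ι → ℝ) (a b : ι) :
    partition w θ * (softmax w θ a * softmax w θ b) ≤
      Real.sqrt (w a) * Real.sqrt (w b) * Real.exp ((θ a + θ b) / 2) := by
  have hZ := partition_pos hw θ
  have ha := softmax_pos hw θ a
  have hb := softmax_pos hw θ b
  refine (sq_le_sq₀ (by positivity) (by positivity)).1 ?_
  have e1 : (Real.sqrt (w a) * Real.sqrt (w b) * Real.exp ((θ a + θ b) / 2)) ^ 2 =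
      (partition w θ * softmax w θ a) * (partition w θ * softmax w θ b) := by
    rw [partition_mul_softmax hw, partition_mul_softmax hw, mul_pow, mul_pow,
      Real.sq_sqrt (hw a).le, Real.sq_sqrt (hw b).le, ← Real.exp_nat_mul]
    rw [show ((2 : ℕ) : ℝ) * ((θ a + θ b) / 2) = θ a + θ b by push_cast; ring, Real.exp_add]
    ring
  rw [e1]
  have h1 : softmax w θ a * softmax w θ b ≤ 1 :=
    mul_le_one₀ (softmax_le_one hw θ a) hb.le (softmax_le_one hw θ b)
  calc _ = (partition w θ * softmax w θ a) * (partition w θ * softmax w θ b) *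
        (softmax w θ a * softmax w θ b) := by ring
    _ ≤ _ := mul_le_of_le_one_right (by positivity) h1

omit [Nonempty ι] in
theorem sum_sqrt_mul_sqrt_le (hw : ∀ a, 0 < w a) (hw1 : ∑ a, w a = 1) :
    ∑ a, ∑ b, Real.sqrt (w a) * Real.sqrt (w b) ≤ Fintype.card ι := by
  rw [← Finset.sum_mul_sum, ← sq]
  have h := sq_sum_le_card_mul_sum_sq (s := Finset.univ) (f := fun a => Real.sqrt (w a))
  simp_rw [Real.sq_sqrt (hw _).le] at h
  rw [hw1, mul_one] at h
  simpa using h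

/-- The averaged fourth central moment of the posterior is at most quadratic in the logarithm of
the number of components: well separated components are rarely confused. -/
theorem lintegral_wfourth_le (hw : ∀ a, 0 < w a) (hw1 : ∑ a, w a = 1) (m : ι → E d) {r : ℝ}
    (hr : 1 / 2 ≤ r) :
    ∫⁻ x, ENNReal.ofReal (partition w (expo m r (Real.sqrt r • x)) *
        wfourth (softmax w (expo m r (Real.sqrt r • x))) m) ∂(stdGaussian (E d)) ≤
      ENNReal.ofReal (1024 * Real.log (Fintype.card ι) ^ 2 + 2048) := by
  have hr0 : 0 ≤ r := by linarith
  set N : ℝ := (Fintype.card ι : ℝ) with hN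
  have hNpos : 0 < N := by
    rw [hN]; exact_mod_cast Fintype.card_pos
  have hlogN : 0 ≤ Real.log N := Real.log_nonneg (by
    rw [hN]; exact_mod_cast Nat.one_le_iff_ne_zero.2 Fintype.card_ne_zero)
  -- pairs of means at squared distance above `L` are paid for by their Bhattacharyya coefficient
  set L := 32 * Real.log N with hL
  have hL0 : 0 ≤ L := by positivity
  set c : ι → ι → ℝ := fun a b => if ‖m a - m b‖ ^ 2 ≤ L then 0 else ‖m a - m b‖ ^ 4 with hc
  have hc0 : ∀ a b, 0 ≤ c a b := by
    intro a b; simp only [hc]; split_ifs <;> positivity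
  have hpt : ∀ x : E d, partition w (expo m r (Real.sqrt r • x)) *
      wfourth (softmax w (expo m r (Real.sqrt r • x))) m ≤
      L ^ 2 * partition w (expo m r (Real.sqrt r • x)) +
      ∑ a, ∑ b, c a b * (Real.sqrt (w a) * Real.sqrt (w b)) *
        Real.exp ((expo m r (Real.sqrt r • x) a + expo m r (Real.sqrt r • x) b) / 2) := by
    intro x
    set θ := expo m r (Real.sqrt r • x)
    have hZ := partition_pos hw θ
    have hp0 : ∀ a, 0 ≤ softmax w θ a := fun a => (softmax_pos hw θ a).le
    have hp1 : ∑ a, softmax w θ a = 1 := sum_softmax hw θ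
    have h1 := mul_le_mul_of_nonneg_left (wfourth_le_pairs (m := m) hp0 hp1) hZ.le
    refine h1.trans ?_
    have h2 : L ^ 2 * partition w θ = ∑ a, ∑ b, partition w θ *
        (softmax w θ a * softmax w θ b * L ^ 2) := by
      have : ∑ a, ∑ b, softmax w θ a * softmax w θ b = 1 := by
        rw [← Finset.sum_mul_sum, hp1, one_mul]
      simp_rw [← Finset.mul_sum, ← Finset.sum_mul]
      rw [this]; ring
    rw [h2, Finset.mul_sum, ← Finset.sum_add_distrib]
    refine Finset.sum_le_sum fun a _ => ?_
    rw [Finset.mul_sum, ← Finset.sum_add_distrib]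
    refine Finset.sum_le_sum fun b _ => ?_
    have hpp : 0 ≤ partition w θ * (softmax w θ a * softmax w θ b) :=
      mul_nonneg hZ.le (mul_nonneg (hp0 a) (hp0 b))
    have hs := partition_mul_softmax_mul_softmax_le hw θ a b
    simp only [hc]
    split_ifs with hab
    · have h4 : ‖m a - m b‖ ^ 4 ≤ L ^ 2 := by
        have := pow_le_pow_left₀ (sq_nonneg _) hab 2
        rwa [← pow_mul] at this
      have := mul_le_mul_of_nonneg_left h4 hpp
      linarith
    · have h4 : 0 ≤ ‖m a - m b‖ ^ 4 := by positivity
      have h5 := mul_le_mul_of_nonneg_left hs h4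
      have h6 := mul_nonneg hpp (sq_nonneg L)
      linarith
  refine (lintegral_mono fun x => ENNReal.ofReal_le_ofReal (hpt x)).trans ?_
  have hcont := continuous_expo_sqrt m r
  have hZc : Continuous fun x : E d => partition w (expo m r (Real.sqrt r • x)) :=
    continuous_partition hcont
  have hw0 : ∀ a b, 0 ≤ c a b * (Real.sqrt (w a) * Real.sqrt (w b)) := fun a b =>
    mul_nonneg (hc0 a b) (by positivity)
  have hsplit : ∀ x : E d, ENNReal.ofReal (L ^ 2 * partition w (expo m r (Real.sqrt r • x)) +
      ∑ a, ∑ b, c a b * (Real.sqrt (w a) * Real.sqrt (w b)) *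
        Real.exp ((expo m r (Real.sqrt r • x) a + expo m r (Real.sqrt r • x) b) / 2)) =
      ENNReal.ofReal (L ^ 2) * ENNReal.ofReal (partition w (expo m r (Real.sqrt r • x))) +
      ∑ a, ∑ b, ENNReal.ofReal (c a b * (Real.sqrt (w a) * Real.sqrt (w b))) *
        ENNReal.ofReal (Real.exp ((expo m r (Real.sqrt r • x) a +
          expo m r (Real.sqrt r • x) b) / 2)) := by
    intro x
    rw [ENNReal.ofReal_add (mul_nonneg (sq_nonneg _) (partition_pos hw _).le)
      (Finset.sum_nonneg fun a _ => Finset.sum_nonneg fun b _ =>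
        mul_nonneg (hw0 a b) (Real.exp_pos _).le), ENNReal.ofReal_mul (sq_nonneg _),
      ENNReal.ofReal_sum_of_nonneg fun a _ => Finset.sum_nonneg fun b _ =>
        mul_nonneg (hw0 a b) (Real.exp_pos _).le]
    congr 1
    refine Finset.sum_congr rfl fun a _ => ?_
    rw [ENNReal.ofReal_sum_of_nonneg fun b _ => mul_nonneg (hw0 a b) (Real.exp_pos _).le]
    exact Finset.sum_congr rfl fun b _ => ENNReal.ofReal_mul (hw0 a b)
  simp_rw [hsplit]
  have hem : ∀ a b, Measurable fun x : E d => ENNReal.ofReal (Real.exp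
      ((expo m r (Real.sqrt r • x) a + expo m r (Real.sqrt r • x) b) / 2)) := fun a b =>
    (Continuous.rexp (((hcont a).add (hcont b)).div_const 2)).measurable.ennreal_ofReal
  rw [lintegral_add_left (by have := hZc.measurable; fun_prop), lintegral_const_mul _
    hZc.measurable.ennreal_ofReal, lintegral_partition hw hw1 m hr0, mul_one,
    lintegral_finsetSum _ fun a _ => Finset.measurable_fun_sum _ fun b _ =>
      (hem a b).const_mul _]
  simp_rw [lintegral_finsetSum _ fun b _ => (hem _ b).const_mul _,
    lintegral_const_mul _ (hem _ _), lintegral_exp_half_expo m hr0]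
  simp_rw [← ENNReal.ofReal_mul (hw0 _ _)]
  simp_rw [← ENNReal.ofReal_sum_of_nonneg fun b (_ : b ∈ Finset.univ) =>
    mul_nonneg (hw0 _ b) (Real.exp_pos _).le]
  rw [← ENNReal.ofReal_sum_of_nonneg fun a _ => Finset.sum_nonneg fun b _ =>
        mul_nonneg (hw0 a b) (Real.exp_pos _).le, ← ENNReal.ofReal_add (sq_nonneg _)
        (Finset.sum_nonneg fun a _ => Finset.sum_nonneg fun b _ =>
        mul_nonneg (hw0 a b) (Real.exp_pos _).le)]
  refine ENNReal.ofReal_le_ofReal (add_le_add (le_of_eq (by rw [hL]; ring)) ?_)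
  have hterm : ∀ a b, c a b * (Real.sqrt (w a) * Real.sqrt (w b)) *
      Real.exp (-(r * ‖m a - m b‖ ^ 2) / 8) ≤ 2048 / N * (Real.sqrt (w a) * Real.sqrt (w b)) := by
    intro a b
    have hsw : 0 ≤ Real.sqrt (w a) * Real.sqrt (w b) := by positivity
    have : c a b * Real.exp (-(r * ‖m a - m b‖ ^ 2) / 8) ≤ 2048 / N := by
      simp only [hc]
      split_ifs with hab
      · rw [zero_mul]; positivity
      · push Not at hab
        set t := ‖m a - m b‖ ^ 2 with ht
        have h4 : ‖m a - m b‖ ^ 4 = t ^ 2 := by rw [ht]; ring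
        have ht0 : 0 ≤ t := sq_nonneg _
        -- half of the exponent absorbs the polynomial, the other half the number of components
        have hq : t ^ 2 ≤ 2048 * Real.exp (t / 32) := by
          have := Real.quadratic_le_exp_of_nonneg (by positivity : 0 ≤ t / 32)
          nlinarith
        have hn : Real.exp (-(t / 32)) ≤ 1 / N := by
          rw [← Real.exp_log (by positivity : 0 < 1 / N), Real.exp_le_exp, one_div, Real.log_inv]
          linarith
        have hexp : Real.exp (-(r * t) / 8) ≤ Real.exp (-(t / 32)) * Real.exp (-(t / 32)) := by
          rw [← Real.exp_add, Real.exp_le_exp]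
          nlinarith
        rw [h4]
        calc _ ≤ 2048 * Real.exp (t / 32) * (Real.exp (-(t / 32)) * Real.exp (-(t / 32))) :=
              mul_le_mul hq hexp (Real.exp_pos _).le (by positivity)
          _ = 2048 * Real.exp (-(t / 32)) := by
              rw [Real.exp_neg]; field_simp
          _ ≤ 2048 * (1 / N) := by linarith
          _ = _ := by ring
    calc _ = c a b * Real.exp (-(r * ‖m a - m b‖ ^ 2) / 8) *
          (Real.sqrt (w a) * Real.sqrt (w b)) := by ring
      _ ≤ _ := mul_le_mul_of_nonneg_right this hsw
  calc _ ≤ ∑ a, ∑ b, 2048 / N * (Real.sqrt (w a) * Real.sqrt (w b)) :=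
        Finset.sum_le_sum fun a _ => Finset.sum_le_sum fun b _ => hterm a b
    _ = 2048 / N * ∑ a, ∑ b, Real.sqrt (w a) * Real.sqrt (w b) := by
        simp_rw [← Finset.mul_sum]
    _ ≤ 2048 / N * N := mul_le_mul_of_nonneg_left (sum_sqrt_mul_sqrt_le hw hw1) (by positivity)
    _ = 2048 := by field_simp

end Mixture

/-! ### The local error of one step with the exact score -/

section LocalError

variable {K d : ℕ} {w : Fin K → ℝ} {m : Fin K → E d}

theorem nonempty_of_sum_eq_one (hw1 : ∑ a, w a = 1) : Nonempty (Fin K) := by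
  by_contra h
  rw [not_nonempty_iff] at h
  simp at hw1

theorem lintegral_gmm (w : Fin K → ℝ) (m : Fin K → E d) {f : E d → ENNReal} (hf : Measurable f) :
    ∫⁻ y, f y ∂(gmm w m) =
      ∑ k, ENNReal.ofReal (w k) * ∫⁻ z, f (m k + z) ∂(stdGaussian (E d)) := by
  unfold gmm
  rw [lintegral_finsetSum_measure]
  refine Finset.sum_congr rfl fun k _ => ?_
  rw [lintegral_smul_measure, lintegral_map hf (by fun_prop), smul_eq_mul]

theorem isProbabilityMeasure_gmm (hw : ∀ a, 0 < w a) (hw1 : ∑ a, w a = 1) (m : Fin K → E d) :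
    IsProbabilityMeasure (gmm w m) := by
  constructor
  have h := lintegral_gmm w m (f := fun _ => 1) measurable_const
  simp only [lintegral_const, measure_univ, mul_one, one_mul] at h
  rw [h, ← ENNReal.ofReal_sum_of_nonneg fun a _ => (hw a).le, hw1, ENNReal.ofReal_one]

theorem integrable_norm_sq_gmm (w : Fin K → ℝ) (m : Fin K → E d) :
    Integrable (fun y => ‖y‖ ^ 2) (gmm w m) := by
  unfold gmm
  rw [integrable_finsetSum_measure]
  intro k _
  refine Integrable.smul_measure ?_ ENNReal.ofReal_ne_top
  rw [integrable_map_measure (by fun_prop) (by fun_prop)]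
  refine ((integrable_const (2 * ‖m k‖ ^ 2)).add
    ((integrable_norm_sq_stdGaussian (d := d)).const_mul 2)).mono' (by fun_prop)
    (.of_forall fun z => ?_)
  simp only [Function.comp, Pi.add_apply]
  rw [Real.norm_of_nonneg (sq_nonneg _)]
  have := pow_le_pow_left₀ (norm_nonneg _) (norm_add_le (m k) z) 2
  nlinarith [sq_nonneg (‖m k‖ - ‖z‖)]

/-- The density of the mixture of the `N(√r m_k, I)` with respect to the standard Gaussian. -/
theorem lintegral_gmm_sqrt_smul (hw : ∀ a, 0 < w a) (m : Fin K → E d) {r : ℝ} (hr0 : 0 ≤ r)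
    {f : E d → ENNReal} (hf : Measurable f) :
    ∫⁻ x, f x ∂(gmm w (fun k => Real.sqrt r • m k)) =
      ∫⁻ x, ENNReal.ofReal (partition w (expo m r (Real.sqrt r • x))) * f x
        ∂(stdGaussian (E d)) := by
  rw [lintegral_gmm _ _ hf]
  have h1 : ∀ k, ∫⁻ z, f (Real.sqrt r • m k + z) ∂(stdGaussian (E d)) =
      ∫⁻ x, ENNReal.ofReal (Real.exp (expo m r (Real.sqrt r • x) k)) * f x
        ∂(stdGaussian (E d)) := by
    intro k
    rw [lintegral_stdGaussian_shift _ hf]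
    refine lintegral_congr fun x => ?_
    congr 3
    unfold expo
    rw [inner_smul_left, inner_smul_left, norm_smul, mul_pow, Real.norm_of_nonneg
      (Real.sqrt_nonneg _), Real.sq_sqrt hr0, real_inner_comm]
  have hm : ∀ k, Measurable fun x : E d =>
      ENNReal.ofReal (Real.exp (expo m r (Real.sqrt r • x) k)) * f x := fun k =>
    (Measurable.ennreal_ofReal (by unfold expo; fun_prop)).mul hf
  simp_rw [h1]
  simp_rw [← lintegral_const_mul _ (hm _)]
  rw [← lintegral_finsetSum _ fun k _ => (hm k).const_mul _]
  refine lintegral_congr fun x => ?_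
  unfold partition
  rw [ENNReal.ofReal_sum_of_nonneg fun k _ => mul_nonneg (hw k).le (Real.exp_pos _).le,
    Finset.sum_mul]
  refine Finset.sum_congr rfl fun k _ => ?_
  rw [ENNReal.ofReal_mul (hw k).le, mul_assoc]

/-- The joint law of the endpoint and an intermediate point of the bridge, seen from the
intermediate point. -/
theorem lintegral_gmm_bridge (w : Fin K → ℝ) (m : Fin K → E d) {r : ℝ} (h0 : 0 < r) (h1 : r < 1)
    {Φ : E d → E d → ENNReal} (hΦ : Measurable (Function.uncurry Φ)) :
    ∫⁻ q, Φ q.1 (bridgePoint r q.1 q.2) ∂((gmm w m).prod (stdGaussian (E d))) =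
      ∑ k, ENNReal.ofReal (w k) * ∫⁻ x, ∫⁻ z, Φ (m k + (Real.sqrt r • x + Real.sqrt (1 - r) • z))
        (r • m k + Real.sqrt r • x) ∂(stdGaussian (E d)) ∂(stdGaussian (E d)) := by
  have hΦ' : Measurable fun p : E d × E d => Φ p.1 p.2 := hΦ
  have hm : Measurable fun q : E d × E d => Φ q.1 (bridgePoint r q.1 q.2) := by
    unfold bridgePoint
    fun_prop
  rw [lintegral_prod _ hm.aemeasurable, lintegral_gmm _ _ hm.lintegral_prod_right']
  refine Finset.sum_congr rfl fun k _ => ?_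
  congr 1
  have := lintegral_gaussian_exchange h0 (by linarith : 0 < 1 - r) (by ring) (M := fun _ => 0)
    measurable_const (F := fun x y => Φ (m k + y) (r • m k + Real.sqrt r • x))
    (by unfold Function.uncurry; fun_prop)
  simp only [smul_zero, add_zero, inner_zero_left, norm_zero] at this
  rw [this]
  refine lintegral_congr fun y => lintegral_congr fun z => ?_
  simp only [bridgePoint]
  norm_num
  rw [Real.sqrt_mul h0.le, smul_smul, smul_smul, Real.mul_self_sqrt h0.le, add_assoc]

/-- The second derivative of the log-partition function along the bridge has an absolute first
moment of order `(1 + log K)²`, whatever the dimension and the means. -/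
theorem lintegral_bridgeDeriv2_le (hw : ∀ a, 0 < w a) (hw1 : ∑ a, w a = 1) (m : Fin K → E d)
    {r : ℝ} (hr : 1 / 2 ≤ r) (h1 : r < 1) :
    ∫⁻ q, ENNReal.ofReal |bridgeDeriv2 r q.1 m (bridgePost w m r q.1 q.2)|
        ∂((gmm w m).prod (stdGaussian (E d))) ≤
      ENNReal.ofReal (60000 * (1 + Real.log K) ^ 2) := by
  have := nonempty_of_sum_eq_one hw1
  have h0 : 0 < r := by linarith
  set P : E d → Fin K → ℝ := fun u => softmax w (expo m r u) with hP
  have hP0 : ∀ u a, 0 < P u a := fun u => softmax_pos hw _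
  have hP0' : ∀ u a, 0 ≤ P u a := fun u a => (hP0 u a).le
  have hP1 : ∀ u, ∑ a, P u a = 1 := fun u => sum_softmax hw _
  have hPc : ∀ a, Continuous fun u => P u a :=
    continuous_softmax hw fun a => by unfold expo; fun_prop
  have hMc : Continuous fun u => wmean (P u) m := continuous_wmean hPc
  have hVc : Continuous fun u => wvar (P u) m := continuous_wvar hPc
  have h4c : Continuous fun u => wfourth (P u) m := by
    unfold wfourth
    exact continuous_finsetSum _ fun a _ => (hPc a).mul (by fun_prop)
  set A : E d → E d → ℝ := fun y u =>
    ∑ a, P u a * inner ℝ (y - wmean (P u) m) (m a - wmean (P u) m) ^ 2 with hA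
  have hAc : Continuous (Function.uncurry A) := by
    refine continuous_finsetSum _ fun a _ => ((hPc a).comp continuous_snd).mul ?_
    have := hMc.comp (continuous_snd (X := E d) (Y := E d))
    simp only [Function.comp_def] at this
    fun_prop
  -- the bound on the integrand after integrating out the last Gaussian
  set R : Fin K → E d → ℝ := fun k u => 1 + 2 * (3 * ∑ a, P u a *
      inner ℝ (m k - wmean (P u) m) (m a - wmean (P u) m) ^ 2 + 3 * ∑ a, P u a *
      inner ℝ (u - r • wmean (P u) m) (m a - wmean (P u) m) ^ 2 + 3 * wvar (P u) m) +
      10 * wfourth (P u) m with hR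
  have hRm : ∀ k, Measurable (R k) := by
    intro k
    have e1 : Continuous fun u => ∑ a, P u a *
      inner ℝ (m k - wmean (P u) m) (m a - wmean (P u) m) ^ 2 :=
      continuous_finsetSum _ fun a _ => (hPc a).mul (by fun_prop)
    have e2 : Continuous fun u => ∑ a, P u a *
      inner ℝ (u - r • wmean (P u) m) (m a - wmean (P u) m) ^ 2 :=
      continuous_finsetSum _ fun a _ => (hPc a).mul (by fun_prop)
    have : Continuous (R k) := by simp only [hR]; fun_prop
    exact this.measurable
  have hR0 : ∀ k u, 0 ≤ R k u := by
    intro k u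
    have e1 : 0 ≤ ∑ a, P u a * inner ℝ (m k - wmean (P u) m) (m a - wmean (P u) m) ^ 2 :=
      Finset.sum_nonneg fun a _ => mul_nonneg (hP0' u a) (sq_nonneg _)
    have e2 : 0 ≤ ∑ a, P u a * inner ℝ (u - r • wmean (P u) m) (m a - wmean (P u) m) ^ 2 :=
      Finset.sum_nonneg fun a _ => mul_nonneg (hP0' u a) (sq_nonneg _)
    have e3 := wvar_nonneg (m := m) (hP0' u)
    have e4 := wfourth_nonneg (m := m) (hP0' u)
    simp only [hR]
    positivity
  have hpoint : ∫⁻ q, ENNReal.ofReal |bridgeDeriv2 r q.1 m (bridgePost w m r q.1 q.2)|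
        ∂((gmm w m).prod (stdGaussian (E d))) ≤
      ∫⁻ q, ENNReal.ofReal (1 + 2 * A q.1 (bridgePoint r q.1 q.2) +
        10 * wfourth (P (bridgePoint r q.1 q.2)) m) ∂((gmm w m).prod (stdGaussian (E d))) := by
    refine lintegral_mono fun q => ENNReal.ofReal_le_ofReal ?_
    exact abs_bridgeDeriv2_le (hP0' _) (hP1 _) h0.le h1.le q.1
  have hfresh : ∀ k (x : E d), ∫⁻ z, ENNReal.ofReal (1 + 2 * A (m k + (Real.sqrt r • x +
      Real.sqrt (1 - r) • z)) (r • m k + Real.sqrt r • x) +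
        10 * wfourth (P (r • m k + Real.sqrt r • x)) m) ∂(stdGaussian (E d)) ≤
      ENNReal.ofReal (R k (r • m k + Real.sqrt r • x)) := by
    intro k x
    set u := r • m k + Real.sqrt r • x with hu
    set M := wmean (P u) m with hM
    set c0 : ℝ := 1 + 2 * (3 * ∑ a, P u a * inner ℝ (m k - M) (m a - M) ^ 2 + 3 * ∑ a, P u a *
      inner ℝ (u - r • M) (m a - M) ^ 2) + 10 * wfourth (P u) m with hc0
    have hint : ∀ a, Integrable (fun z : E d => P u a * inner ℝ z (m a - M) ^ 2)
        (stdGaussian (E d)) := fun a => (integrable_inner_sq_stdGaussian _).const_mul _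
    have hint2 : Integrable (fun z : E d => c0 + 6 * ∑ a, P u a * inner ℝ z (m a - M) ^ 2)
        (stdGaussian (E d)) :=
      (integrable_const c0).add ((integrable_finsetSum _ fun a _ => hint a).const_mul 6)
    have hval : ∫ z, (c0 + 6 * ∑ a, P u a * inner ℝ z (m a - M) ^ 2) ∂(stdGaussian (E d)) =
        R k u := by
      rw [integral_add (integrable_const c0)
        ((integrable_finsetSum _ fun a _ => hint a).const_mul 6), integral_const_mul,
        integral_finsetSum _ fun a _ => hint a]
      simp_rw [integral_const_mul, integral_inner_sq_stdGaussian]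
      simp only [integral_const, probReal_univ, one_smul, hR, hc0, wvar]
      ring
    have hc0' : 0 ≤ c0 := by
      have e1 : 0 ≤ ∑ a, P u a * inner ℝ (m k - M) (m a - M) ^ 2 :=
        Finset.sum_nonneg fun a _ => mul_nonneg (hP0' u a) (sq_nonneg _)
      have e2 : 0 ≤ ∑ a, P u a * inner ℝ (u - r • M) (m a - M) ^ 2 :=
        Finset.sum_nonneg fun a _ => mul_nonneg (hP0' u a) (sq_nonneg _)
      have e4 := wfourth_nonneg (m := m) (hP0' u)
      positivity
    rw [← hval, ofReal_integral_eq_lintegral_ofReal hint2 (.of_forall fun z => add_nonneg hc0'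
      (mul_nonneg (by norm_num) (Finset.sum_nonneg fun a _ =>
        mul_nonneg (hP0' u a) (sq_nonneg _))))]
    refine lintegral_mono fun z => ENNReal.ofReal_le_ofReal ?_
    have hAle : A (m k + (Real.sqrt r • x + Real.sqrt (1 - r) • z)) u ≤
        3 * ∑ a, P u a * inner ℝ (m k - M) (m a - M) ^ 2 + 3 * ∑ a, P u a *
        inner ℝ (u - r • M) (m a - M) ^ 2 + 3 * ∑ a, P u a * inner ℝ z (m a - M) ^ 2 := by
      simp only [hA]
      rw [Finset.mul_sum, Finset.mul_sum, Finset.mul_sum, ← Finset.sum_add_distrib,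
        ← Finset.sum_add_distrib]
      refine Finset.sum_le_sum fun a _ => ?_
      -- the deviation of the endpoint, split into the label, the bridge and the fresh Gaussian
      have hvec : m k + (Real.sqrt r • x + Real.sqrt (1 - r) • z) - M =
          (1 - r) • (m k - M) + (u - r • M) + Real.sqrt (1 - r) • z := by
        rw [hu]
        module
      rw [← hM, hvec, inner_add_left, inner_add_left, inner_smul_left, inner_smul_left]
      simp only [conj_trivial]
      set a1 := inner ℝ (m k - M) (m a - M)
      set a2 := inner ℝ (u - r • M) (m a - M)
      set a3 := inner ℝ z (m a - M)
      have hs : Real.sqrt (1 - r) ^ 2 = 1 - r := Real.sq_sqrt (by linarith)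
      have hb : ((1 - r) * a1 + a2 + Real.sqrt (1 - r) * a3) ^ 2 ≤
          3 * a1 ^ 2 + 3 * a2 ^ 2 + 3 * a3 ^ 2 := by
        have t1 : ((1 - r) * a1) ^ 2 ≤ a1 ^ 2 := by
          rw [mul_pow]; exact mul_le_of_le_one_left (sq_nonneg _)
            (pow_le_one₀ (by linarith) (by linarith))
        have t3 : (Real.sqrt (1 - r) * a3) ^ 2 ≤ a3 ^ 2 := by
          rw [mul_pow, hs]; exact mul_le_of_le_one_left (sq_nonneg _) (by linarith)
        nlinarith [sq_nonneg ((1 - r) * a1 - a2), sq_nonneg ((1 - r) * a1 - Real.sqrt (1 - r) * a3),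
          sq_nonneg (a2 - Real.sqrt (1 - r) * a3)]
      have := mul_le_mul_of_nonneg_left hb (hP0' u a)
      linarith
    simp only [hc0]
    linarith
  have hmix : ∫⁻ q, ENNReal.ofReal (1 + 2 * A q.1 (bridgePoint r q.1 q.2) +
        10 * wfourth (P (bridgePoint r q.1 q.2)) m) ∂((gmm w m).prod (stdGaussian (E d))) ≤
      ∫⁻ x, ENNReal.ofReal (partition w (expo m r (Real.sqrt r • x)) *
        ∑ k, P (Real.sqrt r • x) k * R k (Real.sqrt r • x)) ∂(stdGaussian (E d)) := by
    rw [← sum_lintegral_mixture hw m h0.le hRm hR0, lintegral_gmm_bridge w m h0 h1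
      (Φ := fun y u => ENNReal.ofReal (1 + 2 * A y u + 10 * wfourth (P u) m)) (by
        have : Continuous fun p : E d × E d => 1 + 2 * A p.1 p.2 + 10 * wfourth (P p.2) m :=
          (continuous_const.add (continuous_const.mul hAc)).add
            (continuous_const.mul (h4c.comp continuous_snd))
        exact this.measurable.ennreal_ofReal)]
    exact Finset.sum_le_sum fun k _ => mul_le_mul_right (lintegral_mono fun x => hfresh k x) _
  set l := Real.log K with hl
  have hl0 : 0 ≤ l := Real.log_natCast_nonneg K
  have hcard : ((Fintype.card (Fin K) : ℕ) : ℝ) = K := by simp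
  have hZ0 : ∀ u, 0 < partition w (expo m r u) := fun u => partition_pos hw _
  -- the average over the label turns the first term of `R` into the squared covariance
  have hlabel : ∀ x : E d, partition w (expo m r (Real.sqrt r • x)) *
        ∑ k, P (Real.sqrt r • x) k * R k (Real.sqrt r • x) ≤
      (199 + 48 * l ^ 2) * partition w (expo m r (Real.sqrt r • x)) +
      28 * (partition w (expo m r (Real.sqrt r • x)) * wfourth (P (Real.sqrt r • x)) m) +
      24 * (partition w (expo m r (Real.sqrt r • x)) *
        ∑ k, P (Real.sqrt r • x) k * Real.log (w k) ^ 2) := by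
    intro x
    set u := Real.sqrt r • x
    have e1 : ∑ k, P u k * R k u = 1 + 2 * (3 * wcovSq (P u) m + 3 * ∑ a, P u a *
      inner ℝ (u - r • wmean (P u) m) (m a - wmean (P u) m) ^ 2 + 3 * wvar (P u) m) +
      10 * wfourth (P u) m := by
      have e2 : wcovSq (P u) m = ∑ k, P u k * ∑ a, P u a *
          inner ℝ (m k - wmean (P u) m) (m a - wmean (P u) m) ^ 2 := by
        unfold wcovSq
        simp_rw [Finset.mul_sum]
        exact Finset.sum_congr rfl fun a _ => Finset.sum_congr rfl fun b _ => by ring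
      have e3 : ∀ k, P u k * R k u = 6 * (P u k * ∑ a, P u a *
          inner ℝ (m k - wmean (P u) m) (m a - wmean (P u) m) ^ 2) + P u k *
          (1 + 2 * (3 * ∑ a, P u a * inner ℝ (u - r • wmean (P u) m) (m a - wmean (P u) m) ^ 2 +
            3 * wvar (P u) m) + 10 * wfourth (P u) m) := by
        intro k; simp only [hR]; ring
      simp_rw [e3]
      rw [Finset.sum_add_distrib, ← Finset.mul_sum, ← e2, ← Finset.sum_mul, hP1]
      ring
    have b1 := wcovSq_le (m := m) (hP0' u) (hP1 u)
    have b2 := sum_mul_inner_sq_le hw m h0.le h1.le u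
    have b3 := wvar_le_one_add (m := m) (hP0' u) (hP1 u)
    have b4 := sum_mul_log_sq_le (hP0 u) (hP1 u)
    rw [hcard] at b4
    have b5 : ∑ k, P u k * R k u ≤ (199 + 48 * l ^ 2) + 28 * wfourth (P u) m +
        24 * ∑ k, P u k * Real.log (w k) ^ 2 := by
      rw [e1]
      change ∑ a, P u a * inner ℝ (u - r • wmean (P u) m) (m a - wmean (P u) m) ^ 2 ≤
        4 * ∑ a, P u a * Real.log (P u a) ^ 2 + 4 * ∑ a, P u a * Real.log (w a) ^ 2 +
        wfourth (P u) m at b2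
      linarith
    have := mul_le_mul_of_nonneg_left b5 (hZ0 u).le
    linarith
  have hZc : Continuous fun x : E d => partition w (expo m r (Real.sqrt r • x)) :=
    continuous_partition (continuous_expo_sqrt m r)
  have hsc : Continuous fun x : E d => Real.sqrt r • x := by fun_prop
  have h4c' := h4c.comp hsc
  have hPc' := fun k => (hPc k).comp hsc
  simp only [Function.comp_def] at h4c' hPc'
  have hsplit : ∀ x : E d, ENNReal.ofReal (partition w (expo m r (Real.sqrt r • x)) *
        ∑ k, P (Real.sqrt r • x) k * R k (Real.sqrt r • x)) ≤
      ENNReal.ofReal (199 + 48 * l ^ 2) *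
        ENNReal.ofReal (partition w (expo m r (Real.sqrt r • x))) +
      ENNReal.ofReal 28 * ENNReal.ofReal (partition w (expo m r (Real.sqrt r • x)) *
        wfourth (P (Real.sqrt r • x)) m) +
      ENNReal.ofReal 24 * ENNReal.ofReal (partition w (expo m r (Real.sqrt r • x)) *
        ∑ k, P (Real.sqrt r • x) k * Real.log (w k) ^ 2) := by
    intro x
    have hw4 := wfourth_nonneg (m := m) (hP0' (Real.sqrt r • x))
    have hz := (hZ0 (Real.sqrt r • x)).le
    rw [← ENNReal.ofReal_mul (by positivity), ← ENNReal.ofReal_mul (by positivity),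
      ← ENNReal.ofReal_mul (by positivity), ← ENNReal.ofReal_add (by positivity) (by positivity),
      ← ENNReal.ofReal_add (by positivity) (mul_nonneg (by norm_num) (mul_nonneg hz
        (Finset.sum_nonneg fun a _ => mul_nonneg (hP0' _ a) (sq_nonneg _))))]
    exact ENNReal.ofReal_le_ofReal (hlabel x)
  have hlogc : Continuous fun x : E d => ∑ k, P (Real.sqrt r • x) k * Real.log (w k) ^ 2 :=
    continuous_finsetSum _ fun a _ => (hPc' a).mul continuous_const
  have hm1 : Measurable fun x : E d => ENNReal.ofReal (partition w (expo m r (Real.sqrt r • x)) *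
      wfourth (P (Real.sqrt r • x)) m) := (hZc.mul h4c').measurable.ennreal_ofReal
  have hm2 : Measurable fun x : E d => ENNReal.ofReal (partition w (expo m r (Real.sqrt r • x)) *
      ∑ k, P (Real.sqrt r • x) k * Real.log (w k) ^ 2) :=
    (hZc.mul hlogc).measurable.ennreal_ofReal
  refine hpoint.trans (hmix.trans ((lintegral_mono hsplit).trans ?_))
  have hm0 : Measurable fun x : E d => ENNReal.ofReal (199 + 48 * l ^ 2) *
      ENNReal.ofReal (partition w (expo m r (Real.sqrt r • x))) :=
    hZc.measurable.ennreal_ofReal.const_mul _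
  have hm01 : Measurable fun x : E d => ENNReal.ofReal (199 + 48 * l ^ 2) *
      ENNReal.ofReal (partition w (expo m r (Real.sqrt r • x))) +
      ENNReal.ofReal 28 * ENNReal.ofReal (partition w (expo m r (Real.sqrt r • x)) *
      wfourth (P (Real.sqrt r • x)) m) := hm0.add (hm1.const_mul _)
  rw [lintegral_add_left hm01, lintegral_add_left hm0,
    lintegral_const_mul _ hZc.measurable.ennreal_ofReal, lintegral_const_mul _ hm1,
    lintegral_const_mul _ hm2,
    lintegral_partition hw hw1 m h0.le, mul_one]
  have i1 := lintegral_wfourth_le hw hw1 m hr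
  rw [hcard] at i1
  have i2 : ∫⁻ x, ENNReal.ofReal (partition w (expo m r (Real.sqrt r • x)) *
        ∑ k, P (Real.sqrt r • x) k * Real.log (w k) ^ 2) ∂(stdGaussian (E d)) ≤
      ENNReal.ofReal (2 * l ^ 2 + 8) := by
    rw [← sum_lintegral_mixture hw m h0.le (f := fun k _ => Real.log (w k) ^ 2)
      (fun _ => measurable_const) fun _ _ => sq_nonneg _]
    simp only [lintegral_const, measure_univ, mul_one]
    have b4 := sum_mul_log_sq_le hw hw1
    rw [hcard] at b4
    refine le_trans (le_of_eq ?_) (ENNReal.ofReal_le_ofReal b4)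
    rw [ENNReal.ofReal_sum_of_nonneg fun k _ => mul_nonneg (hw k).le (sq_nonneg _)]
    exact Finset.sum_congr rfl fun k _ => (ENNReal.ofReal_mul (hw k).le).symm
  refine (add_le_add (add_le_add le_rfl (mul_le_mul_right i1 _)) (mul_le_mul_right i2 _)).trans ?_
  rw [← ENNReal.ofReal_mul (by norm_num), ← ENNReal.ofReal_mul (by norm_num),
    ← ENNReal.ofReal_add (by positivity) (by positivity),
    ← ENNReal.ofReal_add (by positivity) (by positivity)]
  refine ENNReal.ofReal_le_ofReal ?_
  nlinarith

end LocalError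

section ExactStep

variable {K d : ℕ} {w : Fin K → ℝ} {m : Fin K → E d}

/-- The posterior mean of the label mean, given that the bridge to a sample of the mixture of the
`N(m_k, I)` is at `u` at time `r`. -/
def posteriorMean (w : Fin K → ℝ) (m : Fin K → E d) (r : ℝ) (u : E d) : E d :=
  wmean (softmax w (expo m r u)) m

/-- The law of one step of the sampler with the exact score, started from the exact law: the input
is a sample of the mixture of the `N(√r m_k, I)`, and the step aims at the mixture of the
`N(m_k, I)`. -/
def exactStep (w : Fin K → ℝ) (m : Fin K → E d) (r : ℝ) : Measure (E d) :=
  ((gmm w fun k => Real.sqrt r • m k).prod (stdGaussian (E d))).map fun p =>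
    Real.sqrt r • p.1 + (1 - r) • posteriorMean w m r (Real.sqrt r • p.1) +
      Real.sqrt (1 - r) • p.2

/-- The exponent of the Girsanov density of the exact step, on the path `q`. -/
def stepDrift (w : Fin K → ℝ) (m : Fin K → E d) (r : ℝ) (q : E d × E d) : ℝ :=
  inner ℝ (posteriorMean w m r (bridgePoint r q.1 q.2)) (q.1 - bridgePoint r q.1 q.2) -
    (1 - r) * ‖posteriorMean w m r (bridgePoint r q.1 q.2)‖ ^ 2 / 2

/-- The log-likelihood ratio of the time reversal of the forward noising step against the exact
step of the sampler, on the path `q`. -/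
def stepLogRatio (w : Fin K → ℝ) (m : Fin K → E d) (r : ℝ) (q : E d × E d) : ℝ :=
  bridgeLog w m 1 q.1 q.2 - bridgeLog w m r q.1 q.2 - stepDrift w m r q

theorem continuous_posteriorMean [Nonempty (Fin K)] (hw : ∀ a, 0 < w a) (m : Fin K → E d)
    (r : ℝ) : Continuous (posteriorMean w m r) :=
  continuous_wmean (continuous_softmax hw fun a => by unfold expo; fun_prop)

theorem continuous_stepLogRatio [Nonempty (Fin K)] (hw : ∀ a, 0 < w a) (m : Fin K → E d)
    (r : ℝ) : Continuous (stepLogRatio w m r) := by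
  have h1 : Continuous fun q : E d × E d => posteriorMean w m r (bridgePoint r q.1 q.2) :=
    (continuous_posteriorMean hw m r).comp (by unfold bridgePoint; fun_prop)
  refine ((continuous_bridgeLog hw m 1).sub (continuous_bridgeLog hw m r)).sub ?_
  unfold stepDrift
  exact (h1.inner (by unfold bridgePoint; fun_prop)).sub (by fun_prop)

theorem bridgePoint_one (y W : E d) : bridgePoint 1 y W = y := by simp [bridgePoint]

theorem measurable_exactStep_map [Nonempty (Fin K)] (hw : ∀ a, 0 < w a) (m : Fin K → E d)
    (r : ℝ) : Measurable fun p : E d × E d => Real.sqrt r • p.1 +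
      (1 - r) • posteriorMean w m r (Real.sqrt r • p.1) + Real.sqrt (1 - r) • p.2 := by
  have := (continuous_posteriorMean hw m r).comp
    (by fun_prop : Continuous fun p : E d × E d => Real.sqrt r • p.1)
  simp only [Function.comp_def] at this
  exact Continuous.measurable (by fun_prop)

/-- The exact step has the density `exp (-stepLogRatio)` on path space with respect to the law of
the reversed noising step. -/
theorem lintegral_exactStep [Nonempty (Fin K)] (hw : ∀ a, 0 < w a) (m : Fin K → E d)
    {r : ℝ} (h0 : 0 < r) (h1 : r < 1) {f : E d → ENNReal} (hf : Measurable f) :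
    ∫⁻ x, f x ∂(exactStep w m r) =
      ∫⁻ q, ENNReal.ofReal (Real.exp (-stepLogRatio w m r q)) * f q.1
        ∂((gmm w m).prod (stdGaussian (E d))) := by
  have hM := (continuous_posteriorMean hw m r).comp
    (by fun_prop : Continuous fun x : E d => Real.sqrt r • x)
  simp only [Function.comp_def] at hM
  have hZc : Continuous fun x : E d => partition w (expo m r (Real.sqrt r • x)) :=
    continuous_partition fun a => by unfold expo; fun_prop
  have hmap := measurable_exactStep_map hw m r
  have hgm : Measurable fun q : E d × E d =>
      ENNReal.ofReal (Real.exp (-stepLogRatio w m r q)) * f q.1 :=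
    ((continuous_stepLogRatio hw m r).neg.rexp.measurable.ennreal_ofReal).mul
      (hf.comp measurable_fst)
  have hfm : Measurable fun p : E d × E d => f (Real.sqrt r • p.1 +
      (1 - r) • posteriorMean w m r (Real.sqrt r • p.1) + Real.sqrt (1 - r) • p.2) := hf.comp hmap
  rw [exactStep, lintegral_map hf hmap, lintegral_prod _ hfm.aemeasurable,
    lintegral_gmm_sqrt_smul hw m h0.le hfm.lintegral_prod_right']
  have e1 : ∀ x : E d, ENNReal.ofReal (partition w (expo m r (Real.sqrt r • x))) *
      ∫⁻ z, f (Real.sqrt r • x + (1 - r) • posteriorMean w m r (Real.sqrt r • x) +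
        Real.sqrt (1 - r) • z) ∂(stdGaussian (E d)) =
      ∫⁻ z, ENNReal.ofReal (partition w (expo m r (Real.sqrt r • x))) *
        f (Real.sqrt r • x + (1 - r) • posteriorMean w m r (Real.sqrt r • x) +
        Real.sqrt (1 - r) • z) ∂(stdGaussian (E d)) := fun x =>
    (lintegral_const_mul _ (hf.comp (by fun_prop))).symm
  simp only []
  simp_rw [e1]
  rw [lintegral_gaussian_exchange h0 (by linarith : 0 < 1 - r) (by ring)
    (M := fun x => posteriorMean w m r (Real.sqrt r • x)) hM.measurable
    (F := fun x y => ENNReal.ofReal (partition w (expo m r (Real.sqrt r • x))) * f y)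
    ((hZc.comp continuous_fst).measurable.ennreal_ofReal.mul (hf.comp measurable_snd))]
  have hone : (gmm w m) = gmm w fun k => Real.sqrt 1 • m k := by simp
  rw [lintegral_prod _ hgm.aemeasurable]
  conv_rhs => rw [hone]
  rw [lintegral_gmm_sqrt_smul hw m zero_le_one hgm.lintegral_prod_right']
  refine lintegral_congr fun y => ?_
  have hgy : Measurable fun z : E d =>
      ENNReal.ofReal (Real.exp (-stepLogRatio w m r (y, z))) * f (y, z).1 :=
    hgm.comp (by fun_prop : Measurable fun z : E d => (y, z))
  rw [← lintegral_const_mul _ hgy]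
  refine lintegral_congr fun z => ?_
  have hu : Real.sqrt r • (Real.sqrt r • y + Real.sqrt (1 - r) • z) = bridgePoint r y z := by
    rw [bridgePoint, smul_add, smul_smul, smul_smul, Real.mul_self_sqrt h0.le, Real.sqrt_mul h0.le]
  simp only [hu, Real.sqrt_one, one_smul]
  rw [← mul_assoc, ← mul_assoc, ← ENNReal.ofReal_mul (Real.exp_pos _).le,
    ← ENNReal.ofReal_mul (partition_pos hw _).le]
  congr 2
  rw [stepLogRatio, bridgeLog, bridgeLog, bridgePoint_one, stepDrift]
  have hZ1 := partition_pos hw (expo m 1 y)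
  have hZr := partition_pos hw (expo m r (bridgePoint r y z))
  simp only []
  generalize inner ℝ (posteriorMean w m r (bridgePoint r y z)) (y - bridgePoint r y z) -
    (1 - r) * ‖posteriorMean w m r (bridgePoint r y z)‖ ^ 2 / 2 = D
  rw [show ∀ a b : ℝ, -(a - b - D) = D + b - a by intros; ring, Real.exp_sub, Real.exp_add,
    Real.exp_log hZ1, Real.exp_log hZr]
  field_simp

theorem abs_inner_sub_bridgePoint_le {B r : ℝ} (h0 : 0 ≤ r) (h1 : r ≤ 1) {v : E d}
    (hv : ‖v‖ ≤ B) (q : E d × E d) :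
    |inner ℝ v (q.1 - bridgePoint r q.1 q.2)| ≤ B * envelope q := by
  have hB : 0 ≤ B := (norm_nonneg v).trans hv
  have e : q.1 - bridgePoint r q.1 q.2 = (1 - r) • q.1 - Real.sqrt (r * (1 - r)) • q.2 := by
    unfold bridgePoint; module
  have hs : Real.sqrt (r * (1 - r)) ≤ 1 := by
    exact Real.sqrt_le_iff.2 ⟨zero_le_one, by nlinarith⟩
  have hn : ‖q.1 - bridgePoint r q.1 q.2‖ ≤ (1 + ‖q.1‖) * (1 + ‖q.2‖) := by
    rw [e]
    refine (norm_sub_le _ _).trans ?_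
    rw [norm_smul, norm_smul, Real.norm_of_nonneg (by linarith : 0 ≤ 1 - r),
      Real.norm_of_nonneg (Real.sqrt_nonneg _)]
    have := norm_nonneg q.1
    have := norm_nonneg q.2
    nlinarith [mul_nonneg (norm_nonneg q.1) (norm_nonneg q.2)]
  have h2 := mul_le_envelope (i := 1) (j := 1) (by norm_num) (by norm_num) q
  rw [pow_one, pow_one] at h2
  exact (abs_real_inner_le_norm _ _).trans
    (mul_le_mul hv (hn.trans h2) (norm_nonneg _) hB)

theorem abs_stepDrift_le [Nonempty (Fin K)] (hw : ∀ a, 0 < w a) (m : Fin K → E d)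
    {r : ℝ} (h0 : 0 ≤ r) (h1 : r ≤ 1) :
    ∃ c, ∀ q : E d × E d, |stepDrift w m r q| ≤ c * envelope q := by
  set B := 1 + ∑ b, ‖m b‖ with hB
  refine ⟨B + B ^ 2, fun q => ?_⟩
  have hM : ‖posteriorMean w m r (bridgePoint r q.1 q.2)‖ ≤ B :=
    norm_wmean_le (fun a => (softmax_pos hw _ a).le) (sum_softmax hw _) (norm_le_one_add_sum m)
  have e1 := abs_inner_sub_bridgePoint_le h0 h1 hM q
  have e2 : |(1 - r) * ‖posteriorMean w m r (bridgePoint r q.1 q.2)‖ ^ 2 / 2| ≤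
      B ^ 2 * envelope q := by
    have := pow_le_pow_left₀ (norm_nonneg _) hM 2
    rw [abs_of_nonneg (by have : 0 ≤ 1 - r := by linarith
                          positivity)]
    have := one_le_envelope q
    nlinarith [sq_nonneg ‖posteriorMean w m r (bridgePoint r q.1 q.2)‖, sq_nonneg B]
  refine (abs_sub _ _).trans ?_
  linarith

/-- Given the endpoint, the linear term of the drift is integrated by parts, so the mean drift is the
first-order Taylor term of the mean log-partition function. -/
theorem integral_mul_stepDrift [Nonempty (Fin K)] (hw : ∀ a, 0 < w a) (m : Fin K → E d)
    {Q : Measure (E d)} [IsProbabilityMeasure Q] (hQ : Integrable (fun y => ‖y‖ ^ 2) Q)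
    {g : E d → ℝ} (hg : Measurable g) (hg1 : ∀ y, |g y| ≤ 1) {r : ℝ} (h0 : 0 ≤ r) (h1 : r ≤ 1) :
    ∫ q, g q.1 * stepDrift w m r q ∂(Q.prod (stdGaussian (E d))) =
      (1 - r) * ∫ q, g q.1 * bridgeDeriv r q.1 m (bridgePost w m r q.1 q.2)
        ∂(Q.prod (stdGaussian (E d))) := by
  set B := 1 + ∑ b, ‖m b‖ with hB
  have hB1 : 1 ≤ B := one_le_one_add_sum m
  have hmB := norm_le_one_add_sum m
  set σ := Real.sqrt (r * (1 - r)) with hσ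
  have hpc := continuous_bridgePost hw m r
  have i1 : Integrable (fun q : E d × E d => g q.1 *
      bridgeDeriv r q.1 m (bridgePost w m r q.1 q.2)) (Q.prod (stdGaussian (E d))) := by
    refine integrable_mul_of_abs_le hQ hg hg1 (continuous_bridgeDeriv hpc r continuous_fst)
      (c := 8 * B ^ 2) fun q => ?_
    exact (abs_bridgeDeriv_le (bridgePost_nonneg hw m r _ _) (sum_bridgePost hw m r _ _) hmB hB1
      h0 h1 _).trans (mul_le_mul_of_nonneg_left (one_add_norm_le_envelope q) (by positivity))
  have i2 : Integrable (fun q : E d × E d => g q.1 *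
      (σ * wvar (bridgePost w m r q.1 q.2) m)) (Q.prod (stdGaussian (E d))) := by
    refine integrable_mul_of_abs_le hQ hg hg1 (continuous_const.mul (continuous_wvar hpc))
      (c := σ * (4 * B ^ 2)) fun q => ?_
    have hσ0 : 0 ≤ σ := Real.sqrt_nonneg _
    have hv0 := wvar_nonneg (m := m) (bridgePost_nonneg hw m r q.1 q.2)
    have hv := wvar_le (bridgePost_nonneg hw m r q.1 q.2) (sum_bridgePost hw m r _ _) hmB
    rw [abs_of_nonneg (mul_nonneg hσ0 hv0)]
    have := one_le_envelope q
    calc _ ≤ σ * (4 * B ^ 2) * 1 := by rw [mul_one]; exact mul_le_mul_of_nonneg_left hv hσ0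
      _ ≤ _ := mul_le_mul_of_nonneg_left this (by positivity)
  have i3 : Integrable (fun q : E d × E d => g q.1 *
      ∑ a, bridgePost w m r q.1 q.2 a * inner ℝ q.2 (m a)) (Q.prod (stdGaussian (E d))) := by
    refine integrable_mul_sum_mul_inner hQ hg hg1 m hpc (c := 1) fun a q => ?_
    rw [abs_of_nonneg (bridgePost_nonneg hw m r _ _ a), one_mul]
    have : bridgePost w m r q.1 q.2 a ≤ 1 := softmax_le_one hw _ a
    linarith [norm_nonneg q.1]
  have e : ∀ q : E d × E d, g q.1 * stepDrift w m r q =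
      (1 - r) * (g q.1 * bridgeDeriv r q.1 m (bridgePost w m r q.1 q.2)) +
      σ * (g q.1 * (σ * wvar (bridgePost w m r q.1 q.2) m)) -
      σ * (g q.1 * ∑ a, bridgePost w m r q.1 q.2 a * inner ℝ q.2 (m a)) := by
    intro q
    have hs : σ * σ = r * (1 - r) := Real.mul_self_sqrt (by nlinarith)
    have hsum : ∑ a, bridgePost w m r q.1 q.2 a * inner ℝ q.2 (m a) =
        inner ℝ q.2 (wmean (bridgePost w m r q.1 q.2) m) := by
      simp_rw [← inner_smul_right]
      rw [← inner_sum]; rfl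
    rw [hsum]
    unfold stepDrift bridgeDeriv
    have hv : q.1 - bridgePoint r q.1 q.2 = (1 - r) • q.1 - σ • q.2 := by
      unfold bridgePoint; module
    change g q.1 * (inner ℝ (wmean (bridgePost w m r q.1 q.2) m) (q.1 - bridgePoint r q.1 q.2) -
      (1 - r) * ‖wmean (bridgePost w m r q.1 q.2) m‖ ^ 2 / 2) = _
    rw [hv, inner_sub_right, inner_smul_right, inner_smul_right, real_inner_comm,
      real_inner_comm q.2]
    linear_combination -(g q.1 * wvar (bridgePost w m r q.1 q.2) m) * hs
  have i12 : Integrable (fun q : E d × E d =>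
      (1 - r) * (g q.1 * bridgeDeriv r q.1 m (bridgePost w m r q.1 q.2)) +
      σ * (g q.1 * (σ * wvar (bridgePost w m r q.1 q.2) m))) (Q.prod (stdGaussian (E d))) :=
    (i1.const_mul _).add (i2.const_mul _)
  simp_rw [e]
  rw [integral_sub i12 (i3.const_mul _),
    integral_add (i1.const_mul _) (i2.const_mul _), integral_const_mul, integral_const_mul,
    integral_const_mul, integral_mul_sum_bridgePost hw m hQ hg hg1 r]
  ring

/-- The mean log-likelihood ratio of one step on an event of the endpoint is of second order in
the step size. -/
theorem abs_integral_mul_stepLogRatio_le (hw : ∀ a, 0 < w a) (hw1 : ∑ a, w a = 1)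
    (m : Fin K → E d) {g : E d → ℝ} (hg : Measurable g) (hg1 : ∀ y, |g y| ≤ 1) {r : ℝ}
    (hr : 1 / 2 ≤ r) (h1 : r < 1) :
    |∫ q, g q.1 * stepLogRatio w m r q ∂((gmm w m).prod (stdGaussian (E d)))| ≤
      60000 * (1 + Real.log K) ^ 2 * (1 - r) ^ 2 := by
  have := nonempty_of_sum_eq_one hw1
  have := isProbabilityMeasure_gmm hw hw1 m
  have hQ := integrable_norm_sq_gmm w m
  have h0 : 0 < r := by linarith
  obtain ⟨c, hc⟩ := exists_abs_bridgeLog_le hw hw1 m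
  obtain ⟨c', hc'⟩ := abs_stepDrift_le hw m h0.le h1.le
  have i1 : ∀ t ∈ Set.Icc (0 : ℝ) 1, Integrable (fun q => g q.1 * bridgeLog w m t q.1 q.2)
      ((gmm w m).prod (stdGaussian (E d))) := fun t ht =>
    integrable_mul_of_abs_le hQ hg hg1 (continuous_bridgeLog hw m t) (hc t ht)
  have hdc : Continuous (stepDrift w m r) := by
    have h1 : Continuous fun q : E d × E d => posteriorMean w m r (bridgePoint r q.1 q.2) :=
      (continuous_posteriorMean hw m r).comp (by unfold bridgePoint; fun_prop)
    exact (h1.inner (by unfold bridgePoint; fun_prop)).sub (by fun_prop)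
  have i2 : Integrable (fun q => g q.1 * stepDrift w m r q)
      ((gmm w m).prod (stdGaussian (E d))) := integrable_mul_of_abs_le hQ hg hg1 hdc hc'
  have e : ∀ q : E d × E d, g q.1 * stepLogRatio w m r q = g q.1 * bridgeLog w m 1 q.1 q.2 -
      g q.1 * bridgeLog w m r q.1 q.2 - g q.1 * stepDrift w m r q := fun q => by
    unfold stepLogRatio; ring
  simp_rw [e]
  have m1 : (1 : ℝ) ∈ Set.Icc (0 : ℝ) 1 := by simp
  have m2 : r ∈ Set.Icc (0 : ℝ) 1 := ⟨h0.le, h1.le⟩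
  have i12 : Integrable (fun q : E d × E d => g q.1 * bridgeLog w m 1 q.1 q.2 -
      g q.1 * bridgeLog w m r q.1 q.2) ((gmm w m).prod (stdGaussian (E d))) :=
    (i1 1 m1).sub (i1 r m2)
  rw [integral_sub i12 i2, integral_sub (i1 1 m1) (i1 r m2),
    integral_mul_stepDrift hw m hQ hg hg1 h0.le h1.le]
  refine abs_taylor_bridgeLog_le hw hw1 m hQ hg hg1 h0 h1 fun t ht => ?_
  have hD : (0 : ℝ) ≤ 60000 * (1 + Real.log K) ^ 2 := by positivity
  have hle := lintegral_bridgeDeriv2_le hw hw1 m (hr.trans ht.1) ht.2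
  rw [← Real.norm_eq_abs]
  have h2 := ENNReal.toReal_mono ENNReal.ofReal_ne_top hle
  rw [ENNReal.toReal_ofReal hD] at h2
  refine (norm_integral_le_lintegral_norm _).trans (le_trans ?_ h2)
  refine ENNReal.toReal_mono (hle.trans_lt ENNReal.ofReal_lt_top).ne (lintegral_mono fun q => ?_)
  refine ENNReal.ofReal_le_ofReal ?_
  rw [norm_mul, Real.norm_eq_abs, Real.norm_eq_abs]
  exact mul_le_of_le_one_left (abs_nonneg _) (hg1 _)

theorem isProbabilityMeasure_exactStep (hw : ∀ a, 0 < w a) (hw1 : ∑ a, w a = 1)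
    (m : Fin K → E d) (r : ℝ) : IsProbabilityMeasure (exactStep w m r) := by
  have := nonempty_of_sum_eq_one hw1
  have := isProbabilityMeasure_gmm hw hw1 fun k => Real.sqrt r • m k
  exact Measure.isProbabilityMeasure_map (measurable_exactStep_map hw m r).aemeasurable

/-- One-sided local error: `1 - exp (-ℓ) ≤ ℓ` for the log-likelihood ratio `ℓ` reduces the
difference of the probabilities of an event to a mean of `ℓ`. -/
theorem gmm_real_sub_exactStep_le (hw : ∀ a, 0 < w a) (hw1 : ∑ a, w a = 1)
    (m : Fin K → E d) {r : ℝ} (hr : 1 / 2 ≤ r) (h1 : r < 1) {A : Set (E d)}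
    (hA : MeasurableSet A) :
    (gmm w m).real A - (exactStep w m r).real A ≤
      60000 * (1 + Real.log K) ^ 2 * (1 - r) ^ 2 := by
  have := nonempty_of_sum_eq_one hw1
  have := isProbabilityMeasure_gmm hw hw1 m
  have := isProbabilityMeasure_exactStep hw hw1 m r
  have h0 : 0 < r := by linarith
  have hQ := integrable_norm_sq_gmm w m
  set P := (gmm w m).prod (stdGaussian (E d)) with hP
  set g : E d → ℝ := A.indicator fun _ => 1 with hg
  have hgm : Measurable g := measurable_const.indicator hA
  have hg0 : ∀ y, 0 ≤ g y := fun y => Set.indicator_nonneg (fun _ _ => zero_le_one) y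
  have hg1 : ∀ y, |g y| ≤ 1 := fun y => by
    rw [abs_of_nonneg (hg0 y)]
    exact Set.indicator_le_self' (fun _ _ => zero_le_one) y
  have hℓm := (continuous_stepLogRatio hw m r).measurable
  have hem : Measurable fun q => Real.exp (-stepLogRatio w m r q) := hℓm.neg.exp
  have htot := lintegral_exactStep hw m h0 h1 (f := fun _ => 1) measurable_const
  simp only [lintegral_const, measure_univ, mul_one] at htot
  have ie : Integrable (fun q => Real.exp (-stepLogRatio w m r q)) P := by
    refine ⟨hem.aestronglyMeasurable, ?_⟩
    rw [hasFiniteIntegral_iff_ofReal (.of_forall fun q => (Real.exp_pos _).le), ← htot]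
    exact ENNReal.one_lt_top
  have hgm' : Measurable fun q : E d × E d => g q.1 := hgm.comp measurable_fst
  have ig : Integrable (fun q : E d × E d => g q.1) P :=
    Integrable.of_bound hgm'.aestronglyMeasurable 1 (.of_forall fun q => hg1 _)
  have ige : Integrable (fun q => g q.1 * Real.exp (-stepLogRatio w m r q)) P :=
    ie.bdd_mul hgm'.aestronglyMeasurable (.of_forall fun q => hg1 _)
  have v1 : (gmm w m).real A = ∫ q, g q.1 ∂P := by
    rw [hP, integral_fun_fst (f := g)]
    simp [hg, integral_indicator hA]
  have v2 : (exactStep w m r).real A = ∫ q, g q.1 * Real.exp (-stepLogRatio w m r q) ∂P := by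
    rw [integral_eq_lintegral_of_nonneg_ae (.of_forall fun q => mul_nonneg (hg0 _)
      (Real.exp_pos _).le) ige.aestronglyMeasurable, Measure.real, ← lintegral_indicator_one hA,
      lintegral_exactStep hw m h0 h1 (measurable_one.indicator hA)]
    congr 1
    refine lintegral_congr fun q => ?_
    rw [mul_comm (g q.1), ENNReal.ofReal_mul (Real.exp_pos _).le]
    congr 1
    by_cases hq : q.1 ∈ A <;> simp [hg, hq]
  have hmain := abs_integral_mul_stepLogRatio_le hw hw1 m hgm hg1 hr h1
  refine le_trans ?_ ((le_abs_self _).trans hmain)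
  rw [v1, v2, ← integral_sub ig ige]
  obtain ⟨c, hc⟩ := exists_abs_bridgeLog_le hw hw1 m
  obtain ⟨c', hc'⟩ := abs_stepDrift_le hw m h0.le h1.le
  refine integral_mono (ig.sub ige) ?_ fun q => ?_
  · refine integrable_mul_of_abs_le hQ hgm hg1 (continuous_stepLogRatio hw m r)
      (c := c + c + c') fun q => ?_
    have e1 := hc 1 (by simp) q
    have e2 := hc r ⟨h0.le, h1.le⟩ q
    have e3 := hc' q
    unfold stepLogRatio
    refine (abs_sub _ _).trans ((add_le_add ((abs_sub _ _).trans (add_le_add e1 e2)) e3).trans ?_)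
    linarith
  · have := Real.add_one_le_exp (-stepLogRatio w m r q)
    have := mul_le_mul_of_nonneg_left this (hg0 q.1)
    simp only []
    linarith

/-- One step of the sampler with the exact score, started from the exact law, has an error in
total variation that is quadratic in the step size and does not depend on the dimension. -/
theorem abs_gmm_real_sub_exactStep_le (hw : ∀ a, 0 < w a) (hw1 : ∑ a, w a = 1)
    (m : Fin K → E d) {r : ℝ} (hr : 1 / 2 ≤ r) (h1 : r < 1) {A : Set (E d)}
    (hA : MeasurableSet A) :
    |(gmm w m).real A - (exactStep w m r).real A| ≤
      60000 * (1 + Real.log K) ^ 2 * (1 - r) ^ 2 := by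
  have := isProbabilityMeasure_gmm hw hw1 m
  have := isProbabilityMeasure_exactStep hw hw1 m r
  have a1 := gmm_real_sub_exactStep_le hw hw1 m hr h1 hA
  have a2 := gmm_real_sub_exactStep_le hw hw1 m hr h1 hA.compl
  rw [probReal_compl_eq_one_sub hA, probReal_compl_eq_one_sub hA] at a2
  exact abs_le.2 ⟨by linarith, a1⟩

end ExactStep

/-! ### The score of the forward process -/

section Score

variable {d : ℕ} {ρ : Measure (E d)} [IsProbabilityMeasure ρ] {a : ℝ}

theorem gaussDensity_le (m : E d) {v : ℝ} (hv : 0 < v) (x : E d) :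
    gaussDensity m v x ≤ (Real.sqrt (2 * Real.pi * v))⁻¹ ^ d := by
  unfold gaussDensity
  refine mul_le_of_le_one_right (by positivity) (Real.exp_le_one_iff.mpr ?_)
  rw [neg_div, neg_nonpos]
  positivity

theorem hasFDerivAt_gaussDensity (m : E d) (v : ℝ) (x : E d) :
    HasFDerivAt (gaussDensity m v) (innerSL ℝ ((gaussDensity m v x * v⁻¹) • (m - x))) x := by
  have h1 : HasFDerivAt (fun x : E d => ‖x - m‖ ^ 2) (2 • innerSL ℝ (x - m)) x := by
    have := (hasFDerivAt_id x).sub_const m |>.norm_sq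
    simpa using this
  have h2 := ((h1.const_mul (-(1 / (2 * v)))).exp).const_mul ((Real.sqrt (2 * Real.pi * v))⁻¹ ^ d)
  have e : gaussDensity m v = fun x : E d => (Real.sqrt (2 * Real.pi * v))⁻¹ ^ d *
      Real.exp (-(1 / (2 * v)) * ‖x - m‖ ^ 2) := by
    funext x
    unfold gaussDensity
    congr 2
    ring
  rw [e]
  refine h2.congr_fderiv ?_
  ext y
  simp only [smul_apply, innerSL_apply_apply, inner_smul_left, smul_eq_mul,
    conj_trivial, nsmul_eq_mul, inner_sub_left]
  by_cases hv : v = 0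
  · simp [hv]
  · field_simp
    push_cast
    ring

theorem norm_gaussDensity_smul_le (m : E d) {v : ℝ} (hv : 0 < v) (x : E d) :
    ‖(gaussDensity m v x * v⁻¹) • (m - x)‖ ≤
      (Real.sqrt (2 * Real.pi * v))⁻¹ ^ d * (Real.sqrt v)⁻¹ := by
  rw [norm_smul, Real.norm_of_nonneg (mul_nonneg (gaussDensity_nonneg _ _ _) (by positivity)),
    norm_sub_rev, gaussDensity]
  set t := ‖x - m‖ with ht
  have hs : 0 < Real.sqrt v := Real.sqrt_pos.2 hv
  have hsq : Real.sqrt v ^ 2 = v := Real.sq_sqrt hv.le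
  have h1 : t / Real.sqrt v ≤ Real.exp (t ^ 2 / (2 * v)) := by
    have h2 := Real.add_one_le_exp (t ^ 2 / (2 * v))
    have h3 : t ^ 2 / (2 * v) = (t / Real.sqrt v) ^ 2 / 2 := by rw [div_pow, hsq]; field_simp
    nlinarith [sq_nonneg (t / Real.sqrt v - 1)]
  have h4 : Real.exp (-t ^ 2 / (2 * v)) * (t / Real.sqrt v) ≤ 1 := by
    rw [neg_div, Real.exp_neg]
    exact inv_mul_le_one_of_le₀ h1 (Real.exp_pos _).le
  have h5 : (Real.sqrt (2 * Real.pi * v))⁻¹ ^ d * Real.exp (-t ^ 2 / (2 * v)) * v⁻¹ * t =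
      ((Real.sqrt (2 * Real.pi * v))⁻¹ ^ d * (Real.sqrt v)⁻¹) *
        (Real.exp (-t ^ 2 / (2 * v)) * (t / Real.sqrt v)) := by
    have : v⁻¹ = (Real.sqrt v)⁻¹ * (Real.sqrt v)⁻¹ := by
      rw [← mul_inv, Real.mul_self_sqrt hv.le]
    rw [this]; ring
  rw [h5]
  exact mul_le_of_le_one_right (by positivity) h4

/-- The gradient of the density of the forward process. -/
def gradDensity (ρ : Measure (E d)) (a : ℝ) (x : E d) : E d :=
  ∫ x₀, (gaussDensity (Real.sqrt a • x₀) (1 - a) x * (1 - a)⁻¹) • (Real.sqrt a • x₀ - x) ∂ρ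

theorem integrable_gaussDensity_sqrt_smul (ρ : Measure (E d)) [IsFiniteMeasure ρ] (ha : a < 1)
    (x : E d) : Integrable (fun x₀ => gaussDensity (Real.sqrt a • x₀) (1 - a) x) ρ := by
  refine Integrable.of_bound (C := (Real.sqrt (2 * Real.pi * (1 - a)))⁻¹ ^ d)
    (Measurable.aestronglyMeasurable (by unfold gaussDensity; fun_prop)) (.of_forall fun x₀ => ?_)
  rw [Real.norm_of_nonneg (gaussDensity_nonneg _ _ _)]
  exact gaussDensity_le _ (by linarith) _

theorem integrable_gaussDensity_sqrt_smul_smul (ρ : Measure (E d)) [IsFiniteMeasure ρ]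
    (ha : a < 1) (x : E d) : Integrable (fun x₀ =>
      (gaussDensity (Real.sqrt a • x₀) (1 - a) x * (1 - a)⁻¹) • (Real.sqrt a • x₀ - x)) ρ := by
  refine Integrable.of_bound (C := (Real.sqrt (2 * Real.pi * (1 - a)))⁻¹ ^ d *
    (Real.sqrt (1 - a))⁻¹)
    (Measurable.aestronglyMeasurable (by unfold gaussDensity; fun_prop)) (.of_forall fun x₀ => ?_)
  exact norm_gaussDensity_smul_le _ (by linarith) _

theorem hasFDerivAt_forwardDensity (ρ : Measure (E d)) [IsFiniteMeasure ρ] (ha : a < 1)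
    (x : E d) :
    HasFDerivAt (forwardDensity ρ a) (innerSL ℝ (gradDensity ρ a x)) x := by
  have hi := integrable_gaussDensity_sqrt_smul_smul ρ ha x
  rw [gradDensity, ← ContinuousLinearMap.integral_comp_comm (innerSL ℝ) hi]
  refine hasFDerivAt_integral_of_dominated_of_fderiv_le (s := Set.univ) Filter.univ_mem
    (F' := fun x x₀ => innerSL ℝ
      ((gaussDensity (Real.sqrt a • x₀) (1 - a) x * (1 - a)⁻¹) • (Real.sqrt a • x₀ - x)))
    (bound := fun _ => (Real.sqrt (2 * Real.pi * (1 - a)))⁻¹ ^ d * (Real.sqrt (1 - a))⁻¹)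
    (.of_forall fun y => (integrable_gaussDensity_sqrt_smul ρ ha y).aestronglyMeasurable)
    (integrable_gaussDensity_sqrt_smul ρ ha x)
    ((innerSL ℝ).continuous.comp_aestronglyMeasurable hi.aestronglyMeasurable)
    (.of_forall fun x₀ y _ => ?_) (integrable_const _) (.of_forall fun x₀ y _ => ?_)
  · rw [innerSL_apply_norm]
    exact norm_gaussDensity_smul_le _ (by linarith) _
  · exact hasFDerivAt_gaussDensity _ _ _

theorem continuous_forwardDensity (ρ : Measure (E d)) [IsFiniteMeasure ρ] (ha : a < 1) :
    Continuous (forwardDensity ρ a) :=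
  continuous_iff_continuousAt.2 fun x => (hasFDerivAt_forwardDensity ρ ha x).continuousAt

theorem forwardDensity_pos (ha : a < 1) (x : E d) : 0 < forwardDensity ρ a x := by
  unfold forwardDensity
  rw [integral_pos_iff_support_of_nonneg (fun x₀ => gaussDensity_nonneg _ _ _)
    (integrable_gaussDensity_sqrt_smul ρ ha x)]
  have : Function.support (fun x₀ : E d => gaussDensity (Real.sqrt a • x₀) (1 - a) x) =
      Set.univ := Set.eq_univ_of_forall fun x₀ =>
    (gaussDensity_pos _ (by linarith : 0 < 1 - a) x).ne'
  rw [this, measure_univ]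
  exact one_pos

/-- The score is the posterior mean of `(√a X₀ - x) / (1 - a)`. -/
theorem score_eq (ha : a < 1) (x : E d) :
    score ρ a x = (forwardDensity ρ a x)⁻¹ • gradDensity ρ a x := by
  have h := (hasFDerivAt_forwardDensity ρ ha x).log (forwardDensity_pos ha x).ne'
  refine HasGradientAt.gradient ?_
  rw [hasGradientAt_iff_hasFDerivAt]
  refine h.congr_fderiv ?_
  ext y
  simp

theorem measurable_gradDensity (ρ : Measure (E d)) [IsFiniteMeasure ρ] (a : ℝ) :
    Measurable (gradDensity ρ a) := by
  unfold gradDensity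
  refine StronglyMeasurable.measurable ?_
  refine StronglyMeasurable.integral_prod_right (f := fun x x₀ =>
    (gaussDensity (Real.sqrt a • x₀) (1 - a) x * (1 - a)⁻¹) • (Real.sqrt a • x₀ - x)) ?_
  refine Measurable.stronglyMeasurable ?_
  unfold Function.uncurry gaussDensity
  fun_prop

theorem measurable_score (ha : a < 1) : Measurable (score ρ a) := by
  have : score ρ a = fun x => (forwardDensity ρ a x)⁻¹ • gradDensity ρ a x :=
    funext fun x => score_eq ha x
  rw [this]
  exact ((continuous_forwardDensity ρ ha).measurable.inv).smul (measurable_gradDensity ρ a)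

theorem isProbabilityMeasure_forwardLaw (ρ : Measure (E d)) [IsProbabilityMeasure ρ] (a : ℝ) :
    IsProbabilityMeasure (forwardLaw ρ a) :=
  Measure.isProbabilityMeasure_map (by fun_prop)

theorem lintegral_forwardLaw (ha : a < 1) {f : E d → ENNReal} (hf : Measurable f) :
    ∫⁻ x, f x ∂(forwardLaw ρ a) = ∫⁻ x, ENNReal.ofReal (forwardDensity ρ a x) * f x := by
  rw [forwardLaw_eq_withDensity ρ ha, lintegral_withDensity_eq_lintegral_mul _
    (continuous_forwardDensity ρ ha).measurable.ennreal_ofReal hf]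
  rfl

end Score

section MixtureScore

variable {K d : ℕ} {w : Fin K → ℝ} {μ : Fin K → E d} {a : ℝ}

/-- A mixture of Gaussians with identity covariance keeps its shape along the forward process. -/
theorem forwardLaw_gmm (w : Fin K → ℝ) (hw1 : ∑ k, w k = 1) (hw : ∀ k, 0 < w k) (μ : Fin K → E d)
    (h0 : 0 ≤ a) (h1 : a < 1) :
    forwardLaw (gmm w μ) a = gmm w fun k => Real.sqrt a • μ k := by
  have := isProbabilityMeasure_gmm hw hw1 μ
  refine Measure.ext_of_lintegral _ fun f hf => ?_
  have hm : Measurable fun p : E d × E d => f (Real.sqrt a • p.1 + Real.sqrt (1 - a) • p.2) :=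
    hf.comp (by fun_prop)
  rw [forwardLaw, lintegral_map hf (by fun_prop), lintegral_prod _ hm.aemeasurable,
    lintegral_gmm _ _ hm.lintegral_prod_right', lintegral_gmm _ _ hf]
  refine Finset.sum_congr rfl fun k _ => ?_
  congr 1
  rcases h0.eq_or_lt with rfl | h0
  · simp
  have := lintegral_gaussian_exchange h0 (by linarith : 0 < 1 - a) (by ring) (M := fun _ => 0)
    measurable_const (F := fun _ y => f (Real.sqrt a • μ k + y))
    (by unfold Function.uncurry; exact hf.comp (by fun_prop))
  simp only [smul_zero, add_zero, inner_zero_left, norm_zero] at this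
  norm_num at this
  rw [← this]
  refine lintegral_congr fun y => lintegral_congr fun z => ?_
  rw [smul_add, add_assoc]

/-- The density of the mixture of the `N(√a μ_k, I)`, relative to that of `N(0, I)`. -/
theorem forwardDensity_gmm (hw : ∀ k, 0 < w k) (hw1 : ∑ k, w k = 1) (μ : Fin K → E d)
    (h0 : 0 ≤ a) (h1 : a < 1) (x : E d) :
    forwardDensity (gmm w μ) a x =
      gaussDensity 0 1 x * partition w (expo μ a (Real.sqrt a • x)) := by
  have := isProbabilityMeasure_gmm hw hw1 μ
  have := nonempty_of_sum_eq_one hw1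
  have hc1 := continuous_forwardDensity (gmm w μ) h1
  have hZ : Continuous fun x : E d => partition w (expo μ a (Real.sqrt a • x)) :=
    continuous_partition fun k => by unfold expo; fun_prop
  have hc2 : Continuous fun x : E d =>
      gaussDensity 0 1 x * partition w (expo μ a (Real.sqrt a • x)) :=
    Continuous.mul (by unfold gaussDensity; fun_prop) hZ
  have hmeas : volume.withDensity (fun x => ENNReal.ofReal (forwardDensity (gmm w μ) a x)) =
      volume.withDensity (fun x => ENNReal.ofReal
        (gaussDensity 0 1 x * partition w (expo μ a (Real.sqrt a • x)))) := by
    rw [← forwardLaw_eq_withDensity _ h1, forwardLaw_gmm w hw1 hw μ h0 h1]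
    refine Measure.ext_of_lintegral _ fun f hf => ?_
    have hZf : Measurable fun x : E d =>
        ENNReal.ofReal (partition w (expo μ a (Real.sqrt a • x))) * f x :=
      hZ.measurable.ennreal_ofReal.mul hf
    rw [lintegral_gmm_sqrt_smul hw μ h0 hf, lintegral_stdGaussian hZf,
      lintegral_withDensity_eq_lintegral_mul _ hc2.measurable.ennreal_ofReal hf]
    refine lintegral_congr fun y => ?_
    simp only [Pi.mul_apply]
    rw [ENNReal.ofReal_mul (gaussDensity_nonneg _ _ _), mul_assoc]
  have hfin : ∫⁻ x, ENNReal.ofReal (forwardDensity (gmm w μ) a x) ≠ ⊤ := by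
    have := isProbabilityMeasure_forwardLaw (gmm w μ) a
    have e : ∫⁻ x, ENNReal.ofReal (forwardDensity (gmm w μ) a x) = forwardLaw (gmm w μ) a .univ := by
      rw [forwardLaw_eq_withDensity _ h1, withDensity_apply _ .univ, setLIntegral_univ]
    rw [e, measure_univ]
    exact ENNReal.one_ne_top
  rw [withDensity_eq_iff hc1.measurable.ennreal_ofReal.aemeasurable
    hc2.measurable.ennreal_ofReal.aemeasurable hfin] at hmeas
  have hae : forwardDensity (gmm w μ) a =ᵐ[volume] fun x =>
      gaussDensity 0 1 x * partition w (expo μ a (Real.sqrt a • x)) := by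
    filter_upwards [hmeas] with x hx
    rwa [ENNReal.ofReal_eq_ofReal_iff (forwardDensity_pos h1 x).le
      (mul_nonneg (gaussDensity_nonneg _ _ _) (partition_pos hw _).le)] at hx
  exact congrFun ((Continuous.ae_eq_iff_eq volume hc1 hc2).1 hae) x

theorem hasFDerivAt_log_partition [Nonempty (Fin K)] (hw : ∀ k, 0 < w k) (μ : Fin K → E d)
    (a c : ℝ) (x : E d) :
    HasFDerivAt (fun x : E d => Real.log (partition w (expo μ a (c • x))))
      (innerSL ℝ (c • posteriorMean w μ a (c • x))) x := by
  have h1 : ∀ k, HasFDerivAt (fun x : E d => w k * Real.exp (expo μ a (c • x) k))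
      (w k • (Real.exp (expo μ a (c • x) k) • (c • innerSL ℝ (μ k)))) x := by
    intro k
    have : HasFDerivAt (fun x : E d => expo μ a (c • x) k) (c • innerSL ℝ (μ k)) x := by
      have h := ((c • innerSL ℝ (μ k)).hasFDerivAt (x := x)).sub_const (a * ‖μ k‖ ^ 2 / 2)
      refine h.congr_of_eventuallyEq (.of_forall fun y => ?_)
      simp [expo, inner_smul_left, real_inner_comm]
    exact this.exp.const_mul (w k)
  have h2 := (HasFDerivAt.fun_sum (u := Finset.univ) fun k _ => h1 k).log
    (partition_pos hw (expo μ a (c • x))).ne'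
  refine h2.congr_fderiv ?_
  ext y
  simp only [smul_apply, sum_apply, innerSL_apply_apply,
    smul_eq_mul, posteriorMean, wmean, inner_smul_left, sum_inner, conj_trivial]
  rw [Finset.mul_sum, Finset.mul_sum]
  refine Finset.sum_congr rfl fun k _ => ?_
  unfold softmax partition
  ring

theorem score_gmm (hw : ∀ k, 0 < w k) (hw1 : ∑ k, w k = 1) (μ : Fin K → E d)
    (h0 : 0 ≤ a) (h1 : a < 1) (x : E d) :
    score (gmm w μ) a x = -x + Real.sqrt a • posteriorMean w μ a (Real.sqrt a • x) := by
  have := nonempty_of_sum_eq_one hw1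
  refine HasGradientAt.gradient ?_
  rw [hasGradientAt_iff_hasFDerivAt]
  have e : (fun y => Real.log (forwardDensity (gmm w μ) a y)) = fun y =>
      Real.log ((Real.sqrt (2 * Real.pi * 1))⁻¹ ^ d) + -(1 / 2) * ‖y‖ ^ 2 +
        Real.log (partition w (expo μ a (Real.sqrt a • y))) := by
    funext y
    rw [forwardDensity_gmm hw hw1 μ h0 h1, Real.log_mul (gaussDensity_pos _ one_pos _).ne'
      (partition_pos hw _).ne', gaussDensity, Real.log_mul (by positivity) (Real.exp_pos _).ne',
      Real.log_exp, sub_zero]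
    ring
  rw [e]
  have h2 : HasFDerivAt (fun x : E d => ‖x‖ ^ 2) (2 • innerSL ℝ x) x := by
    simpa using (hasFDerivAt_id x).norm_sq
  refine (((h2.const_mul (-(1 / 2))).const_add _).add
    (hasFDerivAt_log_partition hw μ a (Real.sqrt a) x)).congr_fderiv ?_
  ext y
  simp only [add_apply, smul_apply, innerSL_apply_apply,
    InnerProductSpace.toDual_apply_apply, inner_add_left, inner_neg_left, smul_eq_mul,
    nsmul_eq_mul]
  push_cast
  ring

/-- The sampler step with the exact score, started from the exact law, is the step whose error
is bounded in `abs_gmm_real_sub_exactStep_le`. -/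
theorem ddpmStep_score_gmm (hw : ∀ k, 0 < w k) (hw1 : ∑ k, w k = 1) (μ : Fin K → E d) {r b : ℝ}
    (hr : 0 < r) (hb : 0 < b) (h1 : r * b < 1) :
    ddpmStep r (score (gmm w μ) (r * b)) (forwardLaw (gmm w μ) (r * b)) =
      exactStep w (fun k => Real.sqrt b • μ k) r := by
  have hs : Real.sqrt (r * b) = Real.sqrt r * Real.sqrt b := Real.sqrt_mul hr.le b
  rw [forwardLaw_gmm w hw1 hw μ (by positivity) h1, ddpmStep, exactStep]
  have e1 : (fun k => Real.sqrt (r * b) • μ k) = fun k => Real.sqrt r • Real.sqrt b • μ k := by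
    funext k; rw [hs, mul_smul]
  rw [e1]
  congr 1
  funext p
  have hexpo : ∀ x : E d, expo (fun k => Real.sqrt b • μ k) r (Real.sqrt r • x) =
      expo μ (r * b) (Real.sqrt (r * b) • x) := by
    intro x
    funext k
    simp only [expo, hs, inner_smul_left, inner_smul_right, norm_smul, mul_pow, conj_trivial]
    rw [Real.norm_of_nonneg (Real.sqrt_nonneg b), Real.sq_sqrt hb.le]
    ring
  have hmean : posteriorMean w (fun k => Real.sqrt b • μ k) r (Real.sqrt r • p.1) =
      Real.sqrt b • posteriorMean w μ (r * b) (Real.sqrt (r * b) • p.1) := by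
    unfold posteriorMean wmean
    rw [hexpo, Finset.smul_sum]
    exact Finset.sum_congr rfl fun k _ => smul_comm _ _ _
  rw [score_gmm hw hw1 μ (by positivity) h1, hmean]
  congr 1
  have hsr : Real.sqrt r ≠ 0 := (Real.sqrt_pos.2 hr).ne'
  have hsr2 : Real.sqrt r * Real.sqrt r = r := Real.mul_self_sqrt hr.le
  generalize posteriorMean w μ (r * b) (Real.sqrt (r * b) • p.1) = M
  rw [hs]
  have e2 : p.1 + (1 - r) • (-p.1 + (Real.sqrt r * Real.sqrt b) • M) =
      r • p.1 + ((1 - r) * (Real.sqrt r * Real.sqrt b)) • M := by module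
  rw [e2, smul_add, smul_smul, smul_smul, smul_smul]
  congr 2
  · field_simp; nlinarith
  · field_simp

end MixtureScore

/-! ### Propagation of the divergence along a chain of Gaussian steps -/

section Divergence

open InformationTheory

variable {α : Type*} [MeasurableSpace α]

/-- Passing to sub-measures with a common density at most one does not increase the divergence: with
Mathlib's `klDiv` of finite measures, the integrand `klFun` of the ratio is nonnegative and the
ratio does not change. -/
theorem klDiv_withDensity_le {ν ν' : Measure α} [IsFiniteMeasure ν] [IsFiniteMeasure ν']
    {g : α → ENNReal} (hg : Measurable g) (hg1 : ∀ x, g x ≤ 1) :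
    klDiv (ν.withDensity g) (ν'.withDensity g) ≤ klDiv ν ν' := by
  by_cases hac : ν ≪ ν'
  swap
  · rw [klDiv_of_not_ac hac]; exact le_top
  have hle : ∀ κ : Measure α, κ.withDensity g ≤ κ := fun κ => by
    conv_rhs => rw [← withDensity_one (μ := κ)]
    exact withDensity_mono (.of_forall hg1)
  have := isFiniteMeasure_of_le ν (hle ν)
  have := isFiniteMeasure_of_le ν' (hle ν')
  have e : ν.withDensity g = (ν'.withDensity g).withDensity (ν.rnDeriv ν') := by
    conv_lhs => rw [← Measure.withDensity_rnDeriv_eq ν ν' hac]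
    rw [← withDensity_mul _ (Measure.measurable_rnDeriv _ _) hg,
      ← withDensity_mul _ hg (Measure.measurable_rnDeriv _ _), mul_comm]
  have hac' : ν.withDensity g ≪ ν'.withDensity g := by
    rw [e]; exact withDensity_absolutelyContinuous _ _
  have hr : (ν.withDensity g).rnDeriv (ν'.withDensity g) =ᵐ[ν'.withDensity g] ν.rnDeriv ν' := by
    conv_lhs => rw [e]
    exact Measure.rnDeriv_withDensity _ (Measure.measurable_rnDeriv _ _)
  rw [klDiv_eq_lintegral_klFun_of_ac hac', klDiv_eq_lintegral_klFun_of_ac hac]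
  refine (lintegral_congr_ae ?_).trans_le (lintegral_mono' (hle ν') le_rfl)
  filter_upwards [hr] with x hx
  rw [hx]

theorem add_sq_half_le_neg_log {u : ℝ} (h0 : 0 ≤ u) (h1 : u < 1) :
    u + u ^ 2 / 2 ≤ -Real.log (1 - u) := by
  have h := Real.hasSum_pow_div_log_of_abs_lt_one (x := u) (by rwa [abs_of_nonneg h0])
  have := sum_le_hasSum (Finset.range 2) (fun i _ => by positivity) h
  simp [Finset.sum_range_succ] at this
  norm_num at this
  linarith

/-- A one-sided Pinsker inequality for finite measures of mass at most one. -/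
theorem real_le_add_sqrt_klDiv {ν ν' : Measure α} [IsFiniteMeasure ν] [IsFiniteMeasure ν']
    (hν : ν.real .univ ≤ 1) (hD : klDiv ν ν' ≠ ⊤) {A : Set α} (hA : MeasurableSet A) :
    ν.real A ≤ ν'.real A + Real.sqrt (2 * (klDiv ν ν').toReal) := by
  have h1 : klDiv (ν.restrict A) (ν'.restrict A) ≤ klDiv ν ν' := by
    rw [← withDensity_indicator_one hA, ← withDensity_indicator_one hA]
    exact klDiv_withDensity_le (measurable_one.indicator hA) fun x =>
      Set.indicator_le_self' (fun _ _ => zero_le) x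
  have h2 := (mul_log_le_klDiv (ν.restrict A) (ν'.restrict A)).trans h1
  simp only [measureReal_restrict_apply_univ] at h2
  rw [ENNReal.ofReal_le_iff_le_toReal hD] at h2
  set D := (klDiv ν ν').toReal
  have hx1 : ν.real A ≤ 1 := (measureReal_mono (Set.subset_univ A)).trans hν
  have hx0 : 0 ≤ ν.real A := measureReal_nonneg
  have hy0 : 0 ≤ ν'.real A := measureReal_nonneg
  have hac : ν'.real A = 0 → ν.real A = 0 := by
    intro h
    rw [measureReal_eq_zero_iff] at h ⊢
    exact (klDiv_ne_top_iff.1 hD).1 h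
  set x := ν.real A
  set y := ν'.real A
  have hs := Real.sqrt_nonneg (2 * D)
  rcases le_or_gt x y with hxy | hxy
  · linarith
  have hx : 0 < x := hy0.trans_lt hxy
  have hy : 0 < y := lt_of_le_of_ne hy0 fun h => hx.ne' (hac h.symm)
  rw [← sub_le_iff_le_add']
  refine Real.le_sqrt_of_sq_le ?_
  have h3 := add_sq_half_le_neg_log (u := 1 - y / x)
    (by rw [sub_nonneg, div_le_one hx]; exact hxy.le) (by linarith [div_pos hy hx])
  rw [sub_sub_cancel, ← Real.log_inv, inv_div] at h3
  have h4 := mul_le_mul_of_nonneg_left h3 hx.le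
  have h5 : x * (1 - y / x + (1 - y / x) ^ 2 / 2) = x - y + (x - y) ^ 2 / (2 * x) := by
    field_simp
  rw [h5] at h4
  have h6 : (x - y) ^ 2 / 2 ≤ (x - y) ^ 2 / (2 * x) :=
    div_le_div_of_nonneg_left (sq_nonneg _) (by linarith) (by linarith)
  linarith

variable {d : ℕ}

/-- The law of `f X + c Z`, where `X ∼ ν` and `Z` is an independent standard Gaussian. -/
def gaussStep (f : α → E d) (c : ℝ) (ν : Measure α) : Measure (E d) :=
  (ν.prod (stdGaussian (E d))).map fun p => f p.1 + c • p.2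

theorem gaussStep_mono {f : α → E d} (hf : Measurable f) (c : ℝ) {ν ν' : Measure α}
    (h : ν ≤ ν') : gaussStep f c ν ≤ gaussStep f c ν' := by
  unfold gaussStep
  exact Measure.map_mono (Measure.prod_mono h le_rfl) (by fun_prop)

theorem gaussStep_univ {f : α → E d} (hf : Measurable f) (c : ℝ) (ν : Measure α) [SFinite ν] :
    gaussStep f c ν .univ = ν .univ := by
  rw [gaussStep, Measure.map_apply (by fun_prop) .univ, Set.preimage_univ, ← Set.univ_prod_univ,
    Measure.prod_prod, measure_univ (μ := stdGaussian (E d)), mul_one]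

theorem klDiv_withDensity_exp_eq {P : Measure α} [IsFiniteMeasure P] {L : α → ℝ}
    (hL : Integrable L P) (hLm : Measurable L)
    (hmass : P.withDensity (fun x => ENNReal.ofReal (Real.exp (L x))) .univ = P .univ) :
    klDiv P (P.withDensity fun x => ENNReal.ofReal (Real.exp (L x))) =
      ENNReal.ofReal (-∫ x, L x ∂P) := by
  set g : α → ENNReal := fun x => ENNReal.ofReal (Real.exp (L x)) with hg
  have hgm : Measurable g := hLm.exp.ennreal_ofReal
  have : IsFiniteMeasure (P.withDensity g) := ⟨by rw [hmass]; exact measure_lt_top _ _⟩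
  have hac : P ≪ P.withDensity g := withDensity_absolutelyContinuous' hgm.aemeasurable
    (.of_forall fun x => by simp [hg, Real.exp_pos])
  have hllr : llr P (P.withDensity g) =ᵐ[P] fun x => -L x := by
    have h1 := neg_llr hac
    have h2 := Measure.rnDeriv_withDensity P hgm
    filter_upwards [h1, h2] with x hx1 hx2
    rw [Pi.neg_apply, llr_def (P.withDensity g)] at hx1
    simp only [] at hx1
    rw [hx2, hg, ENNReal.toReal_ofReal (Real.exp_pos _).le, Real.log_exp] at hx1
    linarith
  rw [klDiv_of_ac_of_integrable hac ((integrable_congr hllr).2 hL.neg), integral_congr_ae hllr,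
    integral_neg, measureReal_def, measureReal_def, hmass]
  congr 1
  ring

/-- Moving the centre of a Gaussian step from `f` to `f'` increases the divergence by at most
the mean of `‖f - f'‖² / (2 c²)`. -/
theorem klDiv_gaussStep_le {f f' : α → E d} (hf : Measurable f) (hf' : Measurable f') {c : ℝ}
    (hc : 0 < c) (ν ν' : Measure α) [IsFiniteMeasure ν] [IsFiniteMeasure ν'] :
    klDiv (gaussStep f c ν) (gaussStep f' c ν') ≤
      klDiv ν ν' + ∫⁻ x, ENNReal.ofReal (‖f x - f' x‖ ^ 2 / (2 * c ^ 2)) ∂ν := by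
  -- on the joint space of the input and the noise, moving the centre is a shift `δ` of the noise
  set δ : α → E d := fun x => c⁻¹ • (f' x - f x) with hδ
  have hδm : Measurable δ := by fun_prop
  have hδn : ∀ x, ‖δ x‖ ^ 2 / 2 = ‖f x - f' x‖ ^ 2 / (2 * c ^ 2) := by
    intro x
    rw [hδ]
    simp only []
    rw [norm_smul, mul_pow, norm_inv, Real.norm_of_nonneg hc.le, norm_sub_rev]
    field_simp
  set L : α × E d → ℝ := fun p => inner ℝ (δ p.1) p.2 - ‖δ p.1‖ ^ 2 / 2 with hL
  have hLm : Measurable L := by fun_prop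
  have hLm' : Measurable (Function.uncurry fun x z => ENNReal.ofReal (Real.exp (L (x, z)))) :=
    hLm.exp.ennreal_ofReal
  set κ : Kernel α (E d) := Kernel.const α (stdGaussian (E d)) with hκ
  set η : Kernel α (E d) := κ.withDensity fun x z => ENNReal.ofReal (Real.exp (L (x, z))) with hη
  have hηx : ∀ x, η x = (stdGaussian (E d)).withDensity
      fun z => ENNReal.ofReal (Real.exp (L (x, z))) := fun x => by
    rw [hη, Kernel.withDensity_apply _ hLm', hκ, Kernel.const_apply]
  have hηint : ∀ x {F : E d → ENNReal}, Measurable F →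
      ∫⁻ z, F z ∂(η x) = ∫⁻ z, F (δ x + z) ∂(stdGaussian (E d)) := by
    intro x F hF
    have hmx : Measurable fun z => ENNReal.ofReal (Real.exp (L (x, z))) :=
      (hLm.comp measurable_prodMk_left).exp.ennreal_ofReal
    rw [hηx, lintegral_withDensity_eq_lintegral_mul _ hmx hF, lintegral_stdGaussian_shift _ hF]
    rfl
  have hηM : IsMarkovKernel η := ⟨fun x => ⟨by
    rw [← lintegral_one, hηint x measurable_const]; simp⟩⟩
  have hprod : ν ⊗ₘ κ = ν.prod (stdGaussian (E d)) := Measure.compProd_const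
  have hcomp : ν ⊗ₘ η = (ν ⊗ₘ κ).withDensity fun p => ENNReal.ofReal (Real.exp (L p)) := by
    refine Measure.ext_of_lintegral _ fun F hF => ?_
    have hm : Measurable fun p => ENNReal.ofReal (Real.exp (L p)) := hLm.exp.ennreal_ofReal
    rw [Measure.lintegral_compProd hF, lintegral_withDensity_eq_lintegral_mul _ hm hF,
      Measure.lintegral_compProd (hm.mul hF)]
    refine lintegral_congr fun x => ?_
    have hmx : Measurable fun z => ENNReal.ofReal (Real.exp (L (x, z))) :=
      hm.comp measurable_prodMk_left
    have hFx : Measurable fun z => F (x, z) := hF.comp measurable_prodMk_left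
    rw [hηx, lintegral_withDensity_eq_lintegral_mul _ hmx hFx]
    rfl
  have e1 : gaussStep f c ν = (ν ⊗ₘ κ).map fun p => f p.1 + c • p.2 := by
    rw [hprod, gaussStep]
  have e2 : gaussStep f' c ν' = (ν' ⊗ₘ η).map fun p => f p.1 + c • p.2 := by
    refine Measure.ext_of_lintegral _ fun F hF => ?_
    have hm1 : Measurable fun p : α × E d => F (f p.1 + c • p.2) := hF.comp (by fun_prop)
    have hm2 : Measurable fun p : α × E d => F (f' p.1 + c • p.2) := hF.comp (by fun_prop)
    rw [gaussStep, lintegral_map hF (by fun_prop), lintegral_map hF (by fun_prop),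
      Measure.lintegral_compProd hm1, lintegral_prod _ hm2.aemeasurable]
    refine lintegral_congr fun x => ?_
    have hmx : Measurable fun z : E d => F (f (x, z).1 + c • (x, z).2) :=
      hm1.comp measurable_prodMk_left
    rw [hηint x hmx]
    refine lintegral_congr fun z => ?_
    simp only [hδ, smul_add, smul_smul, mul_inv_cancel₀ hc.ne', one_smul]
    congr 1
    abel
  rw [e1, e2]
  -- data processing, then the chain rule
  refine (klDiv_map_le _ _ (by fun_prop)).trans ?_
  rw [klDiv_compProd_eq_add]
  refine add_le_add le_rfl ?_
  by_cases hfin : ∫⁻ x, ENNReal.ofReal (‖f x - f' x‖ ^ 2 / (2 * c ^ 2)) ∂ν = ⊤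
  · rw [hfin]; exact le_top
  have hI : Integrable (fun x => ‖δ x‖ ^ 2 / 2) ν := by
    refine ⟨Measurable.aestronglyMeasurable (by fun_prop), ?_⟩
    rw [hasFiniteIntegral_iff_ofReal (.of_forall fun x => by positivity)]
    simp_rw [hδn]
    exact lt_of_le_of_ne le_top hfin
  have hI1 : Integrable (fun x => ‖δ x‖) ν := by
    refine ((integrable_const (1 : ℝ)).add (hI.const_mul 2)).mono' hδm.norm.aestronglyMeasurable
      (.of_forall fun x => ?_)
    simp only [Pi.add_apply]
    rw [norm_norm]
    nlinarith [sq_nonneg (‖δ x‖ - 1)]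
  have hI2 : Integrable (fun p : α × E d => inner ℝ (δ p.1) p.2) (ν.prod (stdGaussian (E d))) := by
    refine (hI1.mul_prod (integrable_norm_stdGaussian (d := d))).mono'
      (Measurable.aestronglyMeasurable (by fun_prop)) (.of_forall fun p => ?_)
    exact abs_real_inner_le_norm _ _
  have hI3 : Integrable (fun p : α × E d => ‖δ p.1‖ ^ 2 / 2) (ν.prod (stdGaussian (E d))) :=
    hI.comp_fst _
  have hLi : Integrable L (ν ⊗ₘ κ) := by
    rw [hprod]; exact hI2.sub hI3
  rw [hcomp, klDiv_withDensity_exp_eq hLi hLm (by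
    rw [← hcomp, Measure.compProd_apply_univ, Measure.compProd_apply_univ])]
  refine le_of_eq ?_
  have e3 : ∫ p, L p ∂(ν ⊗ₘ κ) = -∫ x, ‖δ x‖ ^ 2 / 2 ∂ν := by
    rw [hprod, hL, integral_sub hI2 hI3, integral_prod _ hI2]
    have : ∀ x, ∫ z, inner ℝ (δ x) z ∂(stdGaussian (E d)) = 0 := by
      intro x
      have hid : Integrable (fun z : E d => z) (stdGaussian (E d)) :=
        (integrable_norm_iff (by fun_prop)).1 integrable_norm_stdGaussian
      rw [integral_inner hid, integral_id_stdGaussian, inner_zero_right]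
    simp only [this, integral_zero, zero_sub]
    rw [integral_fun_fst (f := fun x => ‖δ x‖ ^ 2 / 2)]
    simp
  rw [e3, neg_neg, ofReal_integral_eq_lintegral_ofReal hI (.of_forall fun x => by positivity)]
  simp_rw [hδn]

/-- Two probability measures that differ by at most `η` on every event have a common part of mass
at least `1 - η`, cut out by a density `g ≤ 1`. -/
theorem exists_common_density {p q : Measure α} [IsProbabilityMeasure p] [IsProbabilityMeasure q]
    {η : ℝ} (h : ∀ A, MeasurableSet A → |q.real A - p.real A| ≤ η) :
    ∃ g : α → ENNReal, Measurable g ∧ (∀ x, g x ≤ 1) ∧ p.withDensity g ≤ q ∧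
      ∫⁻ x, (1 - g x) ∂p ≤ ENNReal.ofReal η := by
  -- the density is `min 1 (dq / dp)`; the lost mass is the defect of `q` on `{dq / dp < 1}`, away
  -- from the singular part
  set r := q.rnDeriv p with hr
  have hrm : Measurable r := Measure.measurable_rnDeriv _ _
  have hgm : Measurable fun x => min 1 (r x) := measurable_const.min hrm
  refine ⟨fun x => min 1 (r x), hgm, fun x => min_le_left _ _, ?_, ?_⟩
  · exact (withDensity_mono (.of_forall fun x => min_le_right _ _)).trans
      (Measure.withDensity_rnDeriv_le q p)
  obtain ⟨S, hS, hS1, hS2⟩ := Measure.mutuallySingular_singularPart q p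
  set A := {x | r x < 1} ∩ S with hA
  have hAm : MeasurableSet A := (measurableSet_lt hrm measurable_const).inter hS
  have hqA : q A = ∫⁻ x in A, r x ∂p := by
    conv_lhs => rw [Measure.haveLebesgueDecomposition_add q p]
    rw [Measure.add_apply, measure_mono_null Set.inter_subset_right hS1, zero_add,
      withDensity_apply _ hAm]
  have hpA : p A ≤ q A + ENNReal.ofReal η := by
    have h1 := (abs_le.1 (h A hAm)).1
    have h2 : p.real A ≤ q.real A + η := by linarith
    have hη : 0 ≤ η := (abs_nonneg _).trans (h A hAm)
    rw [← ofReal_measureReal (μ := p), ← ofReal_measureReal (μ := q),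
      ← ENNReal.ofReal_add measureReal_nonneg hη]
    exact ENNReal.ofReal_le_ofReal h2
  have hae : (fun x => 1 - min 1 (r x)) =ᵐ[p] A.indicator fun x => 1 - r x := by
    have : ∀ᵐ x ∂p, x ∈ S := by rwa [ae_iff]
    filter_upwards [this] with x hx
    by_cases hrx : r x < 1
    · rw [Set.indicator_of_mem (show x ∈ A from ⟨hrx, hx⟩), min_eq_right hrx.le]
    · rw [Set.indicator_of_notMem fun h : x ∈ A => hrx h.1, min_eq_left (not_lt.1 hrx), tsub_self]
  rw [lintegral_congr_ae hae, lintegral_indicator hAm]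
  have hsum : ∫⁻ x in A, (1 - r x) ∂p + ∫⁻ x in A, r x ∂p = p A := by
    rw [← lintegral_add_right _ hrm, ← setLIntegral_one]
    refine setLIntegral_congr_fun hAm fun x hx => ?_
    exact tsub_add_cancel_of_le hx.1.le
  rw [← hqA] at hsum
  rw [← hsum, add_comm] at hpA
  exact (ENNReal.add_le_add_iff_left (measure_ne_top q A)).1 hpA

/-- The error of a chain of Gaussian steps `f' n` against a sequence of laws `q n`: the
steps `f n` reproduce `q` up to total variation errors `η n`, which cost mass, and the
differences `f n - f' n` cost divergence on the mass that is left. -/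
theorem exists_submeasure_chain {q Y : ℕ → Measure (E d)} [∀ n, IsProbabilityMeasure (q n)]
    [∀ n, IsProbabilityMeasure (Y n)] {f f' : ℕ → E d → E d} {c η : ℕ → ℝ} (N : ℕ)
    (hf : ∀ n < N, Measurable (f n)) (hf' : ∀ n < N, Measurable (f' n)) (hc : ∀ n < N, 0 < c n)
    (hY : ∀ n < N, Y (n + 1) = gaussStep (f' n) (c n) (Y n))
    (hq : ∀ n < N, ∀ A, MeasurableSet A →
      |(q (n + 1)).real A - (gaussStep (f n) (c n) (q n)).real A| ≤ η n) :
    ∀ n ≤ N, ∃ ν ν' : Measure (E d), ν ≤ q n ∧ ν' ≤ Y n ∧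
      klDiv ν ν' ≤ klDiv (q 0) (Y 0) + ∑ i ∈ Finset.range n,
        ∫⁻ x, ENNReal.ofReal (‖f i x - f' i x‖ ^ 2 / (2 * c i ^ 2)) ∂(q i) ∧
      1 ≤ ν .univ + ∑ i ∈ Finset.range n, ENNReal.ofReal (η i) := by
  intro n
  induction n with
  | zero => exact fun _ => ⟨q 0, Y 0, le_rfl, le_rfl, by simp, by simp⟩
  | succ n ih =>
    intro hn
    obtain ⟨ν, ν', h1, h2, h3, h4⟩ := ih (by omega)
    have hn' : n < N := by omega
    have := isFiniteMeasure_of_le _ h1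
    have := isFiniteMeasure_of_le _ h2
    set p := gaussStep (f n) (c n) (q n) with hp
    have hpp : IsProbabilityMeasure p := ⟨by rw [hp, gaussStep_univ (hf n hn'), measure_univ]⟩
    -- both sub-measures are multiplied by the same density, which leaves the first one below `q`
    obtain ⟨g, hgm, hg1, hgq, hgη⟩ := exists_common_density (hq n hn')
    set ν1 := gaussStep (f n) (c n) ν with hν1
    set ν1' := gaussStep (f' n) (c n) ν' with hν1'
    have hle1 : ν1 ≤ p := gaussStep_mono (hf n hn') _ h1
    have hle1' : ν1' ≤ Y (n + 1) := by
      rw [hY n hn']; exact gaussStep_mono (hf' n hn') _ h2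
    have := isFiniteMeasure_of_le _ hle1
    have := isFiniteMeasure_of_le _ hle1'
    have hwd : ∀ κ : Measure (E d), κ.withDensity g ≤ κ := fun κ => by
      conv_rhs => rw [← withDensity_one (μ := κ)]
      exact withDensity_mono (.of_forall hg1)
    have hmono : ν1.withDensity g ≤ p.withDensity g := by
      refine Measure.le_iff.2 fun s hs => ?_
      rw [withDensity_apply _ hs, withDensity_apply _ hs]
      exact lintegral_mono' (Measure.restrict_mono le_rfl hle1) le_rfl
    refine ⟨ν1.withDensity g, ν1'.withDensity g, hmono.trans hgq, (hwd _).trans hle1', ?_, ?_⟩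
    · refine (klDiv_withDensity_le hgm hg1).trans ?_
      refine (klDiv_gaussStep_le (hf n hn') (hf' n hn') (hc n hn') ν ν').trans ?_
      rw [Finset.sum_range_succ, ← add_assoc]
      exact add_le_add h3 (lintegral_mono' h1 le_rfl)
    · rw [Finset.sum_range_succ, withDensity_apply _ .univ, setLIntegral_univ]
      have e1 : ν .univ = ∫⁻ x, g x ∂ν1 + ∫⁻ x, (1 - g x) ∂ν1 := by
        rw [← lintegral_add_left hgm, ← gaussStep_univ (hf n hn') (c n) ν, ← hν1]
        have : ∀ x, g x + (1 - g x) = 1 := fun x => add_tsub_cancel_of_le (hg1 x)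
        simp [this]
      have e2 : ∫⁻ x, (1 - g x) ∂ν1 ≤ ENNReal.ofReal (η n) :=
        (lintegral_mono' hle1 le_rfl).trans hgη
      calc (1 : ENNReal) ≤ ν .univ + ∑ i ∈ Finset.range n, ENNReal.ofReal (η i) := h4
        _ ≤ (∫⁻ x, g x ∂ν1 + ENNReal.ofReal (η n)) +
            ∑ i ∈ Finset.range n, ENNReal.ofReal (η i) := by
          rw [e1]; exact add_le_add (add_le_add le_rfl e2) le_rfl
        _ = _ := by rw [add_assoc, add_comm (ENNReal.ofReal (η n))]

theorem tvDist_le_of_forall_le {μ ν : Measure α} [IsProbabilityMeasure μ]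
    [IsProbabilityMeasure ν] {b : ℝ}
    (h : ∀ A, MeasurableSet A → μ.real A ≤ ν.real A + b) : tvDist μ ν ≤ b := by
  have : Nonempty {A : Set α // MeasurableSet A} := ⟨⟨∅, .empty⟩⟩
  refine ciSup_le fun A => ?_
  have h1 := h A.1 A.2
  have h2 := h A.1ᶜ A.2.compl
  rw [probReal_compl_eq_one_sub A.2, probReal_compl_eq_one_sub A.2] at h2
  rw [abs_le]
  constructor <;> linarith

theorem abs_real_sub_le_tvDist (μ ν : Measure α) [IsProbabilityMeasure μ]
    [IsProbabilityMeasure ν] {A : Set α} (hA : MeasurableSet A) :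
    |μ.real A - ν.real A| ≤ tvDist μ ν := by
  refine le_ciSup (f := fun A : {A : Set α // MeasurableSet A} => |μ.real A - ν.real A|) ?_
    ⟨A, hA⟩
  refine ⟨1, ?_⟩
  rintro _ ⟨A, rfl⟩
  have h1 : μ.real A.1 ≤ 1 := measureReal_le_one
  have h2 : ν.real A.1 ≤ 1 := measureReal_le_one
  have h3 : 0 ≤ μ.real A.1 := measureReal_nonneg
  have h4 : 0 ≤ ν.real A.1 := measureReal_nonneg
  simp only []
  rw [abs_le]
  constructor <;> linarith

theorem tvDist_triangle (μ ν κ : Measure α) [IsProbabilityMeasure μ] [IsProbabilityMeasure ν]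
    [IsProbabilityMeasure κ] : tvDist μ κ ≤ tvDist μ ν + tvDist ν κ := by
  refine tvDist_le_of_forall_le fun A hA => ?_
  have h1 := (abs_le.1 (abs_real_sub_le_tvDist μ ν hA)).2
  have h2 := (abs_le.1 (abs_real_sub_le_tvDist ν κ hA)).2
  linarith

theorem tvDist_le_one (μ ν : Measure α) [IsProbabilityMeasure μ] [IsProbabilityMeasure ν] :
    tvDist μ ν ≤ 1 := by
  refine tvDist_le_of_forall_le fun A hA => ?_
  have h1 : μ.real A ≤ 1 := measureReal_le_one
  have h2 : 0 ≤ ν.real A := measureReal_nonneg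
  linarith

/-- Total variation error of a chain of Gaussian steps: the local errors add up linearly, while the
changes of the drift enter through the square root of the total divergence. -/
theorem tvDist_chain_le {q Y : ℕ → Measure (E d)} [∀ n, IsProbabilityMeasure (q n)]
    [∀ n, IsProbabilityMeasure (Y n)] {f f' : ℕ → E d → E d} {c η : ℕ → ℝ} (N : ℕ)
    (hf : ∀ n < N, Measurable (f n)) (hf' : ∀ n < N, Measurable (f' n)) (hc : ∀ n < N, 0 < c n)
    (hY : ∀ n < N, Y (n + 1) = gaussStep (f' n) (c n) (Y n))
    (hq : ∀ n < N, ∀ A, MeasurableSet A →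
      |(q (n + 1)).real A - (gaussStep (f n) (c n) (q n)).real A| ≤ η n)
    {D : ℝ} (hD0 : 0 ≤ D) (hD : klDiv (q 0) (Y 0) + ∑ i ∈ Finset.range N,
        ∫⁻ x, ENNReal.ofReal (‖f i x - f' i x‖ ^ 2 / (2 * c i ^ 2)) ∂(q i) ≤
      ENNReal.ofReal D) :
    tvDist (q N) (Y N) ≤ ∑ i ∈ Finset.range N, η i + Real.sqrt (2 * D) := by
  obtain ⟨ν, ν', h1, h2, h3, h4⟩ := exists_submeasure_chain N hf hf' hc hY hq N le_rfl
  have := isFiniteMeasure_of_le _ h1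
  have := isFiniteMeasure_of_le _ h2
  have hkl : klDiv ν ν' ≤ ENNReal.ofReal D := h3.trans hD
  have hne : klDiv ν ν' ≠ ⊤ := (hkl.trans_lt ENNReal.ofReal_lt_top).ne
  have hklr : (klDiv ν ν').toReal ≤ D := ENNReal.toReal_le_of_le_ofReal hD0 hkl
  have hη : ∀ i ∈ Finset.range N, 0 ≤ η i := fun i hi =>
    (abs_nonneg _).trans (hq i (Finset.mem_range.1 hi) ∅ .empty)
  have hle : ∀ A, ν.real A ≤ (q N).real A := fun A =>
    ENNReal.toReal_mono (measure_ne_top _ _) (h1 A)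
  have hle' : ∀ A, ν'.real A ≤ (Y N).real A := fun A =>
    ENNReal.toReal_mono (measure_ne_top _ _) (h2 A)
  have hmass : 1 ≤ ν.real .univ + ∑ i ∈ Finset.range N, η i := by
    rw [← ENNReal.ofReal_sum_of_nonneg hη, ← ofReal_measureReal,
      ← ENNReal.ofReal_add measureReal_nonneg (Finset.sum_nonneg hη), ← ENNReal.ofReal_one,
      ENNReal.ofReal_le_ofReal_iff (add_nonneg measureReal_nonneg (Finset.sum_nonneg hη))] at h4
    exact h4
  refine tvDist_le_of_forall_le fun A hA => ?_
  have e1 := real_le_add_sqrt_klDiv (by simpa using hle .univ) hne hA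
  have e2 : Real.sqrt (2 * (klDiv ν ν').toReal) ≤ Real.sqrt (2 * D) :=
    Real.sqrt_le_sqrt (by linarith)
  have e3 := hle Aᶜ
  have e4 := measureReal_add_measureReal_compl (μ := ν) hA
  have e5 := measureReal_add_measureReal_compl (μ := q N) hA
  rw [probReal_univ] at e5
  have e6 := hle' A
  linarith

end Divergence

/-! ### From the score of the target to the score of the mixture -/

section ScoreComparison

variable {d : ℕ} {a : ℝ}

/-- Two probability measures at total variation distance at most `ε` agree up to parts of mass
at most `ε`. -/
theorem exists_add_of_tvDist_le {Ω : Type*} [MeasurableSpace Ω] {ρ ρ' : Measure Ω}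
    [IsProbabilityMeasure ρ] [IsProbabilityMeasure ρ'] {ε : ℝ} (h : tvDist ρ ρ' ≤ ε) :
    ∃ κ ρ₁ ρ₂ : Measure Ω, ρ = κ + ρ₁ ∧ ρ' = κ + ρ₂ ∧
      ρ₁ .univ ≤ ENNReal.ofReal ε ∧ ρ₂ .univ ≤ ENNReal.ofReal ε := by
  obtain ⟨g, hgm, hg1, hgq, hgη⟩ := exists_common_density (p := ρ) (q := ρ') (η := ε) fun A hA => by
    rw [abs_sub_comm]
    exact (abs_real_sub_le_tvDist ρ ρ' hA).trans h
  have e1 : ρ = ρ.withDensity g + ρ.withDensity fun x => 1 - g x := by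
    rw [← withDensity_add_left hgm]
    have : (g + fun x => 1 - g x) = 1 := funext fun x => add_tsub_cancel_of_le (hg1 x)
    rw [this, withDensity_one]
  have hfin := isFiniteMeasure_of_le _ hgq
  have e2 : ρ' = ρ.withDensity g + (ρ' - ρ.withDensity g) := by
    rw [add_comm, Measure.sub_add_cancel_of_le hgq]
  have hm : (ρ.withDensity fun x => 1 - g x) .univ ≤ ENNReal.ofReal ε := by
    rwa [withDensity_apply _ .univ, setLIntegral_univ]
  refine ⟨_, _, _, e1, e2, hm, ?_⟩
  have u1 : (1 : ENNReal) = ρ.withDensity g .univ + (ρ.withDensity fun x => 1 - g x) .univ := by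
    rw [← Measure.add_apply, ← e1, measure_univ]
  have u2 : (1 : ENNReal) = ρ.withDensity g .univ + (ρ' - ρ.withDensity g) .univ := by
    rw [← Measure.add_apply, ← e2, measure_univ]
  rw [u1] at u2
  rw [← (ENNReal.add_right_inj (measure_ne_top _ _)).1 u2]
  exact hm

/-- Averages over `√a X₀ + √(1 - a) W`, joint with `X₀`, of functions of the noise alone. -/
theorem lintegral_lintegral_gaussDensity_mul (ρ : Measure (E d)) [IsFiniteMeasure ρ] (ha : a < 1)
    {F : E d → ENNReal} (hF : Measurable F) :
    ∫⁻ x, ∫⁻ x₀, ENNReal.ofReal (gaussDensity (Real.sqrt a • x₀) (1 - a) x) *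
        F (x - Real.sqrt a • x₀) ∂ρ =
      ρ .univ * ∫⁻ z, F (Real.sqrt (1 - a) • z) ∂(stdGaussian (E d)) := by
  have hg : Measurable fun p : E d × E d => gaussDensity (Real.sqrt a • p.2) (1 - a) p.1 := by
    unfold gaussDensity
    fun_prop
  have hFm : Measurable fun p : E d × E d => F (p.1 - Real.sqrt a • p.2) := hF.comp (by fun_prop)
  have hms : Measurable fun p : E d × E d => ENNReal.ofReal
      (gaussDensity (Real.sqrt a • p.2) (1 - a) p.1) * F (p.1 - Real.sqrt a • p.2) :=
    hg.ennreal_ofReal.mul hFm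
  rw [lintegral_lintegral_swap (f := fun x x₀ : E d => ENNReal.ofReal
    (gaussDensity (Real.sqrt a • x₀) (1 - a) x) * F (x - Real.sqrt a • x₀)) hms.aemeasurable]
  have key : ∀ x₀ : E d, ∫⁻ x, ENNReal.ofReal (gaussDensity (Real.sqrt a • x₀) (1 - a) x) *
        F (x - Real.sqrt a • x₀) = ∫⁻ z, F (Real.sqrt (1 - a) • z) ∂(stdGaussian (E d)) := by
    intro x₀
    rw [← lintegral_stdGaussian_affine (Real.sqrt a • x₀) (by linarith : 0 < 1 - a)
      (F := fun x => F (x - Real.sqrt a • x₀)) (hF.comp (by fun_prop))]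
    simp
  simp_rw [key]
  rw [lintegral_const, mul_comm]

theorem lintegral_forwardDensity (ρ : Measure (E d)) [IsFiniteMeasure ρ] (ha : a < 1) :
    ∫⁻ x, ENNReal.ofReal (forwardDensity ρ a x) = ρ .univ := by
  have h := lintegral_lintegral_gaussDensity_mul ρ ha (F := fun _ => 1) measurable_const
  simp only [mul_one, lintegral_const, measure_univ] at h
  rw [← h]
  refine lintegral_congr fun x => ?_
  rw [forwardDensity, ofReal_integral_eq_lintegral_ofReal
    (integrable_gaussDensity_sqrt_smul ρ ha x) (.of_forall fun _ => gaussDensity_nonneg _ _ _)]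

theorem lintegral_norm_stdGaussian_le (d : ℕ) :
    ∫⁻ z, ENNReal.ofReal ‖z‖ ∂(stdGaussian (E d)) ≤ ENNReal.ofReal (Real.sqrt d) := by
  rw [← ofReal_integral_eq_lintegral_ofReal integrable_norm_stdGaussian
    (.of_forall fun z => norm_nonneg z)]
  refine ENNReal.ofReal_le_ofReal ?_
  rcases Nat.eq_zero_or_pos d with rfl | hd
  · have : ∀ z : E 0, ‖z‖ = 0 := fun z => by rw [Subsingleton.elim z 0, norm_zero]
    simp [this]
  have hd' : (0 : ℝ) < Real.sqrt d := Real.sqrt_pos.2 (by exact_mod_cast hd)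
  have h2 := integral_norm_sq_stdGaussian (d := d)
  have h1 : ∫ z : E d, ‖z‖ ∂(stdGaussian (E d)) ≤
      ∫ z, (Real.sqrt d / 2 + (1 / (2 * Real.sqrt d)) * ‖z‖ ^ 2) ∂(stdGaussian (E d)) := by
    refine integral_mono integrable_norm_stdGaussian ((integrable_const _).add
      (integrable_norm_sq_stdGaussian.const_mul _)) fun z => ?_
    have : Real.sqrt d / 2 + (1 / (2 * Real.sqrt d)) * ‖z‖ ^ 2 - ‖z‖ =
        (‖z‖ - Real.sqrt d) ^ 2 / (2 * Real.sqrt d) := by field_simp; ring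
    have := div_nonneg (sq_nonneg (‖z‖ - Real.sqrt d)) (by positivity : 0 ≤ 2 * Real.sqrt d)
    simp only []
    linarith
  refine h1.trans (le_of_eq ?_)
  rw [integral_add (integrable_const _) (integrable_norm_sq_stdGaussian.const_mul _),
    integral_const_mul, h2]
  simp only [integral_const, probReal_univ, one_smul]
  have : (d : ℝ) = Real.sqrt d * Real.sqrt d := (Real.mul_self_sqrt (Nat.cast_nonneg d)).symm
  rw [show (1 / (2 * Real.sqrt d)) * (d : ℝ) = (1 / (2 * Real.sqrt d)) *
    (Real.sqrt d * Real.sqrt d) by rw [← this]]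
  field_simp
  ring

theorem lintegral_norm_gradDensity_le (ρ : Measure (E d)) [IsFiniteMeasure ρ] (ha : a < 1) :
    ∫⁻ x, ENNReal.ofReal ‖gradDensity ρ a x‖ ≤
      ρ .univ * ENNReal.ofReal (Real.sqrt d / Real.sqrt (1 - a)) := by
  have hv : 0 < 1 - a := by linarith
  have hs : 0 < Real.sqrt (1 - a) := Real.sqrt_pos.2 hv
  have h := lintegral_lintegral_gaussDensity_mul ρ ha
    (F := fun y => ENNReal.ofReal ((1 - a)⁻¹ * ‖y‖)) (by fun_prop)
  have h2 : ∫⁻ z, ENNReal.ofReal ((1 - a)⁻¹ * ‖Real.sqrt (1 - a) • z‖) ∂(stdGaussian (E d)) ≤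
      ENNReal.ofReal (Real.sqrt d / Real.sqrt (1 - a)) := by
    have e : ∀ z : E d, ENNReal.ofReal ((1 - a)⁻¹ * ‖Real.sqrt (1 - a) • z‖) =
        ENNReal.ofReal (Real.sqrt (1 - a))⁻¹ * ENNReal.ofReal ‖z‖ := by
      intro z
      rw [← ENNReal.ofReal_mul (by positivity), norm_smul, Real.norm_of_nonneg hs.le]
      congr 1
      have : (1 - a) = Real.sqrt (1 - a) * Real.sqrt (1 - a) := (Real.mul_self_sqrt hv.le).symm
      rw [show (1 - a)⁻¹ = (Real.sqrt (1 - a))⁻¹ * (Real.sqrt (1 - a))⁻¹ by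
        rw [← mul_inv, ← this]]
      field_simp
    simp_rw [e]
    rw [lintegral_const_mul _ (by fun_prop)]
    refine (mul_le_mul_right (lintegral_norm_stdGaussian_le d) _).trans (le_of_eq ?_)
    rw [← ENNReal.ofReal_mul (by positivity), div_eq_inv_mul]
  refine le_trans ?_ (h.trans_le (mul_le_mul_right h2 _))
  refine lintegral_mono fun x => ?_
  rw [ofReal_norm, gradDensity]
  refine (enorm_integral_le_lintegral_enorm _).trans (le_of_eq (lintegral_congr fun x₀ => ?_))
  rw [← ofReal_norm, norm_smul, Real.norm_of_nonneg
    (mul_nonneg (gaussDensity_nonneg _ _ _) (by positivity)), mul_assoc,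
    ENNReal.ofReal_mul (gaussDensity_nonneg _ _ _), norm_sub_rev]

theorem forwardDensity_add (κ ρ : Measure (E d)) [IsFiniteMeasure κ] [IsFiniteMeasure ρ]
    (ha : a < 1) (x : E d) :
    forwardDensity (κ + ρ) a x = forwardDensity κ a x + forwardDensity ρ a x :=
  integral_add_measure (integrable_gaussDensity_sqrt_smul κ ha x)
    (integrable_gaussDensity_sqrt_smul ρ ha x)

theorem gradDensity_add (κ ρ : Measure (E d)) [IsFiniteMeasure κ] [IsFiniteMeasure ρ]
    (ha : a < 1) (x : E d) :
    gradDensity (κ + ρ) a x = gradDensity κ a x + gradDensity ρ a x :=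
  integral_add_measure (integrable_gaussDensity_sqrt_smul_smul κ ha x)
    (integrable_gaussDensity_sqrt_smul_smul ρ ha x)

theorem forwardDensity_nonneg (ρ : Measure (E d)) (a : ℝ) (x : E d) : 0 ≤ forwardDensity ρ a x :=
  integral_nonneg fun _ => gaussDensity_nonneg _ _ _

/-- The noised densities of two close measures are close in `L¹`, with their gradients. -/
theorem lintegral_abs_sub_forwardDensity_le {ρ ρ' : Measure (E d)} [IsProbabilityMeasure ρ]
    [IsProbabilityMeasure ρ'] {ε : ℝ} (h : tvDist ρ ρ' ≤ ε) (ha : a < 1) :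
    ∫⁻ x, ENNReal.ofReal |forwardDensity ρ a x - forwardDensity ρ' a x| ≤
        ENNReal.ofReal (2 * ε) ∧
      ∫⁻ x, ENNReal.ofReal ‖gradDensity ρ a x - gradDensity ρ' a x‖ ≤
        ENNReal.ofReal (2 * ε * (Real.sqrt d / Real.sqrt (1 - a))) := by
  obtain ⟨κ, ρ₁, ρ₂, h1, h2, hm1, hm2⟩ := exists_add_of_tvDist_le h
  have : IsFiniteMeasure κ := isFiniteMeasure_of_le ρ (by rw [h1]; exact Measure.le_add_right le_rfl)
  have : IsFiniteMeasure ρ₁ := ⟨hm1.trans_lt ENNReal.ofReal_lt_top⟩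
  have : IsFiniteMeasure ρ₂ := ⟨hm2.trans_lt ENNReal.ofReal_lt_top⟩
  have hε : 0 ≤ ε := (abs_nonneg _).trans ((abs_real_sub_le_tvDist ρ ρ' .empty).trans h)
  constructor
  · have e : ∀ x, ENNReal.ofReal |forwardDensity ρ a x - forwardDensity ρ' a x| ≤
        ENNReal.ofReal (forwardDensity ρ₁ a x) + ENNReal.ofReal (forwardDensity ρ₂ a x) := by
      intro x
      have p1 := forwardDensity_nonneg ρ₁ a x
      have p2 := forwardDensity_nonneg ρ₂ a x
      rw [← ENNReal.ofReal_add p1 p2, h1, h2, forwardDensity_add κ ρ₁ ha,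
        forwardDensity_add κ ρ₂ ha]
      refine ENNReal.ofReal_le_ofReal (abs_le.2 ⟨?_, ?_⟩) <;> linarith
    refine (lintegral_mono e).trans ?_
    rw [lintegral_add_left (continuous_forwardDensity ρ₁ ha).measurable.ennreal_ofReal,
      lintegral_forwardDensity ρ₁ ha, lintegral_forwardDensity ρ₂ ha, two_mul,
      ENNReal.ofReal_add hε hε]
    exact add_le_add hm1 hm2
  · have e : ∀ x, ENNReal.ofReal ‖gradDensity ρ a x - gradDensity ρ' a x‖ ≤
        ENNReal.ofReal ‖gradDensity ρ₁ a x‖ + ENNReal.ofReal ‖gradDensity ρ₂ a x‖ := by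
      intro x
      rw [← ENNReal.ofReal_add (norm_nonneg _) (norm_nonneg _), h1, h2, gradDensity_add κ ρ₁ ha,
        gradDensity_add κ ρ₂ ha, add_sub_add_left_eq_sub]
      exact ENNReal.ofReal_le_ofReal (norm_sub_le _ _)
    refine (lintegral_mono e).trans ?_
    have hsd : 0 ≤ Real.sqrt d / Real.sqrt (1 - a) := by positivity
    rw [lintegral_add_left (measurable_gradDensity ρ₁ a).norm.ennreal_ofReal,
      mul_assoc, two_mul, ENNReal.ofReal_add (by positivity) (by positivity),
      ENNReal.ofReal_mul hε]
    exact add_le_add ((lintegral_norm_gradDensity_le ρ₁ ha).trans (mul_le_mul_left hm1 _))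
      ((lintegral_norm_gradDensity_le ρ₂ ha).trans (mul_le_mul_left hm2 _))

theorem norm_gradDensity_le (ρ : Measure (E d)) [IsFiniteMeasure ρ] (ha : a < 1) (x : E d) :
    ‖gradDensity ρ a x‖ ≤ ∫ x₀, gaussDensity (Real.sqrt a • x₀) (1 - a) x *
      ((1 - a)⁻¹ * ‖x - Real.sqrt a • x₀‖) ∂ρ := by
  refine (norm_integral_le_integral_norm _).trans (le_of_eq ?_)
  refine integral_congr_ae (.of_forall fun x₀ => ?_)
  have hv : 0 < 1 - a := by linarith
  simp only []
  rw [norm_smul, Real.norm_of_nonneg (mul_nonneg (gaussDensity_nonneg _ _ _) (by positivity)),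
    norm_sub_rev, mul_assoc]

/-- The posterior mean inequality `u² ≤ 4 E[(N - c)₊²]` for `u ≤ E N`, `u > 2 c`, applied to the
score. -/
theorem forwardDensity_mul_sq_score_le {ρ : Measure (E d)} [IsProbabilityMeasure ρ] (ha : a < 1)
    {c : ℝ} (hc : 0 ≤ c) (x : E d) (hx : 2 * c < ‖score ρ a x‖) :
    forwardDensity ρ a x * ‖score ρ a x‖ ^ 2 ≤
      4 * ∫ x₀, gaussDensity (Real.sqrt a • x₀) (1 - a) x *
        max ((1 - a)⁻¹ * ‖x - Real.sqrt a • x₀‖ - c) 0 ^ 2 ∂ρ := by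
  have hv : 0 < 1 - a := by linarith
  set k : E d → ℝ := fun x₀ => gaussDensity (Real.sqrt a • x₀) (1 - a) x with hk
  set n : E d → ℝ := fun x₀ => (1 - a)⁻¹ * ‖x - Real.sqrt a • x₀‖ with hn
  have hk0 : ∀ x₀, 0 ≤ k x₀ := fun _ => gaussDensity_nonneg _ _ _
  have hn0 : ∀ x₀, 0 ≤ n x₀ := fun _ => by positivity
  set p := forwardDensity ρ a x with hp
  have hp0 : 0 < p := forwardDensity_pos ha x
  have hpk : p = ∫ x₀, k x₀ ∂ρ := rfl
  set u := ‖score ρ a x‖ with hu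
  have hkm : Measurable k := by simp only [hk]; unfold gaussDensity; fun_prop
  have hnm : Measurable n := by fun_prop
  have ik : Integrable k ρ := integrable_gaussDensity_sqrt_smul ρ ha x
  have ikn : Integrable (fun x₀ => k x₀ * n x₀) ρ := by
    refine (integrable_gaussDensity_sqrt_smul_smul ρ ha x).norm.congr (.of_forall fun x₀ => ?_)
    simp only [hk, hn]
    rw [norm_smul, Real.norm_of_nonneg (mul_nonneg (gaussDensity_nonneg _ _ _) (by positivity)),
      norm_sub_rev, mul_assoc]
  have ikn2 : Integrable (fun x₀ => k x₀ * max (n x₀ - c) 0 ^ 2) ρ := by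
    refine Integrable.of_bound (C := (Real.sqrt (2 * Real.pi * (1 - a)))⁻¹ ^ d * (2 / (1 - a)))
      (Measurable.aestronglyMeasurable (by fun_prop)) (.of_forall fun x₀ => ?_)
    rw [Real.norm_of_nonneg (mul_nonneg (hk0 _) (sq_nonneg _))]
    have h1 : max (n x₀ - c) 0 ^ 2 ≤ n x₀ ^ 2 :=
      pow_le_pow_left₀ (le_max_right _ _) (max_le (by linarith) (hn0 _)) 2
    refine (mul_le_mul_of_nonneg_left h1 (hk0 _)).trans ?_
    simp only [hk, hn, gaussDensity]
    rw [mul_assoc]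
    refine mul_le_mul_of_nonneg_left ?_ (by positivity)
    set t := ‖x - Real.sqrt a • x₀‖
    have h2 := Real.add_one_le_exp (t ^ 2 / (2 * (1 - a)))
    rw [neg_div, Real.exp_neg, inv_mul_le_iff₀ (Real.exp_pos _)]
    calc ((1 - a)⁻¹ * t) ^ 2 = t ^ 2 / (2 * (1 - a)) * (2 / (1 - a)) := by field_simp
      _ ≤ _ := mul_le_mul_of_nonneg_right (by linarith) (by positivity)
  have hup : u * p ≤ ∫ x₀, k x₀ * n x₀ ∂ρ := by
    refine le_trans (le_of_eq ?_) (norm_gradDensity_le ρ ha x)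
    rw [hu, score_eq ha, norm_smul, norm_inv, Real.norm_of_nonneg hp0.le]
    field_simp
  -- the tangent of `t ↦ t₊²` at `l = u - c`, integrated against the posterior
  set l := u - c with hl
  have hl0 : 0 ≤ l := by linarith
  have hint : ∫ x₀, (2 * l * (k x₀ * n x₀) - (2 * l * c + l ^ 2) * k x₀) ∂ρ ≤
      ∫ x₀, k x₀ * max (n x₀ - c) 0 ^ 2 ∂ρ := by
    refine integral_mono ((ikn.const_mul _).sub (ik.const_mul _)) ikn2 fun x₀ => ?_
    have h3 : 2 * l * (n x₀ - c) - l ^ 2 ≤ max (n x₀ - c) 0 ^ 2 := by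
      rcases le_total (n x₀ - c) 0 with h | h
      · rw [max_eq_right h]; nlinarith
      · rw [max_eq_left h]; nlinarith [sq_nonneg (n x₀ - c - l)]
    have := mul_le_mul_of_nonneg_left h3 (hk0 x₀)
    simp only []
    linarith
  rw [integral_sub (ikn.const_mul _) (ik.const_mul _), integral_const_mul, integral_const_mul,
    ← hpk] at hint
  have h4 := mul_le_mul_of_nonneg_left hup (by linarith : 0 ≤ 2 * l)
  have h5 : p * u ^ 2 ≤ 4 * (p * l ^ 2) := by
    have : u ^ 2 ≤ 4 * l ^ 2 := by nlinarith
    nlinarith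
  have h6 : p * l ^ 2 = 2 * l * (u * p) - (2 * l * c + l ^ 2) * p := by rw [hl]; ring
  linarith

/-- The second moment of the score beyond the radius `2 c`. -/
theorem lintegral_sq_score_indicator_le {ρ : Measure (E d)} [IsProbabilityMeasure ρ] (ha : a < 1)
    {c : ℝ} (hc : 0 ≤ c) :
    ∫⁻ x, ENNReal.ofReal (forwardDensity ρ a x *
        (if 2 * c < ‖score ρ a x‖ then ‖score ρ a x‖ ^ 2 else 0)) ≤
      ENNReal.ofReal (32 / (1 - a) * (Real.sqrt 2 ^ d * Real.exp (-(c ^ 2 * (1 - a)) / 8))) := by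
  have hv : 0 < 1 - a := by linarith
  set s := Real.sqrt (1 - a) with hs
  have hs0 : 0 < s := Real.sqrt_pos.2 hv
  have hss : s ^ 2 = 1 - a := Real.sq_sqrt hv.le
  have hm : Measurable fun y : E d => ENNReal.ofReal (max ((1 - a)⁻¹ * ‖y‖ - c) 0 ^ 2) := by
    fun_prop
  have h1 : ∀ x, ENNReal.ofReal (forwardDensity ρ a x *
        (if 2 * c < ‖score ρ a x‖ then ‖score ρ a x‖ ^ 2 else 0)) ≤
      ENNReal.ofReal 4 * ∫⁻ x₀, ENNReal.ofReal (gaussDensity (Real.sqrt a • x₀) (1 - a) x) *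
        ENNReal.ofReal (max ((1 - a)⁻¹ * ‖x - Real.sqrt a • x₀‖ - c) 0 ^ 2) ∂ρ := by
    intro x
    split_ifs with hx
    · refine (ENNReal.ofReal_le_ofReal (forwardDensity_mul_sq_score_le ha hc x hx)).trans ?_
      rw [ENNReal.ofReal_mul (by norm_num)]
      refine mul_le_mul_right ?_ _
      rw [integral_eq_lintegral_of_nonneg_ae (.of_forall fun x₀ => mul_nonneg
        (gaussDensity_nonneg _ _ _) (sq_nonneg _)) (Measurable.aestronglyMeasurable
        (by unfold gaussDensity; fun_prop))]
      refine ENNReal.ofReal_toReal_le.trans (le_of_eq ?_)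
      exact lintegral_congr fun x₀ => ENNReal.ofReal_mul (gaussDensity_nonneg _ _ _)
    · simp
  have hm2 : Measurable fun x => ∫⁻ x₀, ENNReal.ofReal
      (gaussDensity (Real.sqrt a • x₀) (1 - a) x) *
        ENNReal.ofReal (max ((1 - a)⁻¹ * ‖x - Real.sqrt a • x₀‖ - c) 0 ^ 2) ∂ρ := by
    refine Measurable.lintegral_prod_right' (f := fun p : E d × E d => ENNReal.ofReal
      (gaussDensity (Real.sqrt a • p.2) (1 - a) p.1) *
        ENNReal.ofReal (max ((1 - a)⁻¹ * ‖p.1 - Real.sqrt a • p.2‖ - c) 0 ^ 2)) ?_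
    unfold gaussDensity
    fun_prop
  refine (lintegral_mono h1).trans ?_
  rw [lintegral_const_mul _ hm2, lintegral_lintegral_gaussDensity_mul ρ ha hm, measure_univ,
    one_mul]
  have h2 : ∀ z : E d, ENNReal.ofReal (max ((1 - a)⁻¹ * ‖s • z‖ - c) 0 ^ 2) ≤
      ENNReal.ofReal (8 / (1 - a) * Real.exp (-(c ^ 2 * (1 - a)) / 8)) *
        ENNReal.ofReal (Real.exp (‖z‖ ^ 2 / 4)) := by
    intro z
    rw [← ENNReal.ofReal_mul (by positivity)]
    refine ENNReal.ofReal_le_ofReal ?_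
    have e : (1 - a)⁻¹ * ‖s • z‖ = ‖z‖ / s := by
      rw [norm_smul, Real.norm_of_nonneg hs0.le, ← hss]; field_simp
    rw [e]
    set t := ‖z‖ / s with ht
    have ht0 : 0 ≤ t := by positivity
    have htz : ‖z‖ ^ 2 = t ^ 2 * (1 - a) := by rw [ht, div_pow, hss]; field_simp
    rw [htz]
    rcases le_or_gt t c with h | h
    · rw [max_eq_right (by linarith)]; simp; positivity
    rw [max_eq_left (by linarith)]
    have h3 : (t - c) ^ 2 ≤ t ^ 2 := pow_le_pow_left₀ (by linarith) (by linarith) 2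
    -- half of the exponential moment beats the square, the other half the radius
    have h4 := Real.add_one_le_exp (t ^ 2 * (1 - a) / 8)
    have h5 : 1 ≤ Real.exp ((t ^ 2 - c ^ 2) * (1 - a) / 8) :=
      Real.one_le_exp (by have : c ^ 2 ≤ t ^ 2 := pow_le_pow_left₀ hc h.le 2
                          have : 0 ≤ t ^ 2 - c ^ 2 := by linarith
                          positivity)
    have h6 : Real.exp (-(c ^ 2 * (1 - a)) / 8) * Real.exp (t ^ 2 * (1 - a) / 4) =
        Real.exp (t ^ 2 * (1 - a) / 8) * Real.exp ((t ^ 2 - c ^ 2) * (1 - a) / 8) := by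
      rw [← Real.exp_add, ← Real.exp_add]; ring_nf
    rw [mul_assoc, h6]
    calc (t - c) ^ 2 ≤ t ^ 2 := h3
      _ = 8 / (1 - a) * (t ^ 2 * (1 - a) / 8 * 1) := by field_simp
      _ ≤ _ := by
        refine mul_le_mul_of_nonneg_left ?_ (by positivity)
        exact mul_le_mul (by linarith) h5 zero_le_one (Real.exp_pos _).le
  refine (mul_le_mul_right (lintegral_mono h2) _).trans ?_
  rw [lintegral_const_mul _ (by fun_prop), lintegral_exp_norm_sq_stdGaussian,
    ← ENNReal.ofReal_mul (by positivity), ← ENNReal.ofReal_mul (by positivity)]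
  refine ENNReal.ofReal_le_ofReal (le_of_eq ?_)
  ring

theorem norm_clip_le {R : ℝ} (hR : 0 ≤ R) (v : E d) : ‖clip R v‖ ≤ R := by
  unfold clip
  split_ifs with h
  · exact h
  · simpa using hR

/-- Clipping at radius `R` does not increase the distance to a point of norm at most `R / 2`. -/
theorem norm_clip_sub_le {R : ℝ} {v u : E d} (hu : ‖u‖ ≤ R / 2) : ‖clip R v - u‖ ≤ ‖v - u‖ := by
  unfold clip
  split_ifs with h
  · exact le_rfl
  · have := norm_sub_norm_le v u
    rw [zero_sub, norm_neg]
    linarith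

/-- The pointwise comparison. With `p, q` the densities and `gp, gq` their gradients, either one of
the scores is large, which is rare, or both are at most `R / 2`; then clipping does not hurt, and
`p (s_p - s_q) = (∇p - ∇q) - (p - q) s_q`. -/
theorem mul_sq_norm_clip_sub_le {R p q : ℝ} (hR : 0 ≤ R) (hp : 0 < p) (hq : 0 < q)
    (v gp gq : E d) :
    q * ‖clip R v - q⁻¹ • gq‖ ^ 2 ≤
      9 * (q * (if R / 2 < ‖q⁻¹ • gq‖ then ‖q⁻¹ • gq‖ ^ 2 else 0)) +
      9 * (p * (if R / 2 < ‖p⁻¹ • gp‖ then ‖p⁻¹ • gp‖ ^ 2 else 0)) +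
      2 * (p * ‖v - p⁻¹ • gp‖ ^ 2) + 4 * R ^ 2 * |p - q| + 2 * R * ‖gp - gq‖ := by
  set sq := q⁻¹ • gq with hsq
  set sp := p⁻¹ • gp with hsp
  have hcl := norm_clip_le hR v
  have hle : ‖clip R v - sq‖ ≤ R + ‖sq‖ := (norm_sub_le _ _).trans (by linarith)
  have t1 : 0 ≤ 9 * (p * (if R / 2 < ‖sp‖ then ‖sp‖ ^ 2 else 0)) := by
    split_ifs <;> positivity
  have t2 : 0 ≤ 2 * (p * ‖v - sp‖ ^ 2) := by positivity
  have t3 : 0 ≤ 4 * R ^ 2 * |p - q| := by positivity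
  have t4 : 0 ≤ 2 * R * ‖gp - gq‖ := by positivity
  by_cases h : R / 2 < ‖sq‖
  · rw [if_pos h]
    have : ‖clip R v - sq‖ ^ 2 ≤ 9 * ‖sq‖ ^ 2 := by
      have := pow_le_pow_left₀ (norm_nonneg _) (hle.trans (by linarith : R + ‖sq‖ ≤ 3 * ‖sq‖)) 2
      linarith
    have := mul_le_mul_of_nonneg_left this hq.le
    linarith
  rw [if_neg h]
  push Not at h
  have h94 : ‖clip R v - sq‖ ^ 2 ≤ 9 / 4 * R ^ 2 := by
    have := pow_le_pow_left₀ (norm_nonneg _) (hle.trans (by linarith : R + ‖sq‖ ≤ 3 / 2 * R)) 2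
    linarith
  have hqp : q * ‖clip R v - sq‖ ^ 2 ≤ p * ‖clip R v - sq‖ ^ 2 + 9 / 4 * R ^ 2 * |p - q| := by
    have e1 : q - p ≤ |p - q| := by rw [abs_sub_comm]; exact le_abs_self _
    have e2 := mul_le_mul_of_nonneg_right e1 (sq_nonneg ‖clip R v - sq‖)
    have e3 := mul_le_mul_of_nonneg_left h94 (abs_nonneg (p - q))
    linarith
  have hRa : 0 ≤ R ^ 2 * |p - q| := by positivity
  by_cases h' : R / 2 < ‖sp‖
  · rw [if_pos h'] at t1 ⊢
    have : ‖clip R v - sq‖ ^ 2 ≤ 9 * ‖sp‖ ^ 2 := by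
      have := pow_le_pow_left₀ (by linarith) h'.le 2
      linarith
    have := mul_le_mul_of_nonneg_left this hp.le
    linarith
  rw [if_neg h']
  push Not at h'
  have hc := norm_clip_sub_le (v := v) h'
  have hpq : ‖sp - sq‖ ≤ R := (norm_sub_le _ _).trans (by linarith)
  have hd : p * ‖sp - sq‖ ≤ ‖gp - gq‖ + |p - q| * (R / 2) := by
    have e : p • (sp - sq) = (gp - gq) - (p - q) • sq := by
      have e1 : p • sp = gp := by rw [hsp, smul_smul, mul_inv_cancel₀ hp.ne', one_smul]
      have e2 : q • sq = gq := by rw [hsq, smul_smul, mul_inv_cancel₀ hq.ne', one_smul]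
      rw [smul_sub, sub_smul, e1, e2]
      abel
    calc p * ‖sp - sq‖ = ‖p • (sp - sq)‖ := by rw [norm_smul, Real.norm_of_nonneg hp.le]
      _ ≤ ‖gp - gq‖ + ‖(p - q) • sq‖ := by rw [e]; exact norm_sub_le _ _
      _ ≤ _ := by
        rw [norm_smul, Real.norm_eq_abs]
        exact add_le_add le_rfl (mul_le_mul_of_nonneg_left h (abs_nonneg _))
  have htri : ‖clip R v - sq‖ ≤ ‖v - sp‖ + ‖sp - sq‖ := by
    have := norm_sub_le_norm_sub_add_norm_sub (clip R v) sp sq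
    linarith
  have hsq2 : ‖clip R v - sq‖ ^ 2 ≤ 2 * ‖v - sp‖ ^ 2 + 2 * (R * ‖sp - sq‖) := by
    have e1 := pow_le_pow_left₀ (norm_nonneg _) htri 2
    have e2 : ‖sp - sq‖ ^ 2 ≤ R * ‖sp - sq‖ := by
      rw [pow_two]; exact mul_le_mul_of_nonneg_right hpq (norm_nonneg _)
    nlinarith [sq_nonneg (‖v - sp‖ - ‖sp - sq‖)]
  have e3 := mul_le_mul_of_nonneg_left hsq2 hp.le
  have e4 := mul_le_mul_of_nonneg_left hd hR
  nlinarith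

/-- The error of the clipped score estimates as estimates of the score of `ρ'`, when they were
trained for the score of a nearby `ρ`. -/
theorem lintegral_clip_sub_score_le {ρ ρ' : Measure (E d)} [IsProbabilityMeasure ρ]
    [IsProbabilityMeasure ρ'] {ε : ℝ} (h : tvDist ρ ρ' ≤ ε) (ha : a < 1) {R : ℝ}
    (hR : Real.sqrt d / Real.sqrt (1 - a) ≤ R) {s : E d → E d} (hs : Measurable s) :
    ∫⁻ x, ENNReal.ofReal (‖clip R (s x) - score ρ' a x‖ ^ 2) ∂(forwardLaw ρ' a) ≤
      2 * ∫⁻ x, ENNReal.ofReal (‖s x - score ρ a x‖ ^ 2) ∂(forwardLaw ρ a) +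
      ENNReal.ofReal (12 * R ^ 2 * ε) +
      ENNReal.ofReal (576 / (1 - a) *
        (Real.sqrt 2 ^ d * Real.exp (-(R ^ 2 * (1 - a)) / 128))) := by
  have hR0 : 0 ≤ R := le_trans (by positivity) hR
  have hv : 0 < 1 - a := by linarith
  have hε : 0 ≤ ε := (abs_nonneg _).trans ((abs_real_sub_le_tvDist ρ ρ' .empty).trans h)
  have hsp : Measurable (score ρ a) := measurable_score ha
  have hsq : Measurable (score ρ' a) := measurable_score ha
  have hpm := (continuous_forwardDensity ρ ha).measurable
  have hqm := (continuous_forwardDensity ρ' ha).measurable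
  have hcm : Measurable fun x => clip R (s x) := by
    unfold clip
    exact Measurable.ite (measurableSet_le hs.norm measurable_const) hs measurable_const
  obtain ⟨hL1, hL2⟩ := lintegral_abs_sub_forwardDensity_le h ha
  have hR4 : 2 * (R / 4) = R / 2 := by ring
  have hT := lintegral_sq_score_indicator_le (ρ := ρ) ha (by positivity : 0 ≤ R / 4)
  have hT' := lintegral_sq_score_indicator_le (ρ := ρ') ha (by positivity : 0 ≤ R / 4)
  rw [hR4] at hT hT'
  set δ := 32 / (1 - a) * (Real.sqrt 2 ^ d * Real.exp (-((R / 4) ^ 2 * (1 - a)) / 8)) with hδ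
  have hδ0 : 0 ≤ δ := by positivity
  have m1 : Measurable fun x => ENNReal.ofReal (‖clip R (s x) - score ρ' a x‖ ^ 2) :=
    ((hcm.sub hsq).norm.pow_const 2).ennreal_ofReal
  have m2 : Measurable fun x => ENNReal.ofReal (‖s x - score ρ a x‖ ^ 2) :=
    ((hs.sub hsp).norm.pow_const 2).ennreal_ofReal
  rw [lintegral_forwardLaw ha m1, lintegral_forwardLaw ha m2]
  set p := forwardDensity ρ a
  set q := forwardDensity ρ' a
  set Ip : E d → ℝ := fun x => p x * (if R / 2 < ‖score ρ a x‖ then ‖score ρ a x‖ ^ 2 else 0)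
    with hIp
  set Iq : E d → ℝ := fun x => q x * (if R / 2 < ‖score ρ' a x‖ then ‖score ρ' a x‖ ^ 2 else 0)
    with hIq
  have hpt : ∀ x, ENNReal.ofReal (q x) * ENNReal.ofReal (‖clip R (s x) - score ρ' a x‖ ^ 2) ≤
      ENNReal.ofReal 9 * ENNReal.ofReal (Iq x) + (ENNReal.ofReal 9 * ENNReal.ofReal (Ip x) +
      (ENNReal.ofReal 2 * (ENNReal.ofReal (p x) * ENNReal.ofReal (‖s x - score ρ a x‖ ^ 2)) +
      (ENNReal.ofReal (4 * R ^ 2) * ENNReal.ofReal |p x - q x| +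
      ENNReal.ofReal (2 * R) * ENNReal.ofReal ‖gradDensity ρ a x - gradDensity ρ' a x‖))) := by
    intro x
    have hp := forwardDensity_pos (ρ := ρ) ha x
    have hq := forwardDensity_pos (ρ := ρ') ha x
    have key := mul_sq_norm_clip_sub_le hR0 hp hq (s x) (gradDensity ρ a x) (gradDensity ρ' a x)
    rw [← score_eq ha, ← score_eq ha] at key
    have i1 : 0 ≤ Iq x := mul_nonneg hq.le (by split_ifs <;> positivity)
    have i2 : 0 ≤ Ip x := mul_nonneg hp.le (by split_ifs <;> positivity)
    rw [← ENNReal.ofReal_mul hq.le, ← ENNReal.ofReal_mul hp.le,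
      ← ENNReal.ofReal_mul (by norm_num), ← ENNReal.ofReal_mul (by norm_num),
      ← ENNReal.ofReal_mul (by norm_num), ← ENNReal.ofReal_mul (by positivity),
      ← ENNReal.ofReal_mul (by positivity),
      ← ENNReal.ofReal_add (by positivity) (by positivity),
      ← ENNReal.ofReal_add (by have := hp.le; positivity) (by positivity),
      ← ENNReal.ofReal_add (by positivity) (by have := hp.le; positivity),
      ← ENNReal.ofReal_add (by positivity) (by have := hp.le; positivity)]
    refine ENNReal.ofReal_le_ofReal (key.trans (le_of_eq ?_))
    simp only [hIp, hIq]
    ring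
  have mIq : Measurable Iq := hqm.mul (Measurable.ite (measurableSet_lt measurable_const hsq.norm)
    (hsq.norm.pow_const 2) measurable_const)
  have mIp : Measurable Ip := hpm.mul (Measurable.ite (measurableSet_lt measurable_const hsp.norm)
    (hsp.norm.pow_const 2) measurable_const)
  have mE : Measurable fun x => ENNReal.ofReal (p x) *
      ENNReal.ofReal (‖s x - score ρ a x‖ ^ 2) :=
    hpm.ennreal_ofReal.mul m2
  have mA : Measurable fun x => ENNReal.ofReal |p x - q x| := (hpm.sub hqm).norm.ennreal_ofReal
  have mG : Measurable fun x => ENNReal.ofReal ‖gradDensity ρ a x - gradDensity ρ' a x‖ :=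
    ((measurable_gradDensity ρ a).sub (measurable_gradDensity ρ' a)).norm.ennreal_ofReal
  refine (lintegral_mono hpt).trans ?_
  rw [lintegral_add_left (mIq.ennreal_ofReal.const_mul _),
    lintegral_add_left (mIp.ennreal_ofReal.const_mul _), lintegral_add_left (mE.const_mul _),
    lintegral_add_left (mA.const_mul _), lintegral_const_mul _ mIq.ennreal_ofReal,
    lintegral_const_mul _ mIp.ennreal_ofReal, lintegral_const_mul _ mE, lintegral_const_mul _ mA,
    lintegral_const_mul _ mG, ENNReal.ofReal_ofNat 2]
  have b : ENNReal.ofReal 9 * ENNReal.ofReal δ + (ENNReal.ofReal 9 * ENNReal.ofReal δ +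
      (ENNReal.ofReal (4 * R ^ 2) * ENNReal.ofReal (2 * ε) + ENNReal.ofReal (2 * R) *
        ENNReal.ofReal (2 * ε * (Real.sqrt d / Real.sqrt (1 - a))))) ≤
      ENNReal.ofReal (12 * R ^ 2 * ε) + ENNReal.ofReal (576 / (1 - a) *
        (Real.sqrt 2 ^ d * Real.exp (-(R ^ 2 * (1 - a)) / 128))) := by
    have e : 576 / (1 - a) * (Real.sqrt 2 ^ d * Real.exp (-(R ^ 2 * (1 - a)) / 128)) = 18 * δ := by
      rw [hδ, show -((R / 4) ^ 2 * (1 - a)) / 8 = -(R ^ 2 * (1 - a)) / 128 by ring]; ring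
    rw [e, ← ENNReal.ofReal_mul (by positivity), ← ENNReal.ofReal_mul (by positivity),
      ← ENNReal.ofReal_mul (by positivity), ← ENNReal.ofReal_add (by positivity) (by positivity),
      ← ENNReal.ofReal_add (by positivity) (by positivity),
      ← ENNReal.ofReal_add (by positivity) (by positivity),
      ← ENNReal.ofReal_add (by positivity) (by positivity)]
    refine ENNReal.ofReal_le_ofReal ?_
    have : R * ε * (Real.sqrt d / Real.sqrt (1 - a)) ≤ R * ε * R :=
      mul_le_mul_of_nonneg_left hR (by positivity)
    linarith
  calc _ ≤ ENNReal.ofReal 9 * ENNReal.ofReal δ + (ENNReal.ofReal 9 * ENNReal.ofReal δ +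
      (2 * (∫⁻ x, ENNReal.ofReal (p x) * ENNReal.ofReal (‖s x - score ρ a x‖ ^ 2)) +
      (ENNReal.ofReal (4 * R ^ 2) * ENNReal.ofReal (2 * ε) + ENNReal.ofReal (2 * R) *
        ENNReal.ofReal (2 * ε * (Real.sqrt d / Real.sqrt (1 - a)))))) := by
        gcongr
    _ = 2 * (∫⁻ x, ENNReal.ofReal (p x) * ENNReal.ofReal (‖s x - score ρ a x‖ ^ 2)) +
      (ENNReal.ofReal 9 * ENNReal.ofReal δ + (ENNReal.ofReal 9 * ENNReal.ofReal δ +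
      (ENNReal.ofReal (4 * R ^ 2) * ENNReal.ofReal (2 * ε) + ENNReal.ofReal (2 * R) *
        ENNReal.ofReal (2 * ε * (Real.sqrt d / Real.sqrt (1 - a)))))) := by ring
    _ ≤ _ := by rw [add_assoc]; exact add_le_add le_rfl b

end ScoreComparison

/-! ### The learning rate schedule -/

section Schedule

variable {c₀ c₁ : ℝ} {T : ℕ}

theorem alphaBarRev_succ (c₀ c₁ : ℝ) (T n : ℕ) : alphaBarRev c₀ c₁ T (n + 1) =
    alphaBarRev c₀ c₁ T n *
      (1 + c₁ * (Real.log T / T) * (1 - alphaBarRev c₀ c₁ T n)) := by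
  rw [alphaBarRev]; ring

theorem one_sub_alphaBarRev_succ (c₀ c₁ : ℝ) (T n : ℕ) : 1 - alphaBarRev c₀ c₁ T (n + 1) =
    (1 - alphaBarRev c₀ c₁ T n) *
      (1 - c₁ * (Real.log T / T) * alphaBarRev c₀ c₁ T n) := by
  rw [alphaBarRev]; ring

theorem alphaBarRev_mem (hT : 2 ≤ T) (hc₀ : 0 < c₀) (hl0 : 0 ≤ c₁ * (Real.log T / T))
    (hl1 : c₁ * (Real.log T / T) ≤ 1 / 2) (n : ℕ) :
    0 < alphaBarRev c₀ c₁ T n ∧ alphaBarRev c₀ c₁ T n < 1 := by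
  have hT1 : (1 : ℝ) < T := by exact_mod_cast hT
  induction n with
  | zero =>
    have h1 : 1 < (T : ℝ) ^ c₀ := Real.one_lt_rpow hT1 hc₀
    rw [alphaBarRev]
    exact ⟨by positivity, (div_lt_one (by linarith)).2 h1⟩
  | succ n ih =>
    obtain ⟨h0, h1⟩ := ih
    constructor
    · rw [alphaBarRev_succ]
      have : 0 ≤ 1 - alphaBarRev c₀ c₁ T n := by linarith
      positivity
    · have := one_sub_alphaBarRev_succ c₀ c₁ T n
      have h2 : 0 < 1 - c₁ * (Real.log T / T) * alphaBarRev c₀ c₁ T n := by nlinarith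
      have := mul_pos (sub_pos.2 h1) h2
      linarith

/-- The odds of `alphaBarRev` grow at least geometrically. -/
theorem odds_alphaBarRev (hT : 2 ≤ T) (hc₀ : 0 < c₀) (hl0 : 0 ≤ c₁ * (Real.log T / T))
    (hl1 : c₁ * (Real.log T / T) ≤ 1 / 2) (n : ℕ) :
    (1 - alphaBarRev c₀ c₁ T n) *
      (alphaBarRev c₀ c₁ T 0 * (1 + c₁ * (Real.log T / T)) ^ n) ≤ alphaBarRev c₀ c₁ T n := by
  induction n with
  | zero =>
    have := alphaBarRev_mem (c₁ := c₁) hT hc₀ hl0 hl1 0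
    rw [pow_zero, mul_one]
    nlinarith
  | succ n ih =>
    obtain ⟨h0, h1⟩ := alphaBarRev_mem (c₁ := c₁) hT hc₀ hl0 hl1 n
    rw [one_sub_alphaBarRev_succ, alphaBarRev_succ _ _ _ n, pow_succ]
    set l := c₁ * (Real.log T / T)
    set s := alphaBarRev c₀ c₁ T n
    have h2 : 0 ≤ (1 - l * s) * (1 + l) := mul_nonneg (by nlinarith) (by linarith)
    have h3 := mul_le_mul_of_nonneg_right ih h2
    have h4 : s * ((1 - l * s) * (1 + l)) ≤ s * (1 + l * (1 - s)) := by
      refine mul_le_mul_of_nonneg_left ?_ h0.le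
      nlinarith [mul_nonneg (sq_nonneg l) h0.le]
    linarith

theorem exp_two_thirds_le {l : ℝ} (h0 : 0 ≤ l) (h1 : l ≤ 1 / 2) :
    Real.exp (2 / 3 * l) ≤ 1 + l := by
  have h := Real.add_one_le_exp (-(2 / 3 * l))
  have h2 : Real.exp (2 / 3 * l) * Real.exp (-(2 / 3 * l)) = 1 := by
    rw [← Real.exp_add]; simp
  have h3 := mul_le_mul_of_nonneg_left h (Real.exp_pos (2 / 3 * l)).le
  have h4 : 1 ≤ (1 + l) * (1 - 2 / 3 * l) := by nlinarith
  have h5 : 0 < 1 - 2 / 3 * l := by linarith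
  have h6 : Real.exp (2 / 3 * l) * (1 - 2 / 3 * l) ≤ (1 + l) * (1 - 2 / 3 * l) := by linarith
  exact le_of_mul_le_mul_right h6 h5

/-- The forward process at time `1` is polynomially close to the target. -/
theorem one_sub_alphaBarRev_last_le (hT : 2 ≤ T) (hc₀ : 0 < c₀)
    (hl0 : 0 ≤ c₁ * (Real.log T / T)) (hl1 : c₁ * (Real.log T / T) ≤ 1 / 2) :
    1 - alphaBarRev c₀ c₁ T (T - 1) ≤ (T : ℝ) ^ (c₀ - c₁ / 3) := by
  have hT2 : (2 : ℝ) ≤ T := by exact_mod_cast hT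
  have hT0 : (0 : ℝ) < T := by linarith
  have h := odds_alphaBarRev hT hc₀ hl0 hl1 (T - 1)
  obtain ⟨h0, h1⟩ := alphaBarRev_mem (c₁ := c₁) hT hc₀ hl0 hl1 (T - 1)
  set s := alphaBarRev c₀ c₁ T (T - 1)
  set l := c₁ * (Real.log T / T) with hl
  have h2 : (T : ℝ) ^ (c₁ / 3) ≤ (1 + l) ^ (T - 1) := by
    refine le_trans ?_ (pow_le_pow_left₀ (Real.exp_pos _).le (exp_two_thirds_le hl0 hl1) _)
    rw [← Real.exp_nat_mul, Real.rpow_def_of_pos hT0]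
    refine Real.exp_le_exp.2 ?_
    rw [Nat.cast_sub (by omega), Nat.cast_one]
    have e : l * T = c₁ * Real.log T := by rw [hl]; field_simp
    nlinarith
  have h3 : alphaBarRev c₀ c₁ T 0 = (T : ℝ) ^ (-c₀) := by
    rw [alphaBarRev, Real.rpow_neg hT0.le, one_div]
  rw [h3] at h
  have h4 : (T : ℝ) ^ (-(c₀ - c₁ / 3)) ≤ (T : ℝ) ^ (-c₀) * (1 + l) ^ (T - 1) := by
    rw [show -(c₀ - c₁ / 3) = -c₀ + c₁ / 3 by ring, Real.rpow_add hT0]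
    exact mul_le_mul_of_nonneg_left h2 (by positivity)
  have h5 := mul_le_mul_of_nonneg_left h4 (by linarith : 0 ≤ 1 - s)
  rw [Real.rpow_neg hT0.le] at h5
  have hp : 0 < (T : ℝ) ^ (c₀ - c₁ / 3) := by positivity
  have h6 : (1 - s) * ((T : ℝ) ^ (c₀ - c₁ / 3))⁻¹ ≤ 1 := by linarith
  rwa [mul_inv_le_iff₀ hp, one_mul] at h6

theorem alphaBar_sub {n : ℕ} (hn : n < T) :
    alphaBar c₀ c₁ T (T - n) = alphaBarRev c₀ c₁ T n := by
  rw [alphaBar, if_neg (by omega), Nat.sub_sub_self hn.le]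

theorem alpha_sub {n : ℕ} (hn : n + 1 < T) :
    alpha c₀ c₁ T (T - n) = alphaBarRev c₀ c₁ T n / alphaBarRev c₀ c₁ T (n + 1) := by
  rw [alpha, alphaBar_sub (by omega), Nat.sub_sub, alphaBar_sub hn]

/-- The step size `1 - α` in terms of the cumulative learning rates. -/
theorem alpha_facts (hT : 2 ≤ T) (hc₀ : 0 < c₀) (hl0 : 0 < c₁ * (Real.log T / T))
    (hl1 : c₁ * (Real.log T / T) ≤ 1 / 2) {n : ℕ} (hn : n + 1 < T) :
    1 / 2 ≤ alpha c₀ c₁ T (T - n) ∧ alpha c₀ c₁ T (T - n) < 1 ∧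
      1 - alpha c₀ c₁ T (T - n) ≤ c₁ * (Real.log T / T) ∧
      (1 - alpha c₀ c₁ T (T - n)) / alpha c₀ c₁ T (T - n) =
        c₁ * (Real.log T / T) * (1 - alphaBarRev c₀ c₁ T n) ∧
      alpha c₀ c₁ T (T - n) * alphaBarRev c₀ c₁ T (n + 1) = alphaBarRev c₀ c₁ T n := by
  obtain ⟨h0, h1⟩ := alphaBarRev_mem (c₁ := c₁) hT hc₀ hl0.le hl1 n
  have hb := (alphaBarRev_mem (c₁ := c₁) hT hc₀ hl0.le hl1 (n + 1)).1
  rw [alpha_sub hn]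
  have e := alphaBarRev_succ c₀ c₁ T n
  set l := c₁ * (Real.log T / T)
  set s := alphaBarRev c₀ c₁ T n
  set b := alphaBarRev c₀ c₁ T (n + 1)
  have hx : 0 < l * (1 - s) := mul_pos hl0 (by linarith)
  have hxl : l * (1 - s) ≤ l := by nlinarith
  have er : s / b = 1 / (1 + l * (1 - s)) := by rw [e]; field_simp
  have hp : 0 < 1 + l * (1 - s) := by linarith
  refine ⟨?_, ?_, ?_, ?_, div_mul_cancel₀ _ hb.ne'⟩
  · rw [er, div_le_div_iff₀ (by norm_num) hp]; linarith
  · rw [er, div_lt_one hp]; linarith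
  · rw [er, sub_le_comm, le_div_iff₀ hp]; nlinarith
  · rw [er]; field_simp; ring

end Schedule

/-! ### Closeness of Gaussian mixtures with the same weights -/

section Mixtures

open InformationTheory

variable {K d : ℕ} {w : Fin K → ℝ}

/-- The law of the labels of the mixture. -/
def labelLaw (w : Fin K → ℝ) : Measure (Fin K) := ∑ k, ENNReal.ofReal (w k) • Measure.dirac k

theorem lintegral_labelLaw (w : Fin K → ℝ) (f : Fin K → ENNReal) :
    ∫⁻ k, f k ∂(labelLaw w) = ∑ k, ENNReal.ofReal (w k) * f k := by
  rw [labelLaw, lintegral_finsetSum_measure]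
  refine Finset.sum_congr rfl fun k _ => ?_
  rw [lintegral_smul_measure, lintegral_dirac, smul_eq_mul]

theorem isProbabilityMeasure_labelLaw (hw : ∀ k, 0 < w k) (hw1 : ∑ k, w k = 1) :
    IsProbabilityMeasure (labelLaw w) := ⟨by
  have h := lintegral_labelLaw w fun _ => 1
  rw [lintegral_one] at h
  rw [h]
  simp only [mul_one]
  rw [← ENNReal.ofReal_sum_of_nonneg fun k _ => (hw k).le, hw1, ENNReal.ofReal_one]⟩

/-- A mixture is one Gaussian step from its labels, so that `klDiv_gaussStep_le` applies to it. -/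
theorem gmm_eq_gaussStep (hw : ∀ k, 0 < w k) (hw1 : ∑ k, w k = 1) (m : Fin K → E d) :
    gmm w m = gaussStep m 1 (labelLaw w) := by
  have := isProbabilityMeasure_labelLaw hw hw1
  refine Measure.ext_of_lintegral _ fun f hf => ?_
  have hm : Measurable m := measurable_of_countable m
  have hfm : Measurable fun p : Fin K × E d => f (m p.1 + (1 : ℝ) • p.2) := hf.comp (by fun_prop)
  rw [lintegral_gmm _ _ hf, gaussStep, lintegral_map hf (by fun_prop),
    lintegral_prod _ hfm.aemeasurable, lintegral_labelLaw]
  simp only [one_smul]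

theorem klDiv_gmm_le (hw : ∀ k, 0 < w k) (hw1 : ∑ k, w k = 1) {m m' : Fin K → E d} {D : ℝ}
    (h : ∀ k, ‖m k - m' k‖ ^ 2 ≤ D) :
    klDiv (gmm w m) (gmm w m') ≤ ENNReal.ofReal (D / 2) := by
  have := isProbabilityMeasure_labelLaw hw hw1
  rw [gmm_eq_gaussStep hw hw1, gmm_eq_gaussStep hw hw1]
  refine (klDiv_gaussStep_le (measurable_of_countable m) (measurable_of_countable m') one_pos
    _ _).trans ?_
  rw [klDiv_self, zero_add]
  have : ∀ k, ENNReal.ofReal (‖m k - m' k‖ ^ 2 / (2 * 1 ^ 2)) ≤ ENNReal.ofReal (D / 2) :=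
    fun k => ENNReal.ofReal_le_ofReal (by have := h k; linarith)
  refine (lintegral_mono this).trans (le_of_eq ?_)
  rw [lintegral_const, measure_univ, mul_one]

theorem tvDist_gmm_le (hw : ∀ k, 0 < w k) (hw1 : ∑ k, w k = 1) {m m' : Fin K → E d} {D : ℝ}
    (hD : 0 ≤ D) (h : ∀ k, ‖m k - m' k‖ ≤ D) : tvDist (gmm w m) (gmm w m') ≤ D := by
  have := isProbabilityMeasure_gmm hw hw1 m
  have := isProbabilityMeasure_gmm hw hw1 m'
  have hk := klDiv_gmm_le hw hw1 fun k => pow_le_pow_left₀ (norm_nonneg _) (h k) 2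
  refine tvDist_le_of_forall_le fun A hA => ?_
  refine (real_le_add_sqrt_klDiv (by simp) (hk.trans_lt ENNReal.ofReal_lt_top).ne hA).trans ?_
  have h2 := ENNReal.toReal_le_of_le_ofReal (by positivity) hk
  refine add_le_add le_rfl ?_
  refine (Real.sqrt_le_sqrt (by linarith : 2 * (klDiv (gmm w m) (gmm w m')).toReal ≤ D ^ 2)).trans ?_
  rw [Real.sqrt_sq hD]

theorem gmm_zero (hw : ∀ k, 0 < w k) (hw1 : ∑ k, w k = 1) :
    gmm w (fun _ => (0 : E d)) = stdGaussian (E d) := by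
  refine Measure.ext_of_lintegral _ fun f hf => ?_
  rw [lintegral_gmm _ _ hf]
  simp only [zero_add]
  rw [← Finset.sum_mul, ← ENNReal.ofReal_sum_of_nonneg fun k _ => (hw k).le, hw1,
    ENNReal.ofReal_one, one_mul]

end Mixtures

/-! ### The error of the sampler -/

section Sampler

open InformationTheory

variable {c₀ c₁ Cclip : ℝ} {d K T : ℕ} {w : Fin K → ℝ} {μ : Fin K → E d} {s : ℕ → E d → E d}

/-- The mean squared error of the score estimate `s t` in the forward process from `ρ`. -/
def stepScoreError (c₀ c₁ : ℝ) (T : ℕ) (ρ : Measure (E d)) (s : ℕ → E d → E d) (t : ℕ) : ENNReal :=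
  ∫⁻ x, ENNReal.ofReal (‖s t x - score ρ (alphaBar c₀ c₁ T t) x‖ ^ 2)
    ∂(forwardLaw ρ (alphaBar c₀ c₁ T t))

theorem sum_stepScoreError_le (hT : 2 ≤ T) {ρ : Measure (E d)} {εscore : ℝ}
    (h : scoreError c₀ c₁ T ρ s ≤ ENNReal.ofReal (εscore ^ 2)) :
    ∑ n ∈ Finset.range (T - 1), stepScoreError c₀ c₁ T ρ s (T - n) ≤
      ENNReal.ofReal (T * εscore ^ 2) := by
  have h1 : ∑ t ∈ Finset.Icc 1 T, stepScoreError c₀ c₁ T ρ s t ≤ ENNReal.ofReal (T * εscore ^ 2) := by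
    rw [ENNReal.ofReal_mul (Nat.cast_nonneg T), ENNReal.ofReal_natCast]
    unfold scoreError at h
    rw [ENNReal.div_le_iff (by simp; omega) (by simp), mul_comm] at h
    exact h
  refine le_trans ?_ h1
  have hinj : Set.InjOn (fun n => T - n) (Finset.range (T - 1) : Set ℕ) := by
    intro i hi j hj hij
    simp only [Finset.coe_range, Set.mem_Iio] at hi hj
    simp only [] at hij
    omega
  rw [← Finset.sum_image (f := stepScoreError c₀ c₁ T ρ s) hinj]
  refine Finset.sum_le_sum_of_subset fun t ht => ?_
  simp only [Finset.mem_image, Finset.mem_range] at ht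
  obtain ⟨n, hn, rfl⟩ := ht
  rw [Finset.mem_Icc]
  omega

theorem measurable_clippedScore {t : ℕ} (hs : Measurable (s t)) :
    Measurable (clippedScore c₀ c₁ Cclip T s t) := by
  unfold clippedScore clip
  exact Measurable.ite (measurableSet_le hs.norm measurable_const) hs measurable_const

/-- The deterministic part of a sampler step that uses `g` in place of the score. -/
def stepMap (r : ℝ) (g : E d → E d) (x : E d) : E d := (1 / Real.sqrt r) • (x + (1 - r) • g x)

theorem ddpmStep_eq_gaussStep (r : ℝ) (g : E d → E d) (ν : Measure (E d)) :
    ddpmStep r g ν = gaussStep (stepMap r g) (Real.sqrt (1 - r)) ν := rfl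

theorem measurable_stepMap (r : ℝ) {g : E d → E d} (hg : Measurable g) :
    Measurable (stepMap r g) := by
  unfold stepMap
  fun_prop

theorem norm_sq_stepMap_sub {r : ℝ} (h0 : 0 < r) (h1 : r < 1) (g g' : E d → E d) (x : E d) :
    ‖stepMap r g x - stepMap r g' x‖ ^ 2 / (2 * Real.sqrt (1 - r) ^ 2) =
      (1 - r) / r / 2 * ‖g' x - g x‖ ^ 2 := by
  have e : stepMap r g x - stepMap r g' x = ((1 / Real.sqrt r) * (1 - r)) • (g x - g' x) := by
    unfold stepMap; module
  have h2 : 0 < 1 - r := by linarith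
  rw [e, norm_smul, mul_pow, norm_sub_rev, Real.norm_of_nonneg (by positivity), mul_pow, div_pow,
    Real.sq_sqrt h0.le, Real.sq_sqrt h2.le]
  field_simp

theorem log_two_le_log_mul (hd : 1 ≤ d) (hT : 2 ≤ T) : Real.log 2 ≤ Real.log (d * T) := by
  have h1 : (1 : ℝ) ≤ d := by exact_mod_cast hd
  have h2 : (2 : ℝ) ≤ T := by exact_mod_cast hT
  exact Real.log_le_log (by norm_num) (by nlinarith)

theorem log_le_log_mul (hd : 1 ≤ d) (hT : 2 ≤ T) : Real.log T ≤ Real.log (d * T) := by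
  have h1 : (1 : ℝ) ≤ d := by exact_mod_cast hd
  have h2 : (2 : ℝ) ≤ T := by exact_mod_cast hT
  exact Real.log_le_log (by linarith) (by nlinarith)

/-- With a large clipping constant, the Gaussian tail beyond the clipping radius is
polynomially small. -/
theorem sqrt_two_pow_mul_exp_le (hd : 1 ≤ d) (hT : 2 ≤ T) (hC : 32 ≤ Cclip) :
    Real.sqrt 2 ^ d * Real.exp (-(Cclip ^ 2 * (d * Real.log (d * T))) / 128) ≤
      ((T : ℝ) ^ 2)⁻¹ := by
  have h1 : (1 : ℝ) ≤ d := by exact_mod_cast hd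
  have hT0 : (0 : ℝ) < T := by have : (2 : ℝ) ≤ T := by exact_mod_cast hT
                               linarith
  have h2 := log_two_le_log_mul hd hT
  have h3 := log_le_log_mul hd hT
  have hl2 := Real.log_two_gt_d9
  have e1 : Real.sqrt 2 = Real.exp (Real.log 2 / 2) := by
    rw [Real.exp_half, Real.exp_log two_pos]
  have e2 : ((T : ℝ) ^ 2)⁻¹ = Real.exp (-(2 * Real.log T)) := by
    rw [Real.exp_neg, mul_comm, Real.exp_mul, Real.exp_log hT0]; norm_cast
  rw [e1, e2, ← Real.exp_nat_mul, ← Real.exp_add]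
  refine Real.exp_le_exp.2 ?_
  set X := Real.log (d * T)
  have hX : 0 ≤ X := by linarith
  have hC2 : 1024 ≤ Cclip ^ 2 := by nlinarith
  have hdX : X ≤ d * X := by nlinarith
  have hdX2 : (d : ℝ) * Real.log 2 ≤ d * X := mul_le_mul_of_nonneg_left h2 (by linarith)
  have : 1024 * (d * X) ≤ Cclip ^ 2 * (d * X) := mul_le_mul_of_nonneg_right hC2 (by linarith)
  linarith

/-- The divergence added by one step of the sampler. -/
theorem lintegral_stepMap_le (hd : 1 ≤ d) (hT : 2 ≤ T) (hc₀ : 0 < c₀)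
    (hl0 : 0 < c₁ * (Real.log T / T)) (hl1 : c₁ * (Real.log T / T) ≤ 1 / 2) (hC : 32 ≤ Cclip)
    {ρ : Measure (E d)} [IsProbabilityMeasure ρ] (hw : ∀ k, 0 < w k) (hw1 : ∑ k, w k = 1)
    {ε : ℝ} (hε : tvDist ρ (gmm w μ) ≤ ε) {n : ℕ} (hn : n + 1 < T)
    (hs : Measurable (s (T - n))) :
    ∫⁻ x, ENNReal.ofReal (‖stepMap (alpha c₀ c₁ T (T - n))
          (score (gmm w μ) (alphaBarRev c₀ c₁ T n)) x -
        stepMap (alpha c₀ c₁ T (T - n)) (clippedScore c₀ c₁ Cclip T s (T - n)) x‖ ^ 2 /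
        (2 * Real.sqrt (1 - alpha c₀ c₁ T (T - n)) ^ 2))
        ∂(forwardLaw (gmm w μ) (alphaBarRev c₀ c₁ T n)) ≤
      ENNReal.ofReal (c₁ * (Real.log T / T)) * stepScoreError c₀ c₁ T ρ s (T - n) +
      ENNReal.ofReal (c₁ * (Real.log T / T) *
        (6 * Cclip ^ 2 * (d * Real.log (d * T)) * ε + 288 * ((T : ℝ) ^ 2)⁻¹)) := by
  have := isProbabilityMeasure_gmm hw hw1 μ
  obtain ⟨ha0, ha1⟩ := alphaBarRev_mem (c₁ := c₁) hT hc₀ hl0.le hl1 n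
  obtain ⟨hr0, hr1, -, hr3, -⟩ := alpha_facts hT hc₀ hl0 hl1 hn
  have hε0 : 0 ≤ ε := (abs_nonneg _).trans ((abs_real_sub_le_tvDist ρ (gmm w μ) .empty).trans hε)
  have htail := sqrt_two_pow_mul_exp_le hd hT hC
  have hX := log_two_le_log_mul hd hT
  have hl2 := Real.log_two_gt_d9
  have hd1 : (1 : ℝ) ≤ d := by exact_mod_cast hd
  simp_rw [norm_sq_stepMap_sub (by linarith : 0 < alpha c₀ c₁ T (T - n)) hr1, hr3]
  unfold stepScoreError clippedScore
  rw [alphaBar_sub (by omega : n < T)]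
  set l := c₁ * (Real.log T / T)
  set a := alphaBarRev c₀ c₁ T n
  set X := Real.log (d * T)
  have hX0 : 0 < X := by linarith
  have hv : 0 < 1 - a := by linarith
  set R := Cclip * Real.sqrt (d * X / (1 - a)) with hR
  have hR2 : R ^ 2 * (1 - a) = Cclip ^ 2 * (d * X) := by
    rw [hR, mul_pow, Real.sq_sqrt (by positivity)]
    field_simp
  have hRle : Real.sqrt d / Real.sqrt (1 - a) ≤ R := by
    rw [← Real.sqrt_div (by positivity), hR]
    have e : Real.sqrt (d / (1 - a)) ≤ Real.sqrt (4 * (d * X / (1 - a))) := by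
      refine Real.sqrt_le_sqrt ?_
      rw [← mul_div_assoc]
      refine div_le_div_of_nonneg_right ?_ hv.le
      nlinarith
    refine e.trans ?_
    rw [Real.sqrt_mul (by norm_num), show (4 : ℝ) = 2 ^ 2 by norm_num,
      Real.sqrt_sq (by norm_num)]
    exact mul_le_mul_of_nonneg_right (by linarith) (Real.sqrt_nonneg _)
  have hsq : Measurable (score (gmm w μ) a) := measurable_score ha1
  have hcm : Measurable fun x => clip R (s (T - n) x) := by
    unfold clip
    exact Measurable.ite (measurableSet_le hs.norm measurable_const) hs measurable_const
  have hm : Measurable fun x =>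
      ENNReal.ofReal (‖clip R (s (T - n) x) - score (gmm w μ) a x‖ ^ 2) :=
    ((hcm.sub hsq).norm.pow_const 2).ennreal_ofReal
  have hlv : 0 ≤ l * (1 - a) / 2 := by positivity
  simp_rw [ENNReal.ofReal_mul hlv]
  rw [lintegral_const_mul _ hm]
  refine (mul_le_mul_right (lintegral_clip_sub_score_le hε ha1 hRle hs) _).trans ?_
  set err := ∫⁻ x, ENNReal.ofReal (‖s (T - n) x - score ρ a x‖ ^ 2) ∂(forwardLaw ρ a)
  rw [add_assoc, mul_add, ← ENNReal.ofReal_add (by positivity) (by positivity),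
    ← ENNReal.ofReal_mul hlv, ← mul_assoc]
  refine add_le_add (mul_le_mul_left ?_ _) (ENNReal.ofReal_le_ofReal ?_)
  · rw [show (2 : ENNReal) = ENNReal.ofReal 2 by simp, ← ENNReal.ofReal_mul hlv]
    refine ENNReal.ofReal_le_ofReal ?_
    nlinarith
  · rw [hR2]
    set τ := Real.sqrt 2 ^ d * Real.exp (-(Cclip ^ 2 * (d * X)) / 128)
    have e : l * (1 - a) / 2 * (12 * R ^ 2 * ε + 576 / (1 - a) * τ) =
        l * (6 * (R ^ 2 * (1 - a)) * ε + 288 * τ) := by field_simp; ring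
    rw [e, hR2]
    refine mul_le_mul_of_nonneg_left ?_ hl0.le
    linarith

theorem isProbabilityMeasure_ddpmLaw (hs : ∀ t ∈ Finset.Icc 1 T, Measurable (s t)) :
    ∀ n < T, IsProbabilityMeasure (ddpmLaw c₀ c₁ Cclip T s n) := by
  intro n
  induction n with
  | zero => exact fun _ => inferInstanceAs (IsProbabilityMeasure (stdGaussian (E d)))
  | succ n ih =>
    intro hn
    have := ih (by omega)
    have hm := measurable_clippedScore (c₀ := c₀) (c₁ := c₁) (Cclip := Cclip) (T := T)
      (hs (T - n) (by rw [Finset.mem_Icc]; omega))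
    rw [ddpmLaw, ddpmStep_eq_gaussStep]
    exact ⟨by rw [gaussStep_univ (measurable_stepMap _ hm), measure_univ]⟩

/-- The bound on the sampler against the forward process of the mixture: local errors of the exact
steps, plus the divergence of the initial laws and of the score errors. -/
theorem tvDist_gmm_ddpmOutput_le (hd : 1 ≤ d) (hT : 2 ≤ T) (hc₀ : 0 < c₀)
    (hl0 : 0 < c₁ * (Real.log T / T)) (hl1 : c₁ * (Real.log T / T) ≤ 1 / 2) (hC : 32 ≤ Cclip)
    {ρ : Measure (E d)} [IsProbabilityMeasure ρ] (hw : ∀ k, 0 < w k) (hw1 : ∑ k, w k = 1)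
    {ε : ℝ} (hε : tvDist ρ (gmm w μ) ≤ ε) {cR : ℝ} (hcR : 2 * cR + 2 ≤ c₀)
    (hμ : ∀ k, ‖μ k‖ ≤ (T : ℝ) ^ cR) (hs : ∀ t ∈ Finset.Icc 1 T, Measurable (s t)) {εscore : ℝ}
    (hsc : scoreError c₀ c₁ T ρ s ≤ ENNReal.ofReal (εscore ^ 2)) :
    tvDist (gmm w fun k => Real.sqrt (alphaBarRev c₀ c₁ T (T - 1)) • μ k)
        (ddpmOutput c₀ c₁ Cclip T s) ≤
      T * (60000 * (1 + Real.log K) ^ 2 * (c₁ * (Real.log T / T)) ^ 2) +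
      Real.sqrt (2 * (((T : ℝ) ^ 2)⁻¹ / 2 + c₁ * Real.log T * εscore ^ 2 +
        c₁ * Real.log T * (6 * Cclip ^ 2 * (d * Real.log (d * T)) * ε +
          288 * ((T : ℝ) ^ 2)⁻¹))) := by
  have hPg := isProbabilityMeasure_gmm hw hw1 μ
  have hT2 : (2 : ℝ) ≤ T := by exact_mod_cast hT
  have hT0 : (0 : ℝ) < T := by linarith
  have hX := log_two_le_log_mul hd hT
  have hlog2 := Real.log_two_gt_d9
  have hε0 : 0 ≤ ε := (abs_nonneg _).trans ((abs_real_sub_le_tvDist ρ (gmm w μ) .empty).trans hε)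
  set l := c₁ * (Real.log T / T) with hl
  have hlT : l * T = c₁ * Real.log T := by rw [hl]; field_simp
  have ha := alphaBarRev_mem (c₀ := c₀) (c₁ := c₁) hT hc₀ hl0.le hl1
  set α : ℕ → ℝ := fun n => alpha c₀ c₁ T (T - n) with hα
  set q : ℕ → Measure (E d) := fun n => forwardLaw (gmm w μ) (alphaBarRev c₀ c₁ T n) with hq
  -- the law of the sampler, frozen after the last step to be defined for all `n`
  set Y : ℕ → Measure (E d) := fun n => ddpmLaw c₀ c₁ Cclip T s (min n (T - 1)) with hY
  have hqp : ∀ n, IsProbabilityMeasure (q n) := fun n => isProbabilityMeasure_forwardLaw _ _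
  have hYp : ∀ n, IsProbabilityMeasure (Y n) := fun n =>
    isProbabilityMeasure_ddpmLaw hs _ (by omega)
  set f : ℕ → E d → E d := fun n => stepMap (α n) (score (gmm w μ) (alphaBarRev c₀ c₁ T n)) with hf
  set f' : ℕ → E d → E d := fun n =>
    stepMap (α n) (clippedScore c₀ c₁ Cclip T s (T - n)) with hf'
  set B := 6 * Cclip ^ 2 * (d * Real.log (d * T)) * ε + 288 * ((T : ℝ) ^ 2)⁻¹ with hB
  have hB0 : 0 ≤ B := by
    have : 0 ≤ Real.log (d * T) := by linarith
    rw [hB]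
    refine add_nonneg (mul_nonneg (mul_nonneg (by positivity) (mul_nonneg ?_ this)) hε0) ?_ <;>
      positivity
  have hcl : 0 ≤ c₁ * Real.log T := by rw [← hlT]; positivity
  have hmem : ∀ n < T - 1, T - n ∈ Finset.Icc 1 T := fun n hn => by
    rw [Finset.mem_Icc]; omega
  -- `q n` is the forward law at the time of step `n`, `f n` the exact and `f' n` the actual step
  have hchain := tvDist_chain_le (q := q) (Y := Y) (f := f) (f' := f')
    (c := fun n => Real.sqrt (1 - α n))
    (η := fun _ => 60000 * (1 + Real.log K) ^ 2 * l ^ 2)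
    (D := ((T : ℝ) ^ 2)⁻¹ / 2 + c₁ * Real.log T * εscore ^ 2 + c₁ * Real.log T * B) (T - 1)
    (fun n hn => measurable_stepMap _ (measurable_score (ha n).2))
    (fun n hn => measurable_stepMap _ (measurable_clippedScore (hs _ (hmem n hn))))
    (fun n hn => Real.sqrt_pos.2 (sub_pos.2 (alpha_facts hT hc₀ hl0 hl1 (by omega)).2.1))
    (fun n hn => by
      simp only [hY]
      rw [min_eq_left (by omega), min_eq_left (by omega), ddpmLaw, ddpmStep_eq_gaussStep])
    (fun n hn A hA => by
      obtain ⟨h1, h2, h3, h4, h5⟩ := alpha_facts hT hc₀ hl0 hl1 (by omega : n + 1 < T)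
      have e1 : gaussStep (f n) (Real.sqrt (1 - α n)) (q n) =
          exactStep w (fun k => Real.sqrt (alphaBarRev c₀ c₁ T (n + 1)) • μ k) (α n) := by
        rw [← ddpmStep_score_gmm hw hw1 μ (by linarith) (ha (n + 1)).1 (by rw [h5]; exact (ha n).2),
          ddpmStep_eq_gaussStep, h5]
      have e2 : q (n + 1) = gmm w fun k => Real.sqrt (alphaBarRev c₀ c₁ T (n + 1)) • μ k :=
        forwardLaw_gmm w hw1 hw μ (ha (n + 1)).1.le (ha (n + 1)).2
      rw [e1, e2]
      refine (abs_gmm_real_sub_exactStep_le hw hw1 _ h1 h2 hA).trans ?_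
      refine mul_le_mul_of_nonneg_left (pow_le_pow_left₀ (by linarith) h3 2) (by positivity))
    (by positivity) (by
      have k0 : klDiv (q 0) (Y 0) ≤ ENNReal.ofReal (((T : ℝ) ^ 2)⁻¹ / 2) := by
        have e1 : q 0 = gmm w fun k => Real.sqrt (alphaBarRev c₀ c₁ T 0) • μ k :=
          forwardLaw_gmm w hw1 hw μ (ha 0).1.le (ha 0).2
        have e2 : Y 0 = gmm w fun _ => (0 : E d) := by
          rw [gmm_zero hw hw1]
          simp only [hY]
          rw [min_eq_left (by omega), ddpmLaw]
        rw [e1, e2]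
        refine klDiv_gmm_le hw hw1 fun k => ?_
        rw [sub_zero, norm_smul, mul_pow, Real.norm_of_nonneg (Real.sqrt_nonneg _),
          Real.sq_sqrt (ha 0).1.le, alphaBarRev]
        have h2 : ‖μ k‖ ^ 2 ≤ (T : ℝ) ^ (2 * cR) := by
          rw [mul_comm, Real.rpow_mul hT0.le, Real.rpow_two]
          exact pow_le_pow_left₀ (norm_nonneg _) (hμ k) 2
        have h3 : (T : ℝ) ^ (2 * cR) * T ^ 2 ≤ (T : ℝ) ^ c₀ := by
          rw [← Real.rpow_two, ← Real.rpow_add hT0]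
          exact Real.rpow_le_rpow_of_exponent_le (by linarith) hcR
        have hp : 0 < (T : ℝ) ^ c₀ := by positivity
        calc 1 / (T : ℝ) ^ c₀ * ‖μ k‖ ^ 2 ≤ 1 / (T : ℝ) ^ c₀ * (T : ℝ) ^ (2 * cR) :=
              mul_le_mul_of_nonneg_left h2 (by positivity)
          _ ≤ _ := by
            rw [one_div, inv_mul_le_iff₀ hp, ← div_eq_mul_inv, le_div_iff₀ (by positivity)]
            exact h3
      have k1 : ∀ n ∈ Finset.range (T - 1), ∫⁻ x, ENNReal.ofReal (‖f n x - f' n x‖ ^ 2 /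
          (2 * Real.sqrt (1 - α n) ^ 2)) ∂(q n) ≤ ENNReal.ofReal l *
            stepScoreError c₀ c₁ T ρ s (T - n) + ENNReal.ofReal (l * B) := fun n hn => by
        have hn' := Finset.mem_range.1 hn
        exact lintegral_stepMap_le hd hT hc₀ hl0 hl1 hC hw hw1 hε (by omega) (hs _ (hmem n hn'))
      refine (add_le_add k0 (Finset.sum_le_sum k1)).trans ?_
      rw [Finset.sum_add_distrib, ← Finset.mul_sum, Finset.sum_const, Finset.card_range,
        nsmul_eq_mul, ENNReal.ofReal_add (by positivity) (by positivity),
        ENNReal.ofReal_add (by positivity) (by positivity), add_assoc]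
      refine add_le_add le_rfl (add_le_add ?_ ?_)
      · refine (mul_le_mul_right (sum_stepScoreError_le hT hsc) _).trans (le_of_eq ?_)
        rw [← ENNReal.ofReal_mul hl0.le, ← mul_assoc, hlT]
      · rw [← ENNReal.ofReal_natCast, ← ENNReal.ofReal_mul (Nat.cast_nonneg _)]
        refine ENNReal.ofReal_le_ofReal ?_
        rw [← hlT, show l * T * B = T * (l * B) by ring]
        refine mul_le_mul_of_nonneg_right ?_ (by positivity)
        exact_mod_cast Nat.sub_le T 1)
  have e1 : q (T - 1) = gmm w fun k => Real.sqrt (alphaBarRev c₀ c₁ T (T - 1)) • μ k :=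
    forwardLaw_gmm w hw1 hw μ (ha (T - 1)).1.le (ha (T - 1)).2
  have e2 : Y (T - 1) = ddpmOutput c₀ c₁ Cclip T s := by
    simp only [hY]
    rw [min_self, ddpmOutput]
  rw [e1, e2] at hchain
  refine hchain.trans (add_le_add ?_ le_rfl)
  rw [Finset.sum_const, Finset.card_range, nsmul_eq_mul]
  refine mul_le_mul_of_nonneg_right ?_ (by positivity)
  exact_mod_cast Nat.sub_le T 1

end Sampler

/-! ### Total error and number of iterations -/

section Bound

variable {c₀ c₁ Cclip : ℝ} {d K T : ℕ} {w : Fin K → ℝ} {μ : Fin K → E d} {s : ℕ → E d → E d}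

theorem log_le_log_mul_and_one_add_log_le (hK : 1 ≤ K) (hT : 2 ≤ T) :
    Real.log T ≤ Real.log (K * T) ∧ 1 + Real.log K ≤ 2 * Real.log (K * T) := by
  have h1 : (1 : ℝ) ≤ K := by exact_mod_cast hK
  have h2 : (2 : ℝ) ≤ T := by exact_mod_cast hT
  have e : Real.log (K * T) = Real.log K + Real.log T := Real.log_mul (by linarith) (by linarith)
  have h3 : Real.log 2 ≤ Real.log T := Real.log_le_log (by norm_num) h2
  have h4 := Real.log_nonneg h1
  have h5 := Real.log_two_gt_d9
  rw [e]
  constructor <;> linarith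

theorem mul_sq_mul_sq_le {k M c L T : ℝ} (hk : 0 ≤ k) (hkM : k ≤ 2 * M) (hT : 0 < T) :
    T * (60000 * k ^ 2 * (c * (L / T)) ^ 2) ≤ 240000 * c ^ 2 * (M ^ 2 * L ^ 2 / T) := by
  have h1 : k ^ 2 ≤ 4 * M ^ 2 := by
    have := pow_le_pow_left₀ hk hkM 2
    linarith
  have e : T * (60000 * k ^ 2 * (c * (L / T)) ^ 2) =
      k ^ 2 * (60000 * c ^ 2 * (L ^ 2 / T)) := by field_simp
  rw [e]
  refine (mul_le_mul_of_nonneg_right h1 (by positivity)).trans (le_of_eq ?_)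
  ring

theorem one_le_and_le_two_mul_mul_sqrt {X : ℝ} (hX : 0.69 ≤ X) :
    1 ≤ 2 * (X * Real.sqrt X) ∧ X ≤ 2 * (X * Real.sqrt X) := by
  have h3 : 0.8 ≤ Real.sqrt X := Real.le_sqrt_of_sq_le (by norm_num; linarith)
  have h4 := mul_le_mul_of_nonneg_left h3 (by linarith : 0 ≤ X)
  constructor <;> linarith

theorem le_sqrt_mul_of_le {t d ε : ℝ} (h0 : 0 ≤ t) (h1 : t ≤ 1) (ht : t ≤ ε) (hd : 1 ≤ d) :
    t ≤ Real.sqrt (d * ε) := by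
  refine Real.le_sqrt_of_sq_le ?_
  calc t ^ 2 ≤ t := pow_le_of_le_one h0 h1 two_ne_zero
    _ ≤ ε := ht
    _ ≤ d * ε := le_mul_of_one_le_left (h0.trans ht) hd

theorem le_sq_mul_sq {L : ℝ} (hL : 0.69 ≤ L) :
    L ≤ 4 * (L ^ 2 * L ^ 2) ∧ 0.22 ≤ L ^ 2 * L ^ 2 := by
  have h2 : 0.47 ≤ L ^ 2 := by nlinarith
  have h4 : 0.22 ≤ L ^ 2 * L ^ 2 := by nlinarith
  have h3 : 0.32 ≤ L * L ^ 2 := by nlinarith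
  refine ⟨?_, h4⟩
  have := mul_le_mul_of_nonneg_left h3 (by linarith : 0 ≤ L)
  nlinarith

theorem add_sq_mul_add_sq_le (a b : ℝ) : (a + b) ^ 2 * (a + b) ^ 2 ≤ 8 * a ^ 4 + 8 * b ^ 4 := by
  have h2 : (a + b) ^ 2 ≤ 2 * a ^ 2 + 2 * b ^ 2 := by nlinarith [sq_nonneg (a - b)]
  have h3 := mul_le_mul h2 h2 (sq_nonneg _) (by positivity)
  nlinarith [sq_nonneg (a ^ 2 - b ^ 2)]

/-- The square root of the accumulated divergence is at most the sum of the square roots of its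
three parts: initialization and clipping, score estimation, and approximation by a mixture. -/
theorem sqrt_divergence_le {c C L X T e d ε : ℝ} (hc1sq : c ≤ c ^ 2) (hc : 1 ≤ c)
    (hC : 1 ≤ C) (hL : 0.69 ≤ L) (hLX : L ≤ X) (hT0 : 0 < T) (he : 0 ≤ e) (hd : 0 ≤ d)
    (hε0 : 0 ≤ ε) :
    Real.sqrt (2 * ((T ^ 2)⁻¹ / 2 + c * L * e ^ 2 +
        c * L * (6 * C ^ 2 * (d * X) * ε + 288 * (T ^ 2)⁻¹))) ≤
      24 * c * ((1 + L) / T) + 2 * c * (e * Real.sqrt L) +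
        4 * c * C * (Real.sqrt (d * ε) * X) := by
  have hX0 : 0 ≤ X := by linarith
  have hL0 : 0 ≤ L := by linarith
  refine Real.sqrt_le_iff.2 ⟨by positivity, ?_⟩
  have p1 : (1 + 576 * c * L) * (T ^ 2)⁻¹ ≤ (24 * c * ((1 + L) / T)) ^ 2 := by
    have eq : (24 * c * ((1 + L) / T)) ^ 2 = 576 * c ^ 2 * (1 + L) ^ 2 * (T ^ 2)⁻¹ := by
      field_simp; ring
    rw [eq]
    refine mul_le_mul_of_nonneg_right ?_ (by positivity)
    have e1 : c ^ 2 * (1 + 2 * L) ≤ c ^ 2 * (1 + L) ^ 2 :=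
      mul_le_mul_of_nonneg_left (by nlinarith) (sq_nonneg _)
    have e2 : c * L ≤ c ^ 2 * L := mul_le_mul_of_nonneg_right hc1sq (by linarith)
    nlinarith
  have p2 : 2 * (c * L * e ^ 2) ≤ (2 * c * (e * Real.sqrt L)) ^ 2 := by
    have eq : (2 * c * (e * Real.sqrt L)) ^ 2 = 4 * c ^ 2 * (L * e ^ 2) := by
      rw [mul_pow, mul_pow e, Real.sq_sqrt (by linarith)]; ring
    rw [eq]
    have : 0 ≤ L * e ^ 2 := by positivity
    have := mul_le_mul_of_nonneg_right hc1sq this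
    nlinarith
  have p3 : 12 * c * L * C ^ 2 * (d * X) * ε ≤
      (4 * c * C * (Real.sqrt (d * ε) * X)) ^ 2 := by
    have eq : (4 * c * C * (Real.sqrt (d * ε) * X)) ^ 2 =
        16 * c ^ 2 * X * (C ^ 2 * (d * X) * ε) := by
      rw [mul_pow, mul_pow (Real.sqrt (d * ε)), Real.sq_sqrt (by positivity)]; ring
    rw [eq]
    have h0 : 0 ≤ C ^ 2 * (d * X) * ε := by positivity
    have h1 : 12 * c * L ≤ 16 * c ^ 2 * X := by
      have := mul_le_mul hc1sq hLX (by linarith) (by positivity)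
      have : 0 ≤ c ^ 2 * X := by positivity
      linarith
    have := mul_le_mul_of_nonneg_right h1 h0
    linarith
  have q1 : 0 ≤ 24 * c * ((1 + L) / T) := by positivity
  have q2 : 0 ≤ 2 * c * (e * Real.sqrt L) := by positivity
  have q3 : 0 ≤ 4 * c * C * (Real.sqrt (d * ε) * X) := by positivity
  have q4 := mul_nonneg q1 q2
  have q5 := mul_nonneg q1 q3
  have q6 := mul_nonneg q2 q3
  linarith

/-- The three distances `τ₁, τ₂, τ₃` of the comparison, collected into the three error terms. -/
theorem sum_error_le {c C B₁ B₂ B₃ u v τ₁ τ₂ τ₃ : ℝ} (hc : 1 ≤ c) (hC : 1 ≤ C) (hB₁ : 0 ≤ B₁)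
    (hB₂ : 0 ≤ B₂) (hB₃ : 0 ≤ B₃) (h₁ : τ₁ ≤ 2 * B₃) (h₂ : τ₂ ≤ 5 * B₁)
    (h₃ : τ₃ ≤ 240000 * c ^ 2 * B₁ + (24 * c * u + 2 * c * B₂ + 4 * c * C * v))
    (hu : u ≤ 9 * B₁) (hv : v ≤ 2 * B₃) :
    τ₁ + (τ₂ + τ₃) ≤ 300000 * c ^ 2 * C * (B₁ + B₂ + B₃) := by
  have hsq : c ≤ c ^ 2 := le_self_pow₀ hc two_ne_zero
  have hCC : c ^ 2 ≤ c ^ 2 * C := le_mul_of_one_le_right (by positivity) hC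
  have u1 : 24 * c * u ≤ 24 * c * (9 * B₁) := mul_le_mul_of_nonneg_left hu (by positivity)
  have u2 : 4 * c * C * v ≤ 4 * c * C * (2 * B₃) := mul_le_mul_of_nonneg_left hv (by positivity)
  have g1 : (5 + 240000 * c ^ 2 + 216 * c) * B₁ ≤ 300000 * (c ^ 2 * C) * B₁ :=
    mul_le_mul_of_nonneg_right (by linarith) hB₁
  have g2 : 2 * c * B₂ ≤ 300000 * (c ^ 2 * C) * B₂ :=
    mul_le_mul_of_nonneg_right (by linarith) hB₂
  have g3 : (2 + 8 * (c * C)) * B₃ ≤ 300000 * (c ^ 2 * C) * B₃ := by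
    refine mul_le_mul_of_nonneg_right ?_ hB₃
    have : c * C ≤ c ^ 2 * C := mul_le_mul_of_nonneg_right hsq (by linarith)
    linarith
  linarith

/-- The error bound, with an explicit constant. The target is compared with the mixture, the mixture
with the forward process at time `1`, and that with the output of the sampler. When the steps are
not small, `T` is bounded and the right-hand side exceeds one. -/
theorem tvDist_ddpmOutput_le {cR : ℝ} (hcR : 0 < cR) (hc₀ : 12 * cR + 44 ≤ c₀)
    (hc₁ : 4 < c₁ / c₀) (hC : 12 * cR + 44 ≤ Cclip) (hd : 1 ≤ d) (hT : 2 ≤ T)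
    (ρ : Measure (E d)) [IsProbabilityMeasure ρ] {ε εscore : ℝ} (hw : ∀ k, 0 < w k)
    (hw1 : ∑ k, w k = 1) (hε : tvDist ρ (gmm w μ) ≤ ε) (hμ : ∀ k, ‖μ k‖ ≤ (T : ℝ) ^ cR)
    (hs : ∀ t ∈ Finset.Icc 1 T, Measurable (s t)) (hεs : 0 ≤ εscore)
    (hsc : scoreError c₀ c₁ T ρ s ≤ ENNReal.ofReal (εscore ^ 2)) :
    tvDist ρ (ddpmOutput c₀ c₁ Cclip T s) ≤ 300000 * c₁ ^ 2 * Cclip *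
      (Real.log (K * T) ^ 2 * Real.log T ^ 2 / T + εscore * Real.sqrt (Real.log T) +
        Real.sqrt (d * ε) * Real.log (d * T) ^ (3 / 2 : ℝ)) := by
  have hPg := isProbabilityMeasure_gmm hw hw1 μ
  have hK : 1 ≤ K := by
    have := nonempty_of_sum_eq_one hw1
    exact Fin.pos_iff_nonempty.2 this
  have hPY : IsProbabilityMeasure (ddpmOutput c₀ c₁ Cclip T s) :=
    isProbabilityMeasure_ddpmLaw hs _ (by omega)
  have hc0p : 0 < c₀ := by linarith
  have hc14 : 4 * c₀ < c₁ := by rwa [lt_div_iff₀ hc0p] at hc₁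
  have hc1 : 1 ≤ c₁ := by linarith
  have hCc : 1 ≤ Cclip := by linarith
  have hT2 : (2 : ℝ) ≤ T := by exact_mod_cast hT
  have hT0 : (0 : ℝ) < T := by linarith
  have hd1 : (1 : ℝ) ≤ d := by exact_mod_cast hd
  have hε0 : 0 ≤ ε := (abs_nonneg _).trans ((abs_real_sub_le_tvDist ρ (gmm w μ) .empty).trans hε)
  have hlog2 := Real.log_two_gt_d9
  have hX := log_two_le_log_mul hd hT
  have hLX := log_le_log_mul hd hT
  have hL2 : Real.log 2 ≤ Real.log T := Real.log_le_log (by norm_num) hT2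
  obtain ⟨hLKT, hKKT⟩ := log_le_log_mul_and_one_add_log_le hK hT
  have hlogK : 0 ≤ Real.log K := Real.log_natCast_nonneg K
  have e32 : Real.log (d * T) ^ (3 / 2 : ℝ) = Real.log (d * T) * Real.sqrt (Real.log (d * T)) := by
    rw [show (3 / 2 : ℝ) = 1 + 1 / 2 by norm_num, Real.rpow_add (by linarith), Real.rpow_one,
      Real.sqrt_eq_rpow]
  rw [e32]
  set L := Real.log T with hL
  set X := Real.log (d * T)
  set M := Real.log (K * T)
  set B₁ := M ^ 2 * L ^ 2 / T with hB₁
  set B₂ := εscore * Real.sqrt L with hB₂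
  set B₃ := Real.sqrt (d * ε) * (X * Real.sqrt X) with hB₃
  have hL69 : 0.69 ≤ L := by linarith
  have hX69 : 0.69 ≤ X := by linarith
  obtain ⟨hL34, hL4⟩ := le_sq_mul_sq hL69
  have hB₁L : L ^ 2 * L ^ 2 / T ≤ B₁ := by
    rw [hB₁]
    refine div_le_div_of_nonneg_right (mul_le_mul_of_nonneg_right ?_ (sq_nonneg _)) hT0.le
    exact pow_le_pow_left₀ (by linarith) hLKT 2
  have hB₁0 : 0 ≤ B₁ := le_trans (by positivity) hB₁L
  have hB₂0 : 0 ≤ B₂ := by positivity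
  have hX0 : 0 ≤ X := by linarith
  have hB₃0 : 0 ≤ B₃ := by positivity
  have hCC : c₁ ^ 2 ≤ c₁ ^ 2 * Cclip := le_mul_of_one_le_right (by positivity) hCc
  have hc1sq : c₁ ≤ c₁ ^ 2 := by nlinarith
  have hl0 : 0 < c₁ * (L / T) := by positivity
  by_cases hl1 : c₁ * (L / T) ≤ 1 / 2
  swap
  · -- the bound exceeds one when the steps are not small
    refine (tvDist_le_one _ _).trans ?_
    push Not at hl1
    have h1 : c₁ * (L / T) ≤ c₁ ^ 2 * Cclip * (4 * B₁) := by
      refine mul_le_mul (by linarith) ?_ (by positivity) (by positivity)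
      calc L / T ≤ 4 * (L ^ 2 * L ^ 2) / T := div_le_div_of_nonneg_right hL34 hT0.le
        _ ≤ 4 * B₁ := by rw [mul_div_assoc]; linarith
    have h2 : 0 ≤ c₁ ^ 2 * Cclip * B₁ := by positivity
    have h3 : 0 ≤ 300000 * c₁ ^ 2 * Cclip * (B₂ + B₃) := by positivity
    linarith
  have ha := alphaBarRev_mem (c₀ := c₀) (c₁ := c₁) hT hc0p hl0.le hl1 (T - 1)
  set a := alphaBarRev c₀ c₁ T (T - 1) with haa
  have hPa := isProbabilityMeasure_gmm hw hw1 fun k => Real.sqrt a • μ k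
  have t1 : tvDist ρ (gmm w μ) ≤ 2 * B₃ := by
    have h0 : 0 ≤ tvDist ρ (gmm w μ) :=
      (abs_nonneg _).trans (abs_real_sub_le_tvDist ρ (gmm w μ) .empty)
    have h2 := le_sqrt_mul_of_le h0 (tvDist_le_one ρ (gmm w μ)) hε hd1
    have h4 := (one_le_and_le_two_mul_mul_sqrt hX69).1
    have h5 := mul_le_mul_of_nonneg_left h4 (Real.sqrt_nonneg (d * ε))
    rw [hB₃]
    linarith
  have t2 : tvDist (gmm w μ) (gmm w fun k => Real.sqrt a • μ k) ≤ 5 * B₁ := by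
    have h1 : tvDist (gmm w μ) (gmm w fun k => Real.sqrt a • μ k) ≤ (1 : ℝ) / T := by
      refine tvDist_gmm_le hw hw1 (by positivity) fun k => ?_
      have e : μ k - Real.sqrt a • μ k = (1 - Real.sqrt a) • μ k := by module
      have hs1 : Real.sqrt a ≤ 1 := Real.sqrt_le_iff.2 ⟨zero_le_one, by linarith⟩
      have hs2 : a ≤ Real.sqrt a := Real.le_sqrt_of_sq_le (by nlinarith)
      rw [e, norm_smul, Real.norm_of_nonneg (by linarith)]
      have h2 := one_sub_alphaBarRev_last_le hT hc0p hl0.le hl1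
      calc (1 - Real.sqrt a) * ‖μ k‖ ≤ (T : ℝ) ^ (c₀ - c₁ / 3) * (T : ℝ) ^ cR :=
            mul_le_mul (by linarith) (hμ k) (norm_nonneg _) (by positivity)
        _ = (T : ℝ) ^ (c₀ - c₁ / 3 + cR) := (Real.rpow_add hT0 _ _).symm
        _ ≤ (T : ℝ) ^ (-1 : ℝ) :=
            Real.rpow_le_rpow_of_exponent_le (by linarith) (by linarith)
        _ = 1 / T := by rw [Real.rpow_neg_one, one_div]
    refine h1.trans ?_
    calc (1 : ℝ) / T ≤ 5 * (L ^ 2 * L ^ 2) / T :=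
          div_le_div_of_nonneg_right (by linarith) hT0.le
      _ ≤ 5 * B₁ := by rw [mul_div_assoc]; linarith
  have t3 := tvDist_gmm_ddpmOutput_le (Cclip := Cclip) hd hT hc0p hl0 hl1 (by linarith) hw hw1 hε
    (by linarith : 2 * cR + 2 ≤ c₀) hμ hs hsc
  have t4 := mul_sq_mul_sq_le (c := c₁) (L := L) (by linarith : 0 ≤ 1 + Real.log K) hKKT hT0
  have t5 := sqrt_divergence_le hc1sq hc1 hCc hL69 hLX hT0 hεs (Nat.cast_nonneg d) hε0
  have t6 : (1 + L) / T ≤ 9 * B₁ := by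
    calc (1 + L) / T ≤ 9 * (L ^ 2 * L ^ 2) / T :=
          div_le_div_of_nonneg_right (by linarith) hT0.le
      _ ≤ 9 * B₁ := by rw [mul_div_assoc]; linarith
  have t7 : Real.sqrt (d * ε) * X ≤ 2 * B₃ := by
    have h4 := (one_le_and_le_two_mul_mul_sqrt hX69).2
    have := mul_le_mul_of_nonneg_left h4 (Real.sqrt_nonneg (d * ε))
    rw [hB₃]
    linarith
  have t8 := (tvDist_triangle ρ (gmm w μ) (ddpmOutput c₀ c₁ Cclip T s)).trans
    (add_le_add le_rfl (tvDist_triangle (gmm w μ) (gmm w fun k => Real.sqrt a • μ k)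
      (ddpmOutput c₀ c₁ Cclip T s)))
  exact t8.trans (sum_error_le hc1 hCc hB₁0 hB₂0 hB₃0 t1 t2 (t3.trans (add_le_add t4 t5)) t6 t7)

/-- The first term of the error bound is at most `ε` when `T` exceeds the stated number of
iterations. With `x = ε T` and `l = log (e K / ε)`, both logarithms are at most `log x + l`, so that
it suffices to compare `log⁴ x + l⁴` with `x`. -/
theorem mul_sq_log_mul_sq_log_div_le {A ε : ℝ} (hA : 1 ≤ A) (hK : 1 ≤ K) (hε0 : 0 < ε)
    (hε1 : ε < 1) (hT : (65536 * A) ^ 2 * Real.log (Real.exp 1 * K / ε) ^ 4 / ε ≤ T) :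
    2 ≤ T ∧ A * (Real.log (K * T) ^ 2 * Real.log T ^ 2 / T) ≤ ε := by
  have hK1 : (1 : ℝ) ≤ K := by exact_mod_cast hK
  have hK0 : (0 : ℝ) < K := by linarith
  have hlogK := Real.log_nonneg hK1
  have hlogε : Real.log ε ≤ 0 := Real.log_nonpos hε0.le hε1.le
  have el : Real.log (Real.exp 1 * K / ε) = 1 + Real.log K - Real.log ε := by
    rw [Real.log_div (by positivity) hε0.ne', Real.log_mul (Real.exp_pos 1).ne' hK0.ne',
      Real.log_exp]
  rw [el] at hT
  set l := 1 + Real.log K - Real.log ε with hl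
  have hl1 : 1 ≤ l := by linarith
  set x := ε * T with hx
  have hxl : (65536 * A) ^ 2 * l ^ 4 ≤ x := by
    rw [div_le_iff₀ hε0] at hT
    linarith
  have hl4 : 1 ≤ l ^ 4 := one_le_pow₀ hl1
  have hxA : (65536 * A) ^ 2 ≤ x := le_trans (le_mul_of_one_le_right (by positivity) hl4) hxl
  have hA2 : 65536 ≤ (65536 * A) ^ 2 := by nlinarith
  have hA16 : 16 * A ≤ (65536 * A) ^ 2 := by nlinarith
  have hx1 : 1 ≤ x := by linarith
  have hx0 : 0 < x := by linarith
  have hxT : x ≤ T := by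
    rw [hx]
    exact mul_le_of_le_one_left (Nat.cast_nonneg T) hε1.le
  have hT0 : (0 : ℝ) < T := by linarith
  have hT2 : (2 : ℝ) ≤ T := by linarith
  refine ⟨by exact_mod_cast hT2, ?_⟩
  have hlx : 0 ≤ Real.log x := Real.log_nonneg hx1
  have hLT : Real.log T = Real.log x - Real.log ε := by
    rw [hx, Real.log_mul hε0.ne' hT0.ne']; ring
  have hL0 : 0 ≤ Real.log T := Real.log_natCast_nonneg T
  have hL : Real.log T ≤ Real.log x + l := by linarith
  have hM : Real.log (K * T) ≤ Real.log x + l := by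
    rw [Real.log_mul hK0.ne' hT0.ne']; linarith
  have hM0 : 0 ≤ Real.log (K * T) := by
    rw [Real.log_mul hK0.ne' hT0.ne']; linarith
  -- `log x ≤ 8 x ^ (1 / 8)`
  have hlog : Real.log x ^ 4 ≤ 4096 * Real.sqrt x := by
    have h := Real.log_le_rpow_div hx0.le (by norm_num : (0 : ℝ) < 1 / 8)
    have h2 := pow_le_pow_left₀ hlx h 4
    refine h2.trans (le_of_eq ?_)
    rw [div_pow, ← Real.rpow_mul_natCast hx0.le, Real.sqrt_eq_rpow]
    norm_num
    ring
  have hsq : 65536 * A ≤ Real.sqrt x := Real.le_sqrt_of_sq_le hxA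
  have hsx : Real.sqrt x * Real.sqrt x = x := Real.mul_self_sqrt hx0.le
  have hprod : Real.log (K * T) ^ 2 * Real.log T ^ 2 ≤ 8 * Real.log x ^ 4 + 8 * l ^ 4 := by
    have h1 : Real.log (K * T) ^ 2 * Real.log T ^ 2 ≤
        (Real.log x + l) ^ 2 * (Real.log x + l) ^ 2 :=
      mul_le_mul (pow_le_pow_left₀ hM0 hM 2) (pow_le_pow_left₀ hL0 hL 2) (sq_nonneg _)
        (sq_nonneg _)
    exact h1.trans (add_sq_mul_add_sq_le _ _)
  have hA1 : 8 * A * Real.log x ^ 4 ≤ x / 2 := by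
    have h1 : 8 * A * Real.log x ^ 4 ≤ 8 * A * (4096 * Real.sqrt x) :=
      mul_le_mul_of_nonneg_left hlog (by linarith)
    have h2 := mul_le_mul_of_nonneg_right hsq (Real.sqrt_nonneg x)
    linarith
  have hA3 : 8 * A * l ^ 4 ≤ x / 2 := by
    have := mul_le_mul_of_nonneg_right hA16 (by positivity : 0 ≤ l ^ 4)
    linarith
  rw [← mul_div_assoc, div_le_iff₀ hT0]
  have := mul_le_mul_of_nonneg_left hprod (by linarith : 0 ≤ A)
  linarith

end Bound

end DDPM

end

open DDPM in
theorem theorem1 (cR : ℝ) (hcR : 0 < cR) :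
    ∃ m : ℝ, 0 < m ∧ ∀ c₀ c₁ Cclip : ℝ, m ≤ c₀ → m ≤ c₁ → 4 < c₁ / c₀ → m ≤ Cclip →
    ∃ C : ℝ, 0 < C ∧
      -- the error bound
      (∀ (d K T : ℕ), 1 ≤ d → 2 ≤ T →
        ∀ (ρ : Measure (E d)) [IsProbabilityMeasure ρ]
          (w : Fin K → ℝ) (μ : Fin K → E d) (s : ℕ → E d → E d) (εapprx εscore : ℝ),
        (∀ k, 0 < w k) → ∑ k, w k = 1 →
        tvDist ρ (gmm w μ) ≤ εapprx →
        (∀ k, ‖μ k‖ ≤ (T : ℝ) ^ cR) →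
        (∀ t ∈ Finset.Icc 1 T, Measurable (s t)) →
        0 ≤ εscore → scoreError c₀ c₁ T ρ s ≤ ENNReal.ofReal (εscore ^ 2) →
        tvDist ρ (ddpmOutput c₀ c₁ Cclip T s) ≤
          C * (Real.log (K * T) ^ 2 * Real.log T ^ 2 / T
            + εscore * Real.sqrt (Real.log T)
            + Real.sqrt (d * εapprx) * Real.log (d * T) ^ (3 / 2 : ℝ))) ∧
      -- the iteration complexity for exact mixtures and perfect scores
      (∀ (d K T : ℕ), 1 ≤ d →
        ∀ (w : Fin K → ℝ) (μ : Fin K → E d) (s : ℕ → E d → E d) (ε : ℝ),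
        (∀ k, 0 < w k) → ∑ k, w k = 1 →
        (∀ k, ‖μ k‖ ≤ (T : ℝ) ^ cR) →
        (∀ t ∈ Finset.Icc 1 T, Measurable (s t)) →
        scoreError c₀ c₁ T (gmm w μ) s = 0 →
        0 < ε → ε < 1 →
        C * Real.log (Real.exp 1 * K / ε) ^ 4 / ε ≤ T →
        tvDist (gmm w μ) (ddpmOutput c₀ c₁ Cclip T s) ≤ ε) := by
  refine ⟨12 * cR + 44, by linarith, fun c₀ c₁ Cclip hc₀ hc₁ hratio hC => ?_⟩
  -- `A` suffices for the error bound; its square absorbs the logarithms in the iteration count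
  set A := 300000 * c₁ ^ 2 * Cclip with hA
  have h1 : 1 ≤ c₁ ^ 2 := one_le_pow₀ (by linarith)
  have h2 : 1 ≤ c₁ ^ 2 * Cclip := one_le_mul_of_one_le_of_one_le h1 (by linarith)
  have hA1 : 1 ≤ A := by rw [hA]; linarith
  refine ⟨(65536 * A) ^ 2, by positivity, ?_, ?_⟩
  · intro d K T hd hT ρ _ w μ s ε εscore hw hw1 hε hμ hs hεs hsc
    refine (tvDist_ddpmOutput_le hcR hc₀ hratio hC hd hT ρ hw hw1 hε hμ hs hεs hsc).trans ?_
    refine mul_le_mul_of_nonneg_right (by nlinarith) ?_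
    have : 0 ≤ Real.log (d * T) := by
      have := log_two_le_log_mul hd hT
      have := Real.log_two_gt_d9
      linarith
    positivity
  · intro d K T hd w μ s ε hw hw1 hμ hs hsc hε0 hε1 hT
    have hK : 1 ≤ K := Fin.pos_iff_nonempty.2 (nonempty_of_sum_eq_one hw1)
    have := isProbabilityMeasure_gmm hw hw1 μ
    obtain ⟨hT2, hle⟩ := mul_sq_log_mul_sq_log_div_le hA1 hK hε0 hε1 hT
    have hself : tvDist (gmm w μ) (gmm w μ) ≤ 0 := tvDist_le_of_forall_le fun A _ => by simp
    have h := tvDist_ddpmOutput_le hcR hc₀ hratio hC hd hT2 (gmm w μ) hw hw1 hself hμ hs le_rfl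
      (by rw [hsc]; exact zero_le)
    simp only [mul_zero, zero_mul, Real.sqrt_zero, add_zero] at h
    exact h.trans hle
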